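/- Let $\Omega\subset\mathbb R^2$ be a bounded polygonal domain (open, equal to the interior of its closure), $0<\alpha\le\beta$, $c_1>0$, and let $l\ge 0$ and $n\ge l+1$ be integers. Fix one of the element families RT, BDM, BDFM, given on a triangle $T$ by $D_l(T)=P_l$ and $$M_l(T)=P_l^2+P_l\,x\ \text{(RT)},\qquad M_l(T)=P_{l+1}^2\ \text{(BDM)},\qquad M_l(T)=\{q\in P_{l+1}^2:\ (q\cdot\nu)|_E\in P_l(E)\text{ for every edge }E\subset\partial T\}\ \text{(BDFM)},$$ where $P_m$ denotes the polynomials of total degree at most $m$ and $\nu$ a unit normal. There is a constant $C>0$, depending only on $\Omega,\alpha,\beta,c_1,l,n$ and the element family (in particular not on the mesh size), such that the following holds. Let $A$ be a measurable field of symmetric $2\times 2$ matrices on $\Omega$ with $\alpha|\xi|^2\le \xi\cdot A(x)\xi\le\beta|\xi|^2$ for all $\xi\in\mathbb R^2$ and almost every $x\in\Omega$, let $f\in L^2(\Omega)$, let $u\in H^1_0(\Omega)$ and $p\in H(\mathrm{div},\Omega)$ satisfy $p=A\nabla u$ and $-\mathrm{div}\,p=f$ in $\Omega$, and let $0\le\kappa\le1$.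 Let $\mathcal T_h$ be a conforming triangulation of $\overline\Omega$ with $c_1^{-1}h_T^2\le|T|\le c_1h_T^2$ for all $T\in\mathcal T_h$, where $h_T=\mathrm{diam}\,T$. Put $$M_h=\{q\in H(\mathrm{div},\Omega): q|_T\in M_l(T)\ \forall T\in\mathcal T_h\},\qquad L_h=\{v\in L^2(\Omega): v|_T\in P_l\ \forall T\in\mathcal T_h\},$$ let $f_h$ be the $L^2$ projection of $f$ onto $L_h$, and let $(p_h,u_h)\in M_h\times L_h$ satisfy $$(A^{-1}p_h,q_h)_{0,\Omega}+(\mathrm{div}\,q_h,u_h)_{0,\Omega}=0\quad\forall q_h\in M_h,\qquad (\mathrm{div}\,p_h,v_h)_{0,\Omega}=-(f_h,v_h)_{0,\Omega}\quad\forall v_h\in L_h.$$ Assume that $A^{-1}p_h|_T\in H^1(T)^2$ for all $T\in\mathcal T_h$ (so that the quantities below are defined); $A^{-1}p_h$ is not assumed to be a piecewise polynomial. Let $\mathcal E_h$ be the set of all edges and $h_E$ the length of $E\in\mathcal E_h$, and write $\tau$ for a unit tangent of $E$. For an interior edge $E=T_+\cap T_-$ let $J(v)|_E$ be the difference of the traces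 on $E$ of $v|_{T_+}$ and $v|_{T_-}$, and for $E\subset\partial\Omega$ the trace of $v|_T$, with $T$ the triangle that has the edge $E$. Let $\mathrm{curl}\,\psi=\partial\psi_2/\partial x_1-\partial\psi_1/\partial x_2$, applied on each triangle $T$, let $\nabla_h$ be the gradient taken on each triangle, and put $$\eta_{h,\kappa}^2=\sum_{T\in\mathcal T_h}\Big(\|h_T^{\kappa}(f+\mathrm{div}\,p_h)\|_{L^2(T)}^2+h_T^2\|\mathrm{curl}(A^{-1}p_h)\|_{L^2(T)}^2+\sum_{E\subset\partial T}h_E\|J(A^{-1}p_h\cdot\tau)\|_{L^2(E)}^2+h_T^2\|A^{-1}p_h-\nabla_hu_h\|_{L^2(T)}^2\Big),$$ $$\widetilde{\mathrm{osc}}_h^2=\sum_{T\in\mathcal T_h}h_T^2\|(\mathrm{id}-\Pi_n)\mathrm{curl}(A^{-1}p_h)\|_{L^2(T)}^2+\sum_{E\in\mathcal E_h}h_E\|(\mathrm{id}-\Pi_{n+1})J(A^{-1}p_h\cdot\tau)\|_{L^2(E)}^2+\sum_{T\in\mathcal T_h}h_T^2\|(\mathrm{id}-\Pi_n)(A^{-1}p_h-\nabla_hu_h)\|_{L^2(T)}^2,$$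 where $\Pi_m$ is the best $L^2$ approximation by polynomials of degree at most $m$ on the triangle or edge in question (componentwise for vector fields). Then $$\eta_{h,\kappa}^2\le C\Big(\|A^{-1/2}(p-p_h)\|_{L^2(\Omega)}^2+\sum_{T\in\mathcal T_h}\|h_T^{\kappa}\,\mathrm{div}(p-p_h)\|_{L^2(T)}^2+\|u-u_h\|_{L^2(\Omega)}^2+\widetilde{\mathrm{osc}}_h^2\Big).$$ -/

import Mathlib

open MeasureTheory Filter Topology
open scoped ContDiff

noncomputable section

namespace MixedFEM

/-- The Euclidean plane. -/
abbrev Plane : Type := EuclideanSpace ℝ (Fin 2)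

/-- The action of a `2 × 2` matrix on a vector of the plane. -/
def app (B : Matrix (Fin 2) (Fin 2) ℝ) (v : Plane) : Plane := WithLp.toLp 2 (B.mulVec v.ofLp)

/-! ### Sobolev spaces and weak differential operators on an open set `U` -/

/-- Classical partial derivative `∂φ/∂xᵢ`. -/
def pderiv (i : Fin 2) (φ : Plane → ℝ) (x : Plane) : ℝ :=
  fderiv ℝ φ x (EuclideanSpace.single i 1)

/-- `φ ∈ C_c^∞(U)`. -/
def IsTest (U : Set Plane) (φ : Plane → ℝ) : Prop :=
  ContDiff ℝ ∞ φ ∧ HasCompactSupport φ ∧ tsupport φ ⊆ U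

/-- `g ∈ L²(U)`, for scalar and for vector functions. -/
def MemL2 {F : Type*} [NormedAddCommGroup F] (U : Set Plane) (g : Plane → F) : Prop :=
  MemLp g 2 (volume.restrict U)

/-- `‖g‖²_{L²(U)}`, for scalar and for vector functions. -/
def normSq {F : Type*} [NormedAddCommGroup F] (U : Set Plane) (g : Plane → F) : ℝ :=
  ∫ x in U, ‖g x‖ ^ 2

/-- `∇v = G` in the sense of distributions on `U`. -/
def HasWeakGrad (U : Set Plane) (v : Plane → ℝ) (G : Plane → Plane) : Prop :=
  ∀ φ, IsTest U φ → ∀ i, ∫ x in U, v x * pderiv i φ x = -∫ x in U, G x i * φ x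

/-- `div q = d` in the sense of distributions on `U`. -/
def HasWeakDiv (U : Set Plane) (q : Plane → Plane) (d : Plane → ℝ) : Prop :=
  ∀ φ, IsTest U φ →
    ∫ x in U, (q x 0 * pderiv 0 φ x + q x 1 * pderiv 1 φ x) = -∫ x in U, d x * φ x

/-- `curl ψ = ∂ψ₂/∂x₁ - ∂ψ₁/∂x₂ = c` in the sense of distributions on `U`
(coordinates are numbered `0, 1` in the code). -/
def HasWeakCurl (U : Set Plane) (ψ : Plane → Plane) (c : Plane → ℝ) : Prop :=
  ∀ φ, IsTest U φ →
    ∫ x in U, (ψ x 1 * pderiv 0 φ x - ψ x 0 * pderiv 1 φ x) = -∫ x in U, c x * φ x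

open Classical in
/-- The distributional gradient on `U` (unique up to null sets; `0` if it is not in `L²`). -/
def weakGrad (U : Set Plane) (v : Plane → ℝ) : Plane → Plane :=
  if h : ∃ G : Plane → Plane, MemL2 U G ∧ HasWeakGrad U v G then h.choose else 0

open Classical in
/-- The distributional divergence on `U` (unique up to null sets; `0` if it is not in `L²`). -/
def weakDiv (U : Set Plane) (q : Plane → Plane) : Plane → ℝ :=
  if h : ∃ d : Plane → ℝ, MemL2 U d ∧ HasWeakDiv U q d then h.choose else 0

open Classical in
/-- The distributional curl on `U` (unique up to null sets; `0` if it is not in `L²`). -/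
def weakCurl (U : Set Plane) (ψ : Plane → Plane) : Plane → ℝ :=
  if h : ∃ c : Plane → ℝ, MemL2 U c ∧ HasWeakCurl U ψ c then h.choose else 0

/-- `H¹(U)`. -/
def MemH1 (U : Set Plane) (v : Plane → ℝ) : Prop :=
  MemL2 U v ∧ ∃ G : Plane → Plane, MemL2 U G ∧ HasWeakGrad U v G

/-- `H(div, U)`. -/
def MemHDiv (U : Set Plane) (q : Plane → Plane) : Prop :=
  MemL2 U q ∧ ∃ d : Plane → ℝ, MemL2 U d ∧ HasWeakDiv U q d

/-- The smooth functions `φ k` converge to `v` in `H¹(U)`. -/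
def TendstoH1 (U : Set Plane) (φ : ℕ → Plane → ℝ) (v : Plane → ℝ) : Prop :=
  Tendsto (fun k => ∫ x in U, (φ k x - v x) ^ 2) atTop (𝓝 0) ∧
    ∀ i, Tendsto (fun k => ∫ x in U, (pderiv i (φ k) x - weakGrad U v x i) ^ 2) atTop (𝓝 0)

/-- `H¹₀(U)`: the closure of `C_c^∞(U)` in `H¹(U)`. -/
def MemH10 (U : Set Plane) (v : Plane → ℝ) : Prop :=
  MemH1 U v ∧ ∃ φ : ℕ → Plane → ℝ, (∀ k, IsTest U (φ k)) ∧ TendstoH1 U φ v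

/-- The arc length measure on a segment `S`. -/
def arc (S : Set Plane) : Measure Plane := (Measure.hausdorffMeasure 1).restrict S

/-- `g ∈ L²(S)` is the trace on the boundary segment `S` of `v ∈ H¹(U)`: the trace operator is the
continuous extension to `H¹(U)` of the restriction of smooth functions (of the whole plane). -/
def IsTrace (U S : Set Plane) (v g : Plane → ℝ) : Prop :=
  MemLp g 2 (arc S) ∧ ∃ φ : ℕ → Plane → ℝ, (∀ k, ContDiff ℝ ∞ (φ k)) ∧ TendstoH1 U φ v ∧
    Tendsto (fun k => ∫ x, (φ k x - g x) ^ 2 ∂(arc S)) atTop (𝓝 0)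

/-! ### Domain and triangulation -/

/-- The closed simplex with vertex set `s`: a triangle if `s` has three points, an edge if `s` has
two points. -/
def hull (s : Finset Plane) : Set Plane := convexHull ℝ (s : Set Plane)

/-- The open triangle with vertex set `T`. -/
def cell (T : Finset Plane) : Set Plane := interior (hull T)

/-- The diameter `h_T` of a triangle, or the length `h_E` of an edge. -/
def size (s : Finset Plane) : ℝ := Metric.diam (hull s)

/-- The vertex set `T` consists of the three corners of a nondegenerate triangle. -/
def IsTriangle (T : Finset Plane) : Prop :=
  T.card = 3 ∧ AffineIndependent ℝ ((↑) : T → Plane)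

/-- Bounded polygonal domains: the open sets that lie on one side of their boundary and whose closure
is a finite union of triangles. -/
def IsPolygonalDomain (Ω : Set Plane) : Prop :=
  IsOpen Ω ∧ Ω.Nonempty ∧ interior (closure Ω) = Ω ∧
    ∃ 𝒮 : Finset (Finset Plane), (∀ T ∈ 𝒮, IsTriangle T) ∧ ⋃ T ∈ 𝒮, hull T = closure Ω

/-- Conforming triangulations of the closure of `Ω`; a triangle is given by its vertices. -/
structure Triangulation (Ω : Set Plane) where
  /-- the triangles -/
  tri : Finset (Finset Plane)
  isTriangle : ∀ T ∈ tri, IsTriangle T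
  /-- two triangles meet in the convex hull of their common vertices: in the empty set, a common
  vertex or a common edge if they are distinct -/
  conforming : ∀ S ∈ tri, ∀ T ∈ tri, hull S ∩ hull T = convexHull ℝ ((S : Set Plane) ∩ T)
  cover : ⋃ T ∈ tri, hull T = closure Ω

/-- Shape regularity: `c₁⁻¹ h_T² ≤ |T| ≤ c₁ h_T²`. -/
def Triangulation.ShapeRegular {Ω : Set Plane} (𝒯 : Triangulation Ω) (c₁ : ℝ) : Prop :=
  ∀ T ∈ 𝒯.tri, c₁⁻¹ * size T ^ 2 ≤ (volume (hull T)).toReal ∧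
    (volume (hull T)).toReal ≤ c₁ * size T ^ 2

/-- The three edges of a triangle. -/
def edgesOf (T : Finset Plane) : Finset (Finset Plane) := T.powersetCard 2

open Classical in
/-- All the edges of a triangulation (interior and boundary ones), each taken once. -/
def Triangulation.edges {Ω : Set Plane} (𝒯 : Triangulation Ω) : Finset (Finset Plane) :=
  𝒯.tri.biUnion edgesOf

/-! ### Polynomials and mixed finite elements -/

/-- `g` is a polynomial function of total degree `≤ m` in two variables. -/
def IsPoly (m : ℕ) (g : Plane → ℝ) : Prop :=
  ∃ P : MvPolynomial (Fin 2) ℝ, P.totalDegree ≤ m ∧ ∀ x : Plane, g x = MvPolynomial.eval x.ofLp P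

/-- The families of Raviart-Thomas, Brezzi-Douglas-Marini and Brezzi-Douglas-Fortin-Marini
elements. -/
inductive Family
  | RT
  | BDM
  | BDFM

/-- The local spaces `M_l(T)`:
`P_l² + P_l x` for RT, `P_{l+1}²` for BDM, and `{q ∈ P_{l+1}² : q·ν ∈ P_l(E) for each edge E}`, with
`ν` a unit normal of the edge, for BDFM. A polynomial on an edge is the restriction to the edge of a
polynomial of the same degree on the plane. -/
def IsLocalFlux : Family → ℕ → Finset Plane → (Plane → Plane) → Prop
  | .RT, l, _, q => ∃ (a : Fin 2 → Plane → ℝ) (b : Plane → ℝ),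
      (∀ i, IsPoly l (a i)) ∧ IsPoly l b ∧ ∀ x i, q x i = a i x + b x * x i
  | .BDM, l, _, q => ∀ i, IsPoly (l + 1) (fun x => q x i)
  | .BDFM, l, T, q => (∀ i, IsPoly (l + 1) (fun x => q x i)) ∧
      ∀ E ∈ edgesOf T, ∀ ν : Plane, ‖ν‖ = 1 → (∀ a ∈ E, ∀ b ∈ E, inner ℝ ν (b - a) = 0) →
        ∃ r, IsPoly l r ∧ ∀ x ∈ hull E, inner ℝ (q x) ν = r x

variable {Ω : Set Plane}

/-- The flux space `M_h`. -/
def Triangulation.MemM (𝒯 : Triangulation Ω) (fam : Family) (l : ℕ) (q : Plane → Plane) : Prop :=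
  MemHDiv Ω q ∧ ∀ T ∈ 𝒯.tri, ∃ m, IsLocalFlux fam l T m ∧ q =ᵐ[volume.restrict (cell T)] m

/-- The displacement space `L_h`; `D_l(T) = P_l` for all three families. -/
def Triangulation.MemL (𝒯 : Triangulation Ω) (l : ℕ) (v : Plane → ℝ) : Prop :=
  MemL2 Ω v ∧ ∀ T ∈ 𝒯.tri, ∃ m, IsPoly l m ∧ v =ᵐ[volume.restrict (cell T)] m

/-! ### The continuous and the discrete problem -/

/-- `A` is measurable, symmetric, and has its spectrum in `[α, β]`, almost everywhere in `Ω`. -/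
def IsCoefficient (Ω : Set Plane) (α β : ℝ) (A : Plane → Matrix (Fin 2) (Fin 2) ℝ) : Prop :=
  (∀ i j, AEMeasurable (fun x => A x i j) (volume.restrict Ω)) ∧
    ∀ᵐ x ∂(volume.restrict Ω), (A x).IsSymm ∧
      ∀ ξ : Plane, α * ‖ξ‖ ^ 2 ≤ inner ℝ ξ (app (A x) ξ) ∧ inner ℝ ξ (app (A x) ξ) ≤ β * ‖ξ‖ ^ 2

/-- The field `A⁻¹ q`. -/
def invApp (A : Plane → Matrix (Fin 2) (Fin 2) ℝ) (q : Plane → Plane) (x : Plane) : Plane :=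
  app (A x)⁻¹ (q x)

/-- `‖A^{-1/2} q‖²_{L²(Ω)} = ∫_Ω A⁻¹ q · q`. -/
def energySq (Ω : Set Plane) (A : Plane → Matrix (Fin 2) (Fin 2) ℝ) (q : Plane → Plane) : ℝ :=
  ∫ x in Ω, inner ℝ (invApp A q x) (q x)

/-- `(p, u)` solves `-div p = f`, `p = A ∇u` in `Ω` and `u = 0` on `∂Ω`. -/
def IsSolution (Ω : Set Plane) (A : Plane → Matrix (Fin 2) (Fin 2) ℝ) (f : Plane → ℝ)
    (p : Plane → Plane) (u : Plane → ℝ) : Prop :=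
  MemH10 Ω u ∧ MemHDiv Ω p ∧ (∀ᵐ x ∂(volume.restrict Ω), p x = app (A x) (weakGrad Ω u x)) ∧
    HasWeakDiv Ω p (fun x => -f x)

/-- `(p_h, u_h)` solves the mixed finite element equations; `fh` is the `L²` projection of `f` onto
`L_h`. -/
def Triangulation.IsDiscreteSolution (𝒯 : Triangulation Ω) (fam : Family) (l : ℕ)
    (A : Plane → Matrix (Fin 2) (Fin 2) ℝ) (f : Plane → ℝ)
    (ph : Plane → Plane) (uh : Plane → ℝ) : Prop :=
  𝒯.MemM fam l ph ∧ 𝒯.MemL l uh ∧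
    (∀ q, 𝒯.MemM fam l q →
      (∫ x in Ω, inner ℝ (invApp A ph x) (q x)) + ∫ x in Ω, weakDiv Ω q x * uh x = 0) ∧
    ∃ fh : Plane → ℝ, 𝒯.MemL l fh ∧ (∀ v, 𝒯.MemL l v → ∫ x in Ω, (f x - fh x) * v x = 0) ∧
      ∀ v, 𝒯.MemL l v → ∫ x in Ω, weakDiv Ω ph x * v x = -∫ x in Ω, fh x * v x

/-! ### Jumps, estimator and oscillation -/

/-- Every component of the field `σ` belongs to `H¹(T)`, for every triangle `T`. -/
def Triangulation.PiecewiseH1 (𝒯 : Triangulation Ω) (σ : Plane → Plane) : Prop :=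
  ∀ T ∈ 𝒯.tri, ∀ i, MemH1 (cell T) (fun x => σ x i)

/-- `γ T E` is the trace on the edge `E` of the restriction of the field `σ` to the triangle `T`,
for every triangle `T` and every edge `E` of `T`. -/
def Triangulation.IsTraceFamily (𝒯 : Triangulation Ω) (σ : Plane → Plane)
    (γ : Finset Plane → Finset Plane → Plane → Plane) : Prop :=
  ∀ T ∈ 𝒯.tri, ∀ E ∈ edgesOf T, ∀ i,
    IsTrace (cell T) (hull E) (fun x => σ x i) (fun x => γ T E x i)

open Classical in
/-- A unit tangent vector of the edge `E`; its sign is arbitrary. -/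
def tangent (E : Finset Plane) : Plane :=
  if h : ∃ z : Plane × Plane, z.1 ≠ z.2 ∧ (E : Set Plane) = {z.1, z.2} then
    ‖h.choose.2 - h.choose.1‖⁻¹ • (h.choose.2 - h.choose.1) else 0

open Classical in
/-- The jump over the edge `E` of a field with traces `γ`: the difference of the traces from the two
triangles `T₊`, `T₋` that share `E` (in an arbitrary order), or the trace from the one triangle that
has the edge `E`, if `E` lies on the boundary. -/
def Triangulation.jump (𝒯 : Triangulation Ω) (γ : Finset Plane → Finset Plane → Plane → Plane)
    (E : Finset Plane) (x : Plane) : Plane :=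
  if h : ∃ z : Finset Plane × Finset Plane,
      z.1 ∈ 𝒯.tri ∧ z.2 ∈ 𝒯.tri ∧ z.1 ≠ z.2 ∧ E ⊆ z.1 ∧ E ⊆ z.2 then
    γ h.choose.1 E x - γ h.choose.2 E x
  else if h : ∃ T, T ∈ 𝒯.tri ∧ E ⊆ T then γ h.choose E x else 0

/-- The jump of the tangential component. It is determined up to its sign, on which nothing below
depends. -/
def Triangulation.tangentialJump (𝒯 : Triangulation Ω)
    (γ : Finset Plane → Finset Plane → Plane → Plane) (E : Finset Plane) (x : Plane) : ℝ :=
  inner ℝ (𝒯.jump γ E x) (tangent E)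

open Classical in
/-- `Π_m g`: the best approximation of `g` in `L²(μ)` by polynomials of degree `≤ m`, where `μ` is
the area on a triangle or the arc length on an edge (unique up to null sets; `0` if there is none,
which does not happen for `g ∈ L²(μ)`). -/
def bestApprox (μ : Measure Plane) (m : ℕ) (g : Plane → ℝ) : Plane → ℝ :=
  if h : ∃ r, IsPoly m r ∧ ∀ s, IsPoly m s → eLpNorm (g - r) 2 μ ≤ eLpNorm (g - s) 2 μ
  then h.choose else 0

/-- `‖(id - Π_m) g‖²_{L²(μ)}`. -/
def oscSq (μ : Measure Plane) (m : ℕ) (g : Plane → ℝ) : ℝ :=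
  ∫ x, (g x - bestApprox μ m g x) ^ 2 ∂μ

/-- The field `A⁻¹ p_h - ∇_h u_h` on the triangle `T`. -/
def gradResidual (A : Plane → Matrix (Fin 2) (Fin 2) ℝ) (ph : Plane → Plane) (uh : Plane → ℝ)
    (T : Finset Plane) (x : Plane) : Plane :=
  invApp A ph x - weakGrad (cell T) uh x

/-- The local error estimator `η²_{T,κ}`; `γ` are the traces of `A⁻¹ p_h`. -/
def Triangulation.etaLocalSq (𝒯 : Triangulation Ω) (κ : ℝ)
    (A : Plane → Matrix (Fin 2) (Fin 2) ℝ) (f : Plane → ℝ) (ph : Plane → Plane) (uh : Plane → ℝ)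
    (γ : Finset Plane → Finset Plane → Plane → Plane) (T : Finset Plane) : ℝ :=
  normSq (cell T) (fun x => size T ^ κ * (f x + weakDiv Ω ph x))
    + size T ^ 2 * normSq (cell T) (weakCurl (cell T) (invApp A ph))
    + ∑ E ∈ edgesOf T, size E * ∫ x, 𝒯.tangentialJump γ E x ^ 2 ∂(arc (hull E))
    + size T ^ 2 * normSq (cell T) (gradResidual A ph uh T)

/-- The error estimator `η²_{h,κ}`. -/
def Triangulation.etaSq (𝒯 : Triangulation Ω) (κ : ℝ)
    (A : Plane → Matrix (Fin 2) (Fin 2) ℝ) (f : Plane → ℝ) (ph : Plane → Plane) (uh : Plane → ℝ)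
    (γ : Finset Plane → Finset Plane → Plane → Plane) : ℝ :=
  ∑ T ∈ 𝒯.tri, 𝒯.etaLocalSq κ A f ph uh γ T

/-- The oscillation of data, squared; vector fields are projected componentwise, and `γ` are the
traces of `A⁻¹ p_h`. -/
def Triangulation.dataOscSq (𝒯 : Triangulation Ω) (n : ℕ)
    (A : Plane → Matrix (Fin 2) (Fin 2) ℝ) (ph : Plane → Plane) (uh : Plane → ℝ)
    (γ : Finset Plane → Finset Plane → Plane → Plane) : ℝ :=
  (∑ T ∈ 𝒯.tri, size T ^ 2 *
      oscSq (volume.restrict (cell T)) n (weakCurl (cell T) (invApp A ph)))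
    + (∑ E ∈ 𝒯.edges, size E * oscSq (arc (hull E)) (n + 1) (𝒯.tangentialJump γ E))
    + ∑ T ∈ 𝒯.tri, size T ^ 2 *
      ∑ i, oscSq (volume.restrict (cell T)) n (fun x => gradResidual A ph uh T x i)

/-- `‖h^κ g‖²_{L²(Ω)}` with the mesh size function `h = h_T` on `T`. -/
def Triangulation.weightedNormSq (𝒯 : Triangulation Ω) (κ : ℝ) (g : Plane → ℝ) : ℝ :=
  ∑ T ∈ 𝒯.tri, normSq (cell T) (fun x => size T ^ κ * g x)

end MixedFEM

end

open MixedFEM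

/-! Write `σ = A⁻¹ p_h` and `G = ∇u`. Because `p = A ∇u`, the error `G - σ` is `A⁻¹ (p - p_h)`, and
coercivity bounds its squared L² norm by `α⁻¹` times the energy error. Each residual is then tested
with a bubble function and rewritten as a pairing with the errors.

The equilibrium residual needs no bubble: `div p = -f` makes it minus the divergence of `p - p_h`.
For the curl residual, `∇u` is curl-free in the sense of distributions, so testing `curl σ` with an
interior bubble `ψ` leaves only `G - σ` against first derivatives of `ψ`. The gradient residual is
`∇(u - u_h) - (G - σ)`; integrating the first term by parts moves the derivative to `ψ`. Derivatives
of `ψ` cost a factor `1/h_T`, which the weights `h_T²` absorb. The term `h_T² ‖G - σ‖²` that remains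
is bounded through `h_T ≤ diam Ω`.

For the jumps, Green's formula on each triangle at an edge expresses the tangential trace of `σ`,
tested with an edge bubble, through `curl σ` and `σ` on that triangle. Subtracting the same pairing
of `G` replaces `σ` by `σ - G`. The pairings of `G` disappear in the sum over the triangles at the
edge: approximate `u` by test functions `φ_k` of `Ω`, for which Green's formula leaves the
tangential derivative of `φ_k` on the edge, multiplied by the orientation sign of the triangle. The
signs of two neighbours are opposite since the mesh is conforming (`Triangulation.det2_mul_neg`),
and on a boundary edge `φ_k` vanishes (`Triangulation.notMem_of_boundary`).

As `σ` need not be piecewise polynomial, the bubble is built from a polynomial `r` of fixed degree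
instead of from the residual `g` itself; `g - r` is what the oscillation measures, and
`integral_sq_le_of_bubble` accounts for it. Norm equivalence on finite dimensional spaces over the
reference triangle (`exists_integral_sq_le`) gives the constants, and affine maps controlled by
shape regularity carry them to each triangle. In the final sum an edge is counted at most twice and
a triangle has three edges. -/

noncomputable section

namespace MixedFEM

/-! ### Affine coordinates on a triangle -/

/-- The determinant of two vectors of the plane. -/
def det2 (v w : Plane) : ℝ := v 0 * w 1 - v 1 * w 0

/-- The affine map that sends `0`, `(1, 0)`, `(0, 1)` to `a`, `b`, `c`. -/
def affMap (a b c : Plane) (x : Plane) : Plane := a + (x 0 • (b - a) + x 1 • (c - a))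

/-- The inverse of `affMap a b c`. -/
def affCoord (a b c : Plane) (x : Plane) : Plane :=
  !₂[det2 (x - a) (c - a) / det2 (b - a) (c - a), det2 (b - a) (x - a) / det2 (b - a) (c - a)]

/-- The open reference triangle. -/
def refCell : Set Plane := {x | 0 < x 0 ∧ 0 < x 1 ∧ x 0 + x 1 < 1}

/-- The closed reference triangle. -/
def refHull : Set Plane := {x | 0 ≤ x 0 ∧ 0 ≤ x 1 ∧ x 0 + x 1 ≤ 1}

theorem affMap_apply (a b c x : Plane) (i : Fin 2) :
    affMap a b c x i = a i + (x 0 * (b i - a i) + x 1 * (c i - a i)) := by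
  simp [affMap]

theorem plane_ext {x y : Plane} (h0 : x 0 = y 0) (h1 : x 1 = y 1) : x = y := by
  ext i; fin_cases i <;> assumption

theorem affCoord_affMap {a b c : Plane} (h : det2 (b - a) (c - a) ≠ 0) (x : Plane) :
    affCoord a b c (affMap a b c x) = x := by
  apply plane_ext
  · simp only [affCoord, PiLp.toLp_apply, Matrix.cons_val_zero]
    rw [div_eq_iff h]; simp only [det2, PiLp.sub_apply, affMap_apply]; ring
  · simp only [affCoord, PiLp.toLp_apply, Matrix.cons_val_one, Matrix.cons_val_fin_one]
    rw [div_eq_iff h]; simp only [det2, PiLp.sub_apply, affMap_apply]; ring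

theorem affMap_affCoord {a b c : Plane} (h : det2 (b - a) (c - a) ≠ 0) (x : Plane) :
    affMap a b c (affCoord a b c x) = x := by
  have key : ∀ D E u v w z : ℝ, D * u + E * v = det2 (b - a) (c - a) * (z - w) →
      w + (D / det2 (b - a) (c - a) * u + E / det2 (b - a) (c - a) * v) = z := by
    intro D E u v w z hz
    have : D / det2 (b - a) (c - a) * u + E / det2 (b - a) (c - a) * v
        = (D * u + E * v) / det2 (b - a) (c - a) := by ring
    rw [this, hz, mul_div_cancel_left₀ _ h]; ring
  apply plane_ext
  · rw [affMap_apply]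
    apply key
    simp only [det2, PiLp.sub_apply]; ring
  · rw [affMap_apply]
    apply key
    simp only [det2, PiLp.sub_apply]; ring

theorem contDiff_affMap (a b c : Plane) : ContDiff ℝ ∞ (affMap a b c) := by
  unfold affMap; fun_prop

theorem contDiff_affCoord (a b c : Plane) : ContDiff ℝ ∞ (affCoord a b c) := by
  rw [contDiff_euclidean]
  intro i
  fin_cases i <;>
  · simp only [affCoord, det2, PiLp.toLp_apply, Fin.zero_eta, Fin.mk_one, Matrix.cons_val_zero,
      Matrix.cons_val_one, PiLp.sub_apply]
    fun_prop

/-- `affMap a b c` as a homeomorphism of the plane. -/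
def affHomeo (a b c : Plane) (h : det2 (b - a) (c - a) ≠ 0) : Plane ≃ₜ Plane where
  toFun := affMap a b c
  invFun := affCoord a b c
  left_inv := affCoord_affMap h
  right_inv := affMap_affCoord h
  continuous_toFun := (contDiff_affMap a b c).continuous
  continuous_invFun := (contDiff_affCoord a b c).continuous

theorem affMap_image_eq_preimage {a b c : Plane} (h : det2 (b - a) (c - a) ≠ 0) (s : Set Plane) :
    affMap a b c '' s = affCoord a b c ⁻¹' s :=
  (affHomeo a b c h).toEquiv.image_eq_preimage_symm s

theorem convex_refHull : Convex ℝ refHull := by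
  intro x hx y hy s t hs ht hst
  obtain ⟨x0, x1, x2⟩ := hx
  obtain ⟨y0, y1, y2⟩ := hy
  simp only [refHull, Set.mem_ofPred_eq, PiLp.add_apply, PiLp.smul_apply, smul_eq_mul]
  refine ⟨by positivity, by positivity, ?_⟩
  nlinarith [mul_le_mul_of_nonneg_left x2 hs, mul_le_mul_of_nonneg_left y2 ht]

theorem affMap_combo (a b c x y : Plane) {s t : ℝ} (hst : s + t = 1) :
    affMap a b c (s • x + t • y) = s • affMap a b c x + t • affMap a b c y := by
  have : t = 1 - s := by linarith
  subst this
  apply plane_ext <;> simp [affMap_apply] <;> ring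

theorem hull_eq_image (a b c : Plane) : hull {a, b, c} = affMap a b c '' refHull := by
  apply Set.Subset.antisymm
  · apply convexHull_min
    · intro x hx
      simp only [Finset.coe_insert, Finset.coe_singleton, Set.mem_insert_iff,
        Set.mem_singleton_iff] at hx
      rcases hx with rfl | rfl | rfl
      · exact ⟨!₂[0, 0], by simp [refHull], by apply plane_ext <;> simp [affMap_apply]⟩
      · exact ⟨!₂[1, 0], by simp [refHull], by apply plane_ext <;> simp [affMap_apply]⟩
      · exact ⟨!₂[0, 1], by simp [refHull], by apply plane_ext <;> simp [affMap_apply]⟩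
    · rintro _ ⟨x, hx, rfl⟩ _ ⟨y, hy, rfl⟩ s t hs ht hst
      exact ⟨s • x + t • y, convex_refHull hx hy hs ht hst, affMap_combo a b c x y hst⟩
  · rintro _ ⟨x, ⟨h0, h1, h2⟩, rfl⟩
    have hc : Convex ℝ (hull {a, b, c}) := convex_convexHull ℝ _
    have hs : ∀ z ∈ ({a, b, c} : Finset Plane), z ∈ hull {a, b, c} := fun z hz =>
      subset_convexHull ℝ _ hz
    have := hc.sum_mem (t := Finset.univ) (w := ![1 - x 0 - x 1, x 0, x 1]) (z := ![a, b, c])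
      (by intro i _; fin_cases i <;> simp <;> linarith)
      (by simp [Fin.sum_univ_three]; ring)
      (by intro i _; fin_cases i <;> apply hs <;> simp)
    convert this using 1
    apply plane_ext <;> simp [affMap_apply, Fin.sum_univ_three] <;> ring

/-- Preimages under an open map commute with interiors, nonzero linear functionals are open, and the
triangle is an intersection of three half-planes. -/
theorem interior_refHull : interior refHull = refCell := by
  have key : ∀ (f : Plane →ₗ[ℝ] ℝ), f ≠ 0 → interior (f ⁻¹' Set.Ici 0) = f ⁻¹' Set.Ioi 0 := by
    intro f hf
    have hs : Function.Surjective f := LinearMap.surjective hf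
    rw [← (f.isOpenMap_of_finiteDimensional hs).preimage_interior_eq_interior_preimage
      f.continuous_of_finiteDimensional, interior_Ici]
  have key' : ∀ (f : Plane →ₗ[ℝ] ℝ), f ≠ 0 → interior (f ⁻¹' Set.Iic 1) = f ⁻¹' Set.Iio 1 := by
    intro f hf
    have hs : Function.Surjective f := LinearMap.surjective hf
    rw [← (f.isOpenMap_of_finiteDimensional hs).preimage_interior_eq_interior_preimage
      f.continuous_of_finiteDimensional, interior_Iic]
  let p : Fin 2 → Plane →ₗ[ℝ] ℝ := fun i => (EuclideanSpace.proj i : Plane →L[ℝ] ℝ)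
  have e : refHull = (p 0 ⁻¹' Set.Ici 0 ∩ p 1 ⁻¹' Set.Ici 0) ∩ (p 0 + p 1) ⁻¹' Set.Iic 1 := by
    ext x; simp [refHull, p, and_assoc]
  have hp : ∀ i, p i ≠ 0 := fun i h => by
    have := LinearMap.congr_fun h (EuclideanSpace.single i 1)
    simp [p] at this
  rw [e, interior_inter, interior_inter, key _ (hp 0), key _ (hp 1), key']
  · ext x; simp [refCell, p, and_assoc]
  · intro h
    have := LinearMap.congr_fun h (EuclideanSpace.single 0 1)
    simp [p] at this

theorem cell_eq_image {a b c : Plane} (h : det2 (b - a) (c - a) ≠ 0) :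
    cell {a, b, c} = affMap a b c '' refCell := by
  rw [cell, hull_eq_image, ← interior_refHull]
  exact ((affHomeo a b c h).image_interior refHull).symm

theorem cell_eq_preimage {a b c : Plane} (h : det2 (b - a) (c - a) ≠ 0) :
    cell {a, b, c} = affCoord a b c ⁻¹' refCell := by
  rw [cell_eq_image h, affMap_image_eq_preimage h]

theorem hull_eq_preimage {a b c : Plane} (h : det2 (b - a) (c - a) ≠ 0) :
    hull {a, b, c} = affCoord a b c ⁻¹' refHull := by
  rw [hull_eq_image, affMap_image_eq_preimage h]

theorem isOpen_refCell : IsOpen refCell := interior_refHull ▸ isOpen_interior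

theorem isOpen_cell (T : Finset Plane) : IsOpen (cell T) := isOpen_interior

theorem isCompact_hull (T : Finset Plane) : IsCompact (hull T) :=
  (Finset.finite_toSet T).isCompact_convexHull ℝ

theorem cell_subset_hull (T : Finset Plane) : cell T ⊆ hull T := interior_subset

theorem refCell_subset_refHull : refCell ⊆ refHull := interior_refHull ▸ interior_subset

theorem isCompact_refHull : IsCompact refHull := by
  have h : det2 (EuclideanSpace.single 0 1 - (0 : Plane)) (EuclideanSpace.single 1 1 - 0) ≠ 0 := by
    simp [det2]
  have := (isCompact_hull {0, EuclideanSpace.single 0 1, EuclideanSpace.single 1 1}).image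
    (contDiff_affCoord 0 (EuclideanSpace.single 0 1) (EuclideanSpace.single 1 1)).continuous
  rwa [hull_eq_preimage h, Set.image_preimage_eq] at this
  exact (affHomeo _ _ _ h).symm.surjective

/-! ### Change of variables -/

/-- The linear part of `affMap a b c`. -/
def affLin (a b c : Plane) : Plane →L[ℝ] Plane :=
  (EuclideanSpace.proj 0 : Plane →L[ℝ] ℝ).smulRight (b - a)
    + (EuclideanSpace.proj 1 : Plane →L[ℝ] ℝ).smulRight (c - a)

theorem hasFDerivAt_affMap (a b c x : Plane) :
    HasFDerivAt (affMap a b c) (affLin a b c) x := by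
  have : affMap a b c = fun x => a + affLin a b c x := by
    ext x; simp [affMap, affLin]
  rw [this]
  exact (affLin a b c).hasFDerivAt.const_add a

theorem det_affLin (a b c : Plane) : (affLin a b c).det = det2 (b - a) (c - a) := by
  have : ((affLin a b c : Plane →L[ℝ] Plane) : Plane →ₗ[ℝ] Plane) =
      Matrix.toLin (EuclideanSpace.basisFun (Fin 2) ℝ).toBasis
        (EuclideanSpace.basisFun (Fin 2) ℝ).toBasis
        !![(b - a) 0, (c - a) 0; (b - a) 1, (c - a) 1] := by
    apply (EuclideanSpace.basisFun (Fin 2) ℝ).toBasis.ext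
    intro i
    rw [Matrix.toLin_self]
    apply plane_ext <;> fin_cases i <;> simp [affLin, Fin.sum_univ_two]
  rw [ContinuousLinearMap.det, this, LinearMap.det_toLin, Matrix.det_fin_two_of, det2]
  ring

theorem setIntegral_affMap_image {a b c : Plane} (h : det2 (b - a) (c - a) ≠ 0) {s : Set Plane}
    (hs : MeasurableSet s) (f : Plane → ℝ) :
    ∫ x in affMap a b c '' s, f x = |det2 (b - a) (c - a)| * ∫ x in s, f (affMap a b c x) := by
  rw [integral_image_eq_integral_abs_det_fderiv_smul volume hs
    (fun x _ => (hasFDerivAt_affMap a b c x).hasFDerivWithinAt)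
    ((affHomeo a b c h).injective.injOn), ← integral_const_mul]
  simp [det_affLin]

theorem setIntegral_cell {a b c : Plane} (h : det2 (b - a) (c - a) ≠ 0) (f : Plane → ℝ) :
    ∫ x in cell {a, b, c}, f x
      = |det2 (b - a) (c - a)| * ∫ x in refCell, f (affMap a b c x) := by
  rw [cell_eq_image h, setIntegral_affMap_image h isOpen_refCell.measurableSet]

/-- The unit square is a sufficient bound: the area only has to be bounded above by a multiple of
the determinant, so that shape regularity bounds the determinant below. -/
theorem volume_refHull_le : (volume refHull).toReal ≤ 1 := by
  have h1 : refHull ⊆ WithLp.ofLp ⁻¹' (Set.univ.pi fun _ : Fin 2 => Set.Icc (0 : ℝ) 1) := by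
    rintro x ⟨h0, h1, h2⟩
    simp only [Set.mem_preimage, Set.mem_pi, Set.mem_univ, true_imp_iff, Fin.forall_fin_two,
      Set.mem_Icc]
    refine ⟨⟨h0, by linarith⟩, h1, by linarith⟩
  have h2 := (PiLp.volume_preserving_ofLp (Fin 2)).measure_preimage
    (s := Set.univ.pi fun _ : Fin 2 => Set.Icc (0 : ℝ) 1)
    (MeasurableSet.univ_pi fun _ => measurableSet_Icc).nullMeasurableSet
  have h3 := measure_mono (μ := volume) h1
  rw [h2, volume_pi, Measure.pi_pi] at h3
  simp only [Real.volume_Icc, sub_zero, ENNReal.ofReal_one, Finset.prod_const_one] at h3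
  exact ENNReal.toReal_mono (by simp) h3

theorem volume_hull_le {a b c : Plane} (h : det2 (b - a) (c - a) ≠ 0) :
    (volume (hull {a, b, c})).toReal ≤ |det2 (b - a) (c - a)| := by
  have := setIntegral_affMap_image h (isCompact_refHull.measurableSet) (fun _ => 1)
  simp only [integral_const, smul_eq_mul, mul_one, Measure.real, Measure.restrict_apply_univ] at this
  rw [hull_eq_image, this]
  exact mul_le_of_le_one_right (abs_nonneg _) volume_refHull_le

/-! ### Integration over the reference triangle -/

theorem setIntegral_prod_triangle {G : ℝ × ℝ → ℝ} (hG : Continuous G) :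
    ∫ z in {z : ℝ × ℝ | 0 < z.1 ∧ 0 < z.2 ∧ z.1 + z.2 < 1}, G z
      = ∫ s in (0 : ℝ)..1, ∫ t in (0 : ℝ)..(1 - s), G (s, t) := by
  set R : Set (ℝ × ℝ) := {z | 0 < z.1 ∧ 0 < z.2 ∧ z.1 + z.2 < 1} with hR
  have hRo : IsOpen R := by
    apply (isOpen_lt continuous_const continuous_fst).inter
    exact (isOpen_lt continuous_const continuous_snd).inter
      (isOpen_lt (continuous_fst.add continuous_snd) continuous_const)
  have hRm := hRo.measurableSet
  have hsub : R ⊆ Set.Icc 0 1 ×ˢ Set.Icc 0 1 := by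
    rintro ⟨s, t⟩ ⟨h0, h1, h2⟩
    simp only at h0 h1 h2
    exact ⟨⟨h0.le, by linarith⟩, h1.le, by linarith⟩
  have hint : IntegrableOn G R :=
    (hG.continuousOn.integrableOn_compact (isCompact_Icc.prod isCompact_Icc)).mono_set hsub
  rw [← integral_indicator hRm, Measure.volume_eq_prod,
    integral_prod _ (by rw [← Measure.volume_eq_prod]; exact hint.integrable_indicator hRm),
    intervalIntegral.integral_of_le zero_le_one, integral_Ioc_eq_integral_Ioo,
    ← integral_indicator measurableSet_Ioo]
  congr 1
  ext s
  by_cases hs : s ∈ Set.Ioo (0 : ℝ) 1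
  · rw [Set.indicator_of_mem hs, intervalIntegral.integral_of_le (by linarith [hs.2]),
      integral_Ioc_eq_integral_Ioo, ← integral_indicator measurableSet_Ioo]
    congr 1
    ext t
    by_cases ht : t ∈ Set.Ioo 0 (1 - s)
    · rw [Set.indicator_of_mem ht, Set.indicator_of_mem]
      exact ⟨hs.1, ht.1, by simp only; linarith [ht.2]⟩
    · rw [Set.indicator_of_notMem ht, Set.indicator_of_notMem]
      rintro ⟨-, h1, h2⟩
      exact ht ⟨h1, by simp only at h2; linarith⟩
  · rw [Set.indicator_of_notMem hs]
    have : ∀ t, R.indicator G (s, t) = 0 := by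
      intro t
      rw [Set.indicator_of_notMem]
      rintro ⟨h0, h1, h2⟩
      simp only at h0 h1 h2
      exact hs ⟨h0, by linarith⟩
    simp [this]

theorem setIntegral_refCell_eq_prod (F : Plane → ℝ) :
    ∫ x in refCell, F x
      = ∫ z in {z : ℝ × ℝ | 0 < z.1 ∧ 0 < z.2 ∧ z.1 + z.2 < 1}, F !₂[z.1, z.2] := by
  have h1 := (EuclideanSpace.volume_preserving_symm_measurableEquiv_toLp (Fin 2))
  have h2 := (volume_preserving_finTwoArrow ℝ).comp h1
  have h3 : MeasurableEmbedding
      (MeasurableEquiv.finTwoArrow ∘ (MeasurableEquiv.toLp 2 (Fin 2 → ℝ)).symm : Plane → ℝ × ℝ) :=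
    MeasurableEquiv.finTwoArrow.measurableEmbedding.comp
      (MeasurableEquiv.toLp 2 (Fin 2 → ℝ)).symm.measurableEmbedding
  rw [← h2.setIntegral_preimage_emb h3]
  apply setIntegral_congr_fun isOpen_refCell.measurableSet
  intro x _
  simp only
  congr 1
  apply plane_ext <;> rfl

theorem continuous_pt : Continuous fun z : ℝ × ℝ => (!₂[z.1, z.2] : Plane) := by
  apply (PiLp.continuous_toLp 2 (fun _ : Fin 2 => ℝ)).comp
  apply continuous_pi
  intro i
  fin_cases i
  · exact continuous_fst
  · exact continuous_snd

theorem setIntegral_refCell {F : Plane → ℝ} (hF : Continuous F) :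
    ∫ x in refCell, F x = ∫ s in (0 : ℝ)..1, ∫ t in (0 : ℝ)..(1 - s), F !₂[s, t] := by
  rw [setIntegral_refCell_eq_prod]
  exact setIntegral_prod_triangle (hF.comp continuous_pt)

/-- The order of integration suited to derivatives in the first coordinate. -/
theorem setIntegral_refCell_symm {F : Plane → ℝ} (hF : Continuous F) :
    ∫ x in refCell, F x = ∫ t in (0 : ℝ)..1, ∫ s in (0 : ℝ)..(1 - t), F !₂[s, t] := by
  have hsw := (Measure.measurePreserving_swap (μ := (volume : Measure ℝ)) (ν := (volume : Measure ℝ)))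
  rw [← Measure.volume_eq_prod] at hsw
  rw [setIntegral_refCell_eq_prod, ← hsw.setIntegral_preimage_emb
    MeasurableEquiv.prodComm.measurableEmbedding]
  have := setIntegral_prod_triangle ((hF.comp continuous_pt).comp continuous_swap)
  simp only [Function.comp_def, Prod.fst_swap, Prod.snd_swap] at this
  rw [← this]
  congr 2
  ext z
  simp only [Set.mem_preimage, Set.mem_ofPred_eq, Prod.fst_swap, Prod.snd_swap]
  constructor <;> rintro ⟨h0, h1, h2⟩ <;> exact ⟨h1, h0, by linarith⟩

/-! ### Green's formula on a triangle -/

theorem contDiff_pderiv {g : Plane → ℝ} (hg : ContDiff ℝ ∞ g) (i : Fin 2) :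
    ContDiff ℝ ∞ (pderiv i g) := by
  unfold pderiv
  exact (hg.fderiv_right (m := ∞) (by simp)).clm_apply contDiff_const

theorem fderiv_apply_eq_pderiv (g : Plane → ℝ) (x v : Plane) :
    fderiv ℝ g x v = v 0 * pderiv 0 g x + v 1 * pderiv 1 g x := by
  have : v = v 0 • EuclideanSpace.single 0 1 + v 1 • EuclideanSpace.single 1 1 := by
    apply plane_ext <;> simp
  conv_lhs => rw [this]
  simp [pderiv]

theorem hasDerivAt_comp_line {g : Plane → ℝ} (hg : ContDiff ℝ ∞ g) (x v : Plane) (s : ℝ) :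
    HasDerivAt (fun s : ℝ => g (x + s • v)) (v 0 * pderiv 0 g (x + s • v)
      + v 1 * pderiv 1 g (x + s • v)) s := by
  have h1 : HasDerivAt (fun s : ℝ => x + s • v) v s := by
    simpa using ((hasDerivAt_id s).smul_const v).const_add x
  have h2 := ((hg.differentiable (by simp)) (x + s • v)).hasFDerivAt.comp_hasDerivAt s h1
  rwa [fderiv_apply_eq_pderiv] at h2

/-- A horizontal slice runs from the edge `x₀ = 0` to the hypotenuse, and `g` vanishes at both ends.
-/
theorem setIntegral_refCell_pderiv_zero {g : Plane → ℝ} (hg : ContDiff ℝ ∞ g)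
    (h0 : ∀ t ∈ Set.Icc (0 : ℝ) 1, g !₂[0, t] = 0)
    (h1 : ∀ t ∈ Set.Icc (0 : ℝ) 1, g !₂[1 - t, t] = 0) :
    ∫ x in refCell, pderiv 0 g x = 0 := by
  rw [setIntegral_refCell_symm (contDiff_pderiv hg 0).continuous]
  rw [intervalIntegral.integral_congr (g := fun _ => 0) (by
    intro t ht
    rw [Set.uIcc_of_le zero_le_one] at ht
    have e : ∀ s : ℝ, (!₂[0, t] : Plane) + s • EuclideanSpace.single 0 1 = !₂[s, t] := by
      intro s; apply plane_ext <;> simp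
    have := intervalIntegral.integral_eq_sub_of_hasDerivAt (a := 0) (b := 1 - t)
      (fun s _ => hasDerivAt_comp_line hg !₂[0, t] (EuclideanSpace.single 0 1) s)
      (Continuous.intervalIntegrable (by
        have := (contDiff_pderiv hg 0).continuous
        have := (contDiff_pderiv hg 1).continuous
        fun_prop) _ _)
    simpa [e, h0 t ht, h1 t ht] using this)]
  simp

/-- A vertical slice ends on the hypotenuse, where `g` vanishes, so only its starting point on the
edge `x₁ = 0` contributes. -/
theorem setIntegral_refCell_pderiv_one {g : Plane → ℝ} (hg : ContDiff ℝ ∞ g)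
    (h1 : ∀ t ∈ Set.Icc (0 : ℝ) 1, g !₂[1 - t, t] = 0) :
    ∫ x in refCell, pderiv 1 g x = -∫ s in (0 : ℝ)..1, g !₂[s, 0] := by
  rw [setIntegral_refCell (contDiff_pderiv hg 1).continuous, ← intervalIntegral.integral_neg]
  apply intervalIntegral.integral_congr
  intro s hs
  rw [Set.uIcc_of_le zero_le_one] at hs
  have e : ∀ t : ℝ, (!₂[s, 0] : Plane) + t • EuclideanSpace.single 1 1 = !₂[s, t] := by
    intro s; apply plane_ext <;> simp
  have := intervalIntegral.integral_eq_sub_of_hasDerivAt (a := 0) (b := 1 - s)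
    (fun t _ => hasDerivAt_comp_line hg !₂[s, 0] (EuclideanSpace.single 1 1) t)
    (Continuous.intervalIntegrable (by
      have := (contDiff_pderiv hg 0).continuous
      have := (contDiff_pderiv hg 1).continuous
      fun_prop) _ _)
  have h2 := h1 (1 - s) ⟨by linarith [hs.2], by linarith [hs.1]⟩
  rw [sub_sub_cancel] at h2
  simpa [e, h2] using this

theorem pderiv_comp_affMap {g : Plane → ℝ} (hg : ContDiff ℝ ∞ g) (a b c x : Plane) (i : Fin 2) :
    pderiv i (fun x => g (affMap a b c x)) x
      = ![b - a, c - a] i 0 * pderiv 0 g (affMap a b c x)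
        + ![b - a, c - a] i 1 * pderiv 1 g (affMap a b c x) := by
  have h := ((hg.differentiable (by simp)) (affMap a b c x)).hasFDerivAt.comp x
    (hasFDerivAt_affMap a b c x)
  rw [pderiv, show (fun x => g (affMap a b c x)) = g ∘ affMap a b c from rfl, h.fderiv,
    ContinuousLinearMap.comp_apply, fderiv_apply_eq_pderiv]
  fin_cases i <;> simp [affLin]

theorem pderiv_zero_affMap {a b c : Plane} (h : det2 (b - a) (c - a) ≠ 0) {g : Plane → ℝ}
    (hg : ContDiff ℝ ∞ g) (x : Plane) :
    pderiv 0 g (affMap a b c x) = (det2 (b - a) (c - a))⁻¹ *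
      ((c - a) 1 * pderiv 0 (fun x => g (affMap a b c x)) x
        - (b - a) 1 * pderiv 1 (fun x => g (affMap a b c x)) x) := by
  rw [eq_inv_mul_iff_mul_eq₀ h, pderiv_comp_affMap hg, pderiv_comp_affMap hg, det2]
  simp only [Matrix.cons_val_zero, Matrix.cons_val_one, Matrix.cons_val_fin_one]
  ring

theorem pderiv_one_affMap {a b c : Plane} (h : det2 (b - a) (c - a) ≠ 0) {g : Plane → ℝ}
    (hg : ContDiff ℝ ∞ g) (x : Plane) :
    pderiv 1 g (affMap a b c x) = (det2 (b - a) (c - a))⁻¹ *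
      ((b - a) 0 * pderiv 1 (fun x => g (affMap a b c x)) x
        - (c - a) 0 * pderiv 0 (fun x => g (affMap a b c x)) x) := by
  rw [eq_inv_mul_iff_mul_eq₀ h, pderiv_comp_affMap hg, pderiv_comp_affMap hg, det2]
  simp only [Matrix.cons_val_zero, Matrix.cons_val_one, Matrix.cons_val_fin_one]
  ring

/-- Green's formula for a function that vanishes on the edges `[b, c]` and `[c, a]`. -/
theorem green_cell {a b c : Plane} (h : det2 (b - a) (c - a) ≠ 0) {g : Plane → ℝ}
    (hg : ContDiff ℝ ∞ g) (h0 : ∀ x ∈ refHull, x 0 = 0 → g (affMap a b c x) = 0)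
    (h1 : ∀ x ∈ refHull, x 0 + x 1 = 1 → g (affMap a b c x) = 0) :
    (∫ x in cell {a, b, c}, pderiv 0 g x = |det2 (b - a) (c - a)| / det2 (b - a) (c - a)
      * (b - a) 1 * ∫ s in (0 : ℝ)..1, g (a + s • (b - a))) ∧
    (∫ x in cell {a, b, c}, pderiv 1 g x = -(|det2 (b - a) (c - a)| / det2 (b - a) (c - a)
      * (b - a) 0 * ∫ s in (0 : ℝ)..1, g (a + s • (b - a)))) := by
  set G : Plane → ℝ := fun x => g (affMap a b c x) with hGdef
  have hG : ContDiff ℝ ∞ G := hg.comp (contDiff_affMap a b c)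
  have hh0 : ∀ t ∈ Set.Icc (0 : ℝ) 1, G !₂[0, t] = 0 := fun t ht =>
    h0 _ (by simpa [refHull] using ht) (by simp)
  have hh1 : ∀ t ∈ Set.Icc (0 : ℝ) 1, G !₂[1 - t, t] = 0 := fun t ht =>
    h1 _ (by simpa [refHull, and_comm] using ht) (by simp)
  have I0 := setIntegral_refCell_pderiv_zero hG hh0 hh1
  have I1 := setIntegral_refCell_pderiv_one hG hh1
  have hint : ∀ i, IntegrableOn (pderiv i G) refCell := fun i =>
    ((contDiff_pderiv hG i).continuous.continuousOn.integrableOn_compact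
      isCompact_refHull).mono_set refCell_subset_refHull
  have e : ∀ s : ℝ, G !₂[s, 0] = g (a + s • (b - a)) := by
    intro s
    simp only [hGdef]
    congr 1
    apply plane_ext <;> simp [affMap_apply]
  simp only [e] at I1
  -- The factor `|d|` of the change of variables meets the factor `d⁻¹` of the chain rule; what is
  -- left is the orientation sign `|d| / d` of the triangle.
  have d0 := pderiv_zero_affMap h hg
  have d1 := pderiv_one_affMap h hg
  constructor
  · rw [setIntegral_cell h]
    simp only [d0]
    simp only [← hGdef]
    rw [integral_const_mul, integral_sub ((hint 0).const_mul _) ((hint 1).const_mul _),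
      integral_const_mul, integral_const_mul, I0, I1]
    ring
  · rw [setIntegral_cell h]
    simp only [d1]
    simp only [← hGdef]
    rw [integral_const_mul, integral_sub ((hint 1).const_mul _) ((hint 0).const_mul _),
      integral_const_mul, integral_const_mul, I0, I1]
    ring

/-! ### Arc length on an edge -/

/-- The unit speed parametrisation is an isometry, so it carries Lebesgue measure to one-dimensional
Hausdorff measure; a dilation by the length then normalises the interval. The half-open interval
agrees with the convention of interval integrals. -/
theorem arc_hull_pair {a b : Plane} (hab : a ≠ b) :
    arc (hull {a, b}) = ENNReal.ofReal ‖b - a‖ •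
      Measure.map (fun s : ℝ => a + s • (b - a)) (volume.restrict (Set.Ioc 0 1)) := by
  set L := ‖b - a‖ with hL
  have hL0 : 0 < L := norm_pos_iff.mpr (sub_ne_zero.mpr hab.symm)
  let ι : ℝ → Plane := fun r => a + r • (L⁻¹ • (b - a))
  have hι : Isometry ι := by
    apply Isometry.of_dist_eq
    intro x y
    rw [dist_add_left, dist_eq_norm, dist_eq_norm, ← sub_smul, norm_smul, norm_smul, norm_inv, ← hL,
      Real.norm_of_nonneg hL0.le, inv_mul_cancel₀ hL0.ne', mul_one]
  have hιe := hι.isClosedEmbedding.measurableEmbedding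
  have hmap := hι.map_hausdorffMeasure (d := 1) (Or.inl zero_le_one)
  rw [hausdorffMeasure_real] at hmap
  have hme : MeasurableEmbedding (fun s : ℝ => L * s) :=
    (Homeomorph.mulLeft₀ L hL0.ne').measurableEmbedding
  have hseg : hull {a, b} = ι '' Set.Icc 0 L := by
    rw [hull, Finset.coe_pair, convexHull_pair, segment_eq_image']
    have : Set.Icc 0 L = (fun s : ℝ => L * s) '' Set.Icc 0 1 := by
      ext r
      constructor
      · rintro ⟨h0, h1⟩
        exact ⟨r / L, ⟨by positivity, (div_le_one hL0).mpr h1⟩, by simp only; field_simp⟩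
      · rintro ⟨s, ⟨h0, h1⟩, rfl⟩
        exact ⟨by positivity, by simp only; nlinarith⟩
    rw [this, Set.image_image]
    apply Set.image_congr
    intro s _
    simp only [ι, smul_smul]
    rw [mul_right_comm, mul_inv_cancel₀ hL0.ne', one_mul]
  have hsub : hull {a, b} ⊆ Set.range ι := hseg ▸ Set.image_subset_range _ _
  have hpre : ι ⁻¹' hull {a, b} = Set.Icc 0 L := by
    rw [hseg, Set.preimage_image_eq _ hι.injective]
  have hvol := Real.smul_map_volume_mul_left hL0.ne'
  rw [abs_of_pos hL0] at hvol
  have hpre2 : (fun s : ℝ => L * s) ⁻¹' Set.Icc 0 L = Set.Icc 0 1 := by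
    ext s
    simp only [Set.mem_preimage, Set.mem_Icc]
    constructor
    · rintro ⟨h0, h1⟩
      exact ⟨by by_contra hs; nlinarith, by by_contra hs; nlinarith⟩
    · rintro ⟨h0, h1⟩
      exact ⟨by positivity, by nlinarith⟩
  have hv2 : volume.restrict (Set.Icc 0 L) = ENNReal.ofReal L •
      Measure.map (fun s : ℝ => L * s) (volume.restrict (Set.Ioc 0 1)) := by
    conv_lhs => rw [← hvol]
    rw [Measure.restrict_smul, hme.restrict_map, hpre2,
      Measure.restrict_congr_set (Ioc_ae_eq_Icc (a := (0 : ℝ)) (b := 1)).symm]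
  have hm : MeasurableSet (hull ({a, b} : Finset Plane)) := (isCompact_hull _).measurableSet
  rw [arc, ← Set.inter_eq_left.mpr hsub, ← Measure.restrict_restrict hm, ← hmap,
    hιe.restrict_map, hpre, hv2, Measure.map_smul, Measure.map_map hιe.measurable hme.measurable]
  congr 2
  ext s : 1
  simp only [Function.comp, ι, smul_smul]
  rw [mul_right_comm, mul_inv_cancel₀ hL0.ne', one_mul]

theorem measurableEmbedding_line {a b : Plane} (hab : a ≠ b) :
    MeasurableEmbedding (fun s : ℝ => a + s • (b - a)) := by
  have hv : b - a ≠ 0 := sub_ne_zero.mpr hab.symm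
  apply Topology.IsClosedEmbedding.measurableEmbedding
  exact (Homeomorph.addLeft a).isClosedEmbedding.comp
    (isClosedEmbedding_smul_left hv)

theorem integral_arc {a b : Plane} (hab : a ≠ b) (f : Plane → ℝ) :
    ∫ x, f x ∂(arc (hull {a, b})) = ‖b - a‖ * ∫ s in (0 : ℝ)..1, f (a + s • (b - a)) := by
  rw [arc_hull_pair hab, integral_smul_measure, (measurableEmbedding_line hab).integral_map,
    intervalIntegral.integral_of_le zero_le_one, ENNReal.toReal_ofReal (norm_nonneg _), smul_eq_mul]

theorem memLp_arc {a b : Plane} (hab : a ≠ b) {f : Plane → ℝ}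
    (hf : MemLp f 2 (arc (hull {a, b}))) :
    MemLp (fun s : ℝ => f (a + s • (b - a))) 2 (volume.restrict (Set.Ioc 0 1)) := by
  have hL0 : 0 < ‖b - a‖ := norm_pos_iff.mpr (sub_ne_zero.mpr hab.symm)
  rw [arc_hull_pair hab] at hf
  have h2 := hf.smul_measure (c := (ENNReal.ofReal ‖b - a‖)⁻¹)
    (ENNReal.inv_ne_top.mpr (by simpa using sub_ne_zero.mpr hab.symm))
  rw [smul_smul, ENNReal.inv_mul_cancel (by simpa using sub_ne_zero.mpr hab.symm) (by simp),
    one_smul, (measurableEmbedding_line hab).memLp_map_measure_iff] at h2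
  exact h2

/-! ### Square integrals -/

section SquareIntegrals

variable {X : Type*} [MeasurableSpace X] {μ : Measure X}

theorem inner_toLp {f g : X → ℝ} (hf : MemLp f 2 μ) (hg : MemLp g 2 μ) :
    inner ℝ (hf.toLp f) (hg.toLp g) = ∫ x, f x * g x ∂μ := by
  rw [L2.inner_def]
  apply integral_congr_ae
  filter_upwards [hf.coeFn_toLp, hg.coeFn_toLp] with x h1 h2
  rw [h1, h2]
  simp [mul_comm]

theorem norm_toLp_sq {f : X → ℝ} (hf : MemLp f 2 μ) : ‖hf.toLp f‖ ^ 2 = ∫ x, f x ^ 2 ∂μ := by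
  rw [← real_inner_self_eq_norm_sq, inner_toLp]
  simp only [sq]

theorem sq_integral_mul_le {f g : X → ℝ} (hf : MemLp f 2 μ) (hg : MemLp g 2 μ) :
    (∫ x, f x * g x ∂μ) ^ 2 ≤ (∫ x, f x ^ 2 ∂μ) * ∫ x, g x ^ 2 ∂μ := by
  rw [← norm_toLp_sq hf, ← norm_toLp_sq hg, ← inner_toLp hf hg, ← mul_pow, sq_le_sq,
    abs_of_nonneg (by positivity : 0 ≤ ‖hf.toLp f‖ * ‖hg.toLp g‖)]
  exact abs_real_inner_le_norm _ _

theorem integral_sq_nonneg (f : X → ℝ) : 0 ≤ ∫ x, f x ^ 2 ∂μ :=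
  integral_nonneg fun x => sq_nonneg (f x)

theorem integral_sq_le_two {f g : X → ℝ} (hf : MemLp f 2 μ) (hg : MemLp g 2 μ) :
    ∫ x, f x ^ 2 ∂μ ≤ 2 * (∫ x, (f x - g x) ^ 2 ∂μ) + 2 * ∫ x, g x ^ 2 ∂μ := by
  have h1 : Integrable (fun x => 2 * (f x - g x) ^ 2) μ := (hf.sub hg).integrable_sq.const_mul 2
  have h2 : Integrable (fun x => 2 * g x ^ 2) μ := hg.integrable_sq.const_mul 2
  rw [← integral_const_mul, ← integral_const_mul, ← integral_add h1 h2]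
  apply integral_mono hf.integrable_sq (h1.add h2)
  intro x
  simp only [Pi.add_apply]
  nlinarith [sq_nonneg (f x - 2 * g x)]

theorem integrable_mul_of_memLp {f g : X → ℝ} (hf : MemLp f 2 μ) (hg : MemLp g 2 μ) :
    Integrable (fun x => f x * g x) μ := hf.integrable_mul hg

/-- One-sided norm equivalence in finite dimension: the map into `L²(ν)` is injective, hence
invertible on its finite dimensional range, and every linear map from that range to `L²(μ)` is
continuous. All the inequalities on the reference triangle come from here. -/
theorem exists_integral_sq_le {V Y : Type*} [AddCommGroup V] [Module ℝ V] [FiniteDimensional ℝ V]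
    [MeasurableSpace Y] {ν : Measure Y} (L₁ : V →ₗ[ℝ] (X → ℝ)) (L₂ : V →ₗ[ℝ] (Y → ℝ))
    (h₁ : ∀ v, MemLp (L₁ v) 2 μ) (h₂ : ∀ v, MemLp (L₂ v) 2 ν)
    (hker : ∀ v, L₂ v =ᵐ[ν] 0 → v = 0) :
    ∃ C : ℝ, 0 < C ∧ ∀ v, ∫ x, L₁ v x ^ 2 ∂μ ≤ C * ∫ y, L₂ v y ^ 2 ∂ν := by
  let M₁ : V →ₗ[ℝ] Lp ℝ 2 μ :=
    { toFun := fun v => (h₁ v).toLp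
      map_add' := fun v w => by
        rw [← MemLp.toLp_add]; congr 1; exact map_add _ _ _
      map_smul' := fun t v => by
        rw [RingHom.id_apply, ← MemLp.toLp_const_smul]; congr 1; exact map_smul _ _ _ }
  let M₂ : V →ₗ[ℝ] Lp ℝ 2 ν :=
    { toFun := fun v => (h₂ v).toLp
      map_add' := fun v w => by
        rw [← MemLp.toLp_add]; congr 1; exact map_add _ _ _
      map_smul' := fun t v => by
        rw [RingHom.id_apply, ← MemLp.toLp_const_smul]; congr 1; exact map_smul _ _ _ }
  have hinj : Function.Injective M₂ := by
    rw [← LinearMap.ker_eq_bot, LinearMap.ker_eq_bot']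
    intro v hv
    apply hker
    exact (h₂ v).coeFn_toLp.symm.trans ((Lp.eq_zero_iff_ae_eq_zero).mp hv)
  let e := LinearEquiv.ofInjective M₂ hinj
  let S : LinearMap.range M₂ →L[ℝ] Lp ℝ 2 μ :=
    LinearMap.toContinuousLinearMap (M₁ ∘ₗ e.symm.toLinearMap)
  refine ⟨‖S‖ ^ 2 + 1, by positivity, fun v => ?_⟩
  have h := S.le_opNorm (e v)
  have hS : S (e v) = M₁ v := by simp [S]
  have he : ‖e v‖ = ‖M₂ v‖ := rfl
  rw [hS, he] at h
  have h3 : ‖M₁ v‖ ^ 2 = ∫ x, L₁ v x ^ 2 ∂μ := norm_toLp_sq (h₁ v)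
  have h4 : ‖M₂ v‖ ^ 2 = ∫ x, L₂ v x ^ 2 ∂ν := norm_toLp_sq (h₂ v)
  rw [← h3, ← h4]
  calc ‖M₁ v‖ ^ 2 ≤ (‖S‖ * ‖M₂ v‖) ^ 2 := by gcongr
    _ = ‖S‖ ^ 2 * ‖M₂ v‖ ^ 2 := by ring
    _ ≤ (‖S‖ ^ 2 + 1) * ‖M₂ v‖ ^ 2 := by gcongr; linarith

/-- The bubble function argument. -/
theorem integral_sq_le_of_bubble {g r ψ : X → ℝ} (hg : MemLp g 2 μ) (hr : MemLp r 2 μ)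
    (hψ : MemLp ψ 2 μ) {C D : ℝ} (hC : 0 ≤ C) (hD : 0 ≤ D)
    (h₁ : ∫ x, r x ^ 2 ∂μ ≤ C * ∫ x, ψ x * r x ∂μ) (h₂ : ∫ x, ψ x ^ 2 ∂μ ≤ C * ∫ x, r x ^ 2 ∂μ)
    (h₃ : (∫ x, g x * ψ x ∂μ) ^ 2 ≤ D * ∫ x, r x ^ 2 ∂μ) :
    ∫ x, g x ^ 2 ∂μ ≤ (2 + 4 * C ^ 3 + 4 * C ^ 2) * ((∫ x, (g x - r x) ^ 2 ∂μ) + D) := by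
  have hG := integral_sq_le_two hg hr
  have hR := integral_sq_nonneg (μ := μ) r
  have hO : 0 ≤ ∫ x, (g x - r x) ^ 2 ∂μ := integral_sq_nonneg (μ := μ) fun x => g x - r x
  have hX := sq_integral_mul_le hψ (hg.sub hr)
  simp only [Pi.sub_apply] at hX
  -- The tested polynomial is the tested residual up to a term that Cauchy–Schwarz bounds by the
  -- oscillation.
  have hs : ∫ x, ψ x * r x ∂μ = (∫ x, g x * ψ x ∂μ) - ∫ x, ψ x * (g x - r x) ∂μ := by
    have h4 : Integrable (fun x => ψ x * (g x - r x)) μ := integrable_mul_of_memLp hψ (hg.sub hr)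
    rw [← integral_sub (integrable_mul_of_memLp hg hψ) h4]
    congr 1; ext x; ring
  rw [hs] at h₁
  set R := ∫ x, r x ^ 2 ∂μ
  set O := ∫ x, (g x - r x) ^ 2 ∂μ
  set P := ∫ x, ψ x ^ 2 ∂μ
  set x := ∫ x, ψ x * (g x - r x) ∂μ
  set y := ∫ x, g x * ψ x ∂μ
  have hX' : x ^ 2 ≤ C * R * O := hX.trans (mul_le_mul_of_nonneg_right h₂ hO)
  -- From `R ≤ C (y - x)`, `y² ≤ D R` and `x² ≤ C R O` follows `R² ≤ 2 C² (C O + D) R`; dividing by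
  -- `R` needs the separate case `R = 0`.
  have hR2 : R ≤ 2 * C ^ 2 * (C * O + D) := by
    rcases hR.eq_or_lt with h0 | h0
    · rw [← h0]; positivity
    · have h5 : R ^ 2 ≤ (C * (y - x)) ^ 2 := by gcongr
      have h6 : (C * (y - x)) ^ 2 ≤ C ^ 2 * (2 * (y ^ 2 + x ^ 2)) := by
        rw [mul_pow]; gcongr; nlinarith [sq_nonneg (y + x)]
      have h7 : C ^ 2 * (2 * (y ^ 2 + x ^ 2)) ≤ C ^ 2 * (2 * (D * R + C * R * O)) := by gcongr
      have h8 : R * R ≤ R * (2 * C ^ 2 * (C * O + D)) := by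
        calc R * R = R ^ 2 := by ring
          _ ≤ _ := h5.trans (h6.trans h7)
          _ = _ := by ring
      exact le_of_mul_le_mul_left h8 h0
  -- Now `∫ g² ≤ 2 O + 2 R ≤ (2 + 4 C³) O + 4 C² D`; these terms allow one common constant.
  have p1 : 0 ≤ C ^ 3 * D := by positivity
  have p2 : 0 ≤ C ^ 2 * O := by positivity
  nlinarith

end SquareIntegrals

/-! ### Polynomials -/

theorem contDiff_mvPolynomial (P : MvPolynomial (Fin 2) ℝ) :
    ContDiff ℝ ∞ fun x : Plane => MvPolynomial.eval x.ofLp P := by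
  induction P using MvPolynomial.induction_on with
  | C t => simpa using contDiff_const
  | add p q hp hq => simpa using hp.add hq
  | mul_X p i hp =>
    simp only [map_mul, MvPolynomial.eval_X]
    exact hp.mul (by fun_prop)

theorem IsPoly.contDiff {m : ℕ} {q : Plane → ℝ} (hq : IsPoly m q) : ContDiff ℝ ∞ q := by
  obtain ⟨P, -, hP⟩ := hq
  rw [funext hP]
  exact contDiff_mvPolynomial P

theorem totalDegree_aeval_le {σ τ : Type*} (F : MvPolynomial σ ℝ) (f : σ → MvPolynomial τ ℝ)
    (hf : ∀ i, (f i).totalDegree ≤ 1) : (MvPolynomial.aeval f F).totalDegree ≤ F.totalDegree := by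
  rw [MvPolynomial.aeval_def, MvPolynomial.eval₂_eq]
  apply MvPolynomial.totalDegree_finsetSum_le
  intro d hd
  refine (MvPolynomial.totalDegree_mul _ _).trans ?_
  rw [MvPolynomial.algebraMap_eq, MvPolynomial.totalDegree_C, zero_add]
  refine (MvPolynomial.totalDegree_finsetProd _ _).trans ?_
  refine le_trans ?_ (MvPolynomial.le_totalDegree hd)
  apply Finset.sum_le_sum
  intro i _
  refine (MvPolynomial.totalDegree_pow _ _).trans ?_
  simpa using Nat.mul_le_mul_left (d i) (hf i)

theorem IsPoly.comp_affMap {m : ℕ} {q : Plane → ℝ} (hq : IsPoly m q) (a b c : Plane) :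
    IsPoly m fun x => q (affMap a b c x) := by
  obtain ⟨P, hP, hPq⟩ := hq
  let f : Fin 2 → MvPolynomial (Fin 2) ℝ := fun i =>
    MvPolynomial.C (a i) + (MvPolynomial.C (b i - a i) * MvPolynomial.X 0
      + MvPolynomial.C (c i - a i) * MvPolynomial.X 1)
  refine ⟨MvPolynomial.aeval f P, (totalDegree_aeval_le P f ?_).trans hP, ?_⟩
  · intro i
    have h1 : ∀ (t : ℝ) (j : Fin 2),
        (MvPolynomial.C t * MvPolynomial.X j : MvPolynomial (Fin 2) ℝ).totalDegree ≤ 1 := by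
      intro t j
      refine (MvPolynomial.totalDegree_mul _ _).trans ?_
      rw [MvPolynomial.totalDegree_C, MvPolynomial.totalDegree_X]
    refine (MvPolynomial.totalDegree_add _ _).trans (max_le (by simp) ?_)
    exact (MvPolynomial.totalDegree_add _ _).trans (max_le (h1 _ _) (h1 _ _))
  · intro x
    simp only [hPq]
    rw [← MvPolynomial.coe_aeval_eq_eval, ← MvPolynomial.coe_aeval_eq_eval,
      RingHom.coe_coe, RingHom.coe_coe, ← AlgHom.comp_apply, MvPolynomial.comp_aeval]
    congr 2
    ext i
    simp [f, affMap_apply]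
    ring

/-- Links polynomials on an edge, which are restrictions from the plane, to polynomials in the edge
parameter, for which the edge bubble bounds are proved. -/
theorem IsPoly.exists_polynomial_line {m : ℕ} {q : Plane → ℝ} (hq : IsPoly m q) (a v : Plane) :
    ∃ P : Polynomial ℝ, P.natDegree ≤ m ∧ ∀ s : ℝ, q (a + s • v) = P.eval s := by
  obtain ⟨P, hP, hPq⟩ := hq
  let f : Fin 2 → Polynomial ℝ := fun i => Polynomial.C (a i) + Polynomial.C (v i) * Polynomial.X
  refine ⟨MvPolynomial.aeval f P, ?_, ?_⟩
  · have := MvPolynomial.aeval_natDegree_le (n := 1) P hP f (fun i => by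
      refine (Polynomial.natDegree_add_le _ _).trans (max_le (by simp) ?_)
      exact (Polynomial.natDegree_C_mul_le _ _).trans Polynomial.natDegree_X_le)
    simpa using this
  · intro s
    rw [hPq, ← MvPolynomial.coe_aeval_eq_eval, ← Polynomial.coe_aeval_eq_eval,
      RingHom.coe_coe, ← AlgHom.comp_apply, MvPolynomial.comp_aeval]
    congr 2
    ext i
    simp [f]
    ring

theorem isPoly_zero (m : ℕ) : IsPoly m (0 : Plane → ℝ) := ⟨0, by simp, by simp⟩

/-- An open set contains a box, and a product of infinite sets determines a polynomial. -/
theorem eq_zero_of_eval_eq_zero_on_open {P : MvPolynomial (Fin 2) ℝ} {U : Set Plane}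
    (hU : IsOpen U) (hne : U.Nonempty) (h : ∀ x ∈ U, MvPolynomial.eval x.ofLp P = 0) : P = 0 := by
  obtain ⟨x, hx⟩ := hne
  have ho : IsOpen (WithLp.toLp 2 ⁻¹' U : Set (Fin 2 → ℝ)) :=
    hU.preimage (PiLp.continuous_toLp 2 fun _ : Fin 2 => ℝ)
  obtain ⟨ε, hε, hb⟩ := Metric.isOpen_iff.mp ho x.ofLp (by simpa using hx)
  rw [ball_pi _ hε] at hb
  apply MvPolynomial.funext_set (fun i => Metric.ball (x.ofLp i) ε)
  · intro i
    rw [Real.ball_eq_Ioo]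
    exact Set.Ioo_infinite (by linarith)
  · intro y hy
    simpa using h _ (hb hy)

/-! ### Bubble functions on the reference triangle -/

theorem memLp_two_restrict_of_continuous {F : Plane → ℝ} (hF : Continuous F) {U K : Set Plane}
    (hK : IsCompact K) (hU : U ⊆ K) : MemLp F 2 (volume.restrict U) := by
  obtain ⟨B, hB⟩ := hK.exists_bound_of_continuousOn hF.continuousOn
  have : IsFiniteMeasure (volume.restrict K) := ⟨by simpa using hK.measure_lt_top⟩
  have : MemLp F 2 (volume.restrict K) := by
    apply MemLp.of_bound hF.aestronglyMeasurable B
    filter_upwards [ae_restrict_mem hK.measurableSet] with x hx using hB x hx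
  exact this.mono_measure (Measure.restrict_mono hU le_rfl)

theorem memLp_refCell {F : Plane → ℝ} (hF : Continuous F) :
    MemLp F 2 (volume.restrict refCell) :=
  memLp_two_restrict_of_continuous hF isCompact_refHull refCell_subset_refHull

theorem memLp_cell {F : Plane → ℝ} (hF : Continuous F) (T : Finset Plane) :
    MemLp F 2 (volume.restrict (cell T)) :=
  memLp_two_restrict_of_continuous hF (isCompact_hull T) (cell_subset_hull T)

theorem memLp_Ioc {F : ℝ → ℝ} (hF : Continuous F) :
    MemLp F 2 (volume.restrict (Set.Ioc (0 : ℝ) 1)) := by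
  obtain ⟨B, hB⟩ := (isCompact_Icc (a := (0 : ℝ)) (b := 1)).exists_bound_of_continuousOn
    hF.continuousOn
  apply MemLp.of_bound hF.aestronglyMeasurable B
  filter_upwards [ae_restrict_mem measurableSet_Ioc] with x hx using hB x ⟨hx.1.le, hx.2⟩

/-- A family of smooth functions that depends linearly on a parameter. -/
def smoothFamily {V : Type*} [AddCommGroup V] [Module ℝ V] (F : V → Plane → ℝ)
    (hadd : ∀ v w x, F (v + w) x = F v x + F w x) (hsmul : ∀ (t : ℝ) v x, F (t • v) x = t * F v x) :
    V →ₗ[ℝ] (Plane → ℝ) where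
  toFun := F
  map_add' v w := funext (hadd v w)
  map_smul' t v := funext (hsmul t v)

/-- The partial derivatives of such a family. -/
def smoothFamilyDeriv {V : Type*} [AddCommGroup V] [Module ℝ V] (F : V → Plane → ℝ)
    (hadd : ∀ v w x, F (v + w) x = F v x + F w x) (hsmul : ∀ (t : ℝ) v x, F (t • v) x = t * F v x)
    (hF : ∀ v, ContDiff ℝ ∞ (F v)) (i : Fin 2) :
    V →ₗ[ℝ] (Plane → ℝ) where
  toFun v := pderiv i (F v)
  map_add' v w := by
    ext x
    have : F (v + w) = F v + F w := funext (hadd v w)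
    simp only [pderiv, this, Pi.add_apply]
    rw [fderiv_add ((hF v).differentiable (by simp) x) ((hF w).differentiable (by simp) x)]
    rfl
  map_smul' t v := by
    ext x
    have : F (t • v) = t • F v := funext (hsmul t v)
    simp only [pderiv, this, Pi.smul_apply, RingHom.id_apply]
    rw [fderiv_const_smul ((hF v).differentiable (by simp) x)]
    rfl

/-- A smooth cut-off replaces the usual product of barycentric coordinates, so that `χ² q` is a
genuine test function. The square makes `∫ (χ² q) q = ∫ (χ q)²`, and `q ↦ χ q` is injective because
`χ` is positive on a ball. -/
theorem exists_refCell_bump (m : ℕ) : ∃ χ : Plane → ℝ, ContDiff ℝ ∞ χ ∧ HasCompactSupport χ ∧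
    tsupport χ ⊆ refCell ∧ ∃ C : ℝ, 0 < C ∧ ∀ q, IsPoly m q →
      ∫ x in refCell, q x ^ 2 ≤ C * ∫ x in refCell, (χ x * q x) ^ 2 ∧
      ∫ x in refCell, (χ x ^ 2 * q x) ^ 2 ≤ C * ∫ x in refCell, q x ^ 2 ∧
      ∀ i, ∫ x in refCell, pderiv i (fun x => χ x ^ 2 * q x) x ^ 2
        ≤ C * ∫ x in refCell, q x ^ 2 := by
  have hc : (!₂[1 / 4, 1 / 4] : Plane) ∈ refCell := by
    refine ⟨?_, ?_, ?_⟩ <;> norm_num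
  obtain ⟨ε, hε, hball⟩ := Metric.nhds_basis_closedBall.mem_iff.mp (isOpen_refCell.mem_nhds hc)
  let χ : ContDiffBump (!₂[1 / 4, 1 / 4] : Plane) := ⟨ε / 2, ε, by positivity, by linarith⟩
  have hχs : ContDiff ℝ ∞ χ := χ.contDiff
  have hχsup : tsupport χ ⊆ refCell := χ.tsupport_eq ▸ hball
  refine ⟨χ, hχs, χ.hasCompactSupport, hχsup, ?_⟩
  let V := MvPolynomial.restrictTotalDegree (Fin 2) ℝ m
  let E : V → Plane → ℝ := fun v x => MvPolynomial.eval x.ofLp v.1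
  have hE : ∀ v, ContDiff ℝ ∞ (E v) := fun v => contDiff_mvPolynomial v.1
  let L₀ := smoothFamily E (fun v w x => by simp [E]) (fun t v x => by simp [E])
  let L₁ := smoothFamily (fun v x => χ x * E v x) (fun v w x => by simp [E]; ring)
    (fun t v x => by simp [E]; ring)
  let F : V → Plane → ℝ := fun v x => χ x ^ 2 * E v x
  have hF : ∀ v, ContDiff ℝ ∞ (F v) := fun v => (hχs.pow 2).mul (hE v)
  have hadd : ∀ v w x, F (v + w) x = F v x + F w x := fun v w x => by simp [F, E]; ring
  have hsmul : ∀ (t : ℝ) v x, F (t • v) x = t * F v x := fun t v x => by simp [F, E]; ring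
  let L₂ := smoothFamily F hadd hsmul
  let L₃ := smoothFamilyDeriv F hadd hsmul hF
  have m0 : ∀ v, MemLp (L₀ v) 2 (volume.restrict refCell) := fun v =>
    memLp_refCell (hE v).continuous
  have m1 : ∀ v, MemLp (L₁ v) 2 (volume.restrict refCell) := fun v =>
    memLp_refCell (hχs.mul (hE v)).continuous
  have m2 : ∀ v, MemLp (L₂ v) 2 (volume.restrict refCell) := fun v =>
    memLp_refCell (hF v).continuous
  have m3 : ∀ i v, MemLp (L₃ i v) 2 (volume.restrict refCell) := fun i v =>
    memLp_refCell (contDiff_pderiv (hF v) i).continuous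
  have hk0 : ∀ v, L₀ v =ᵐ[volume.restrict refCell] 0 → v = 0 := by
    intro v hv
    have h2 := Measure.eqOn_open_of_ae_eq hv isOpen_refCell (hE v).continuous.continuousOn
      continuous_zero.continuousOn
    exact Subtype.ext (eq_zero_of_eval_eq_zero_on_open isOpen_refCell ⟨_, hc⟩ h2)
  have hk1 : ∀ v, L₁ v =ᵐ[volume.restrict refCell] 0 → v = 0 := by
    intro v hv
    have h2 := Measure.eqOn_open_of_ae_eq hv isOpen_refCell
      (hχs.mul (hE v)).continuous.continuousOn continuous_zero.continuousOn
    refine Subtype.ext (eq_zero_of_eval_eq_zero_on_open (U := Metric.ball !₂[1 / 4, 1 / 4] ε)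
      Metric.isOpen_ball ⟨_, Metric.mem_ball_self hε⟩ ?_)
    intro x hx
    have h3 : χ x * E v x = 0 := h2 (hball (Metric.ball_subset_closedBall hx))
    exact (mul_eq_zero.mp h3).resolve_left (χ.pos_of_mem_ball hx).ne'
  obtain ⟨C₁, hC₁, H₁⟩ := exists_integral_sq_le L₀ L₁ m0 m1 hk1
  obtain ⟨C₂, hC₂, H₂⟩ := exists_integral_sq_le L₂ L₀ m2 m0 hk0
  obtain ⟨C₃, hC₃, H₃⟩ := exists_integral_sq_le (L₃ 0) L₀ (m3 0) m0 hk0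
  obtain ⟨C₄, hC₄, H₄⟩ := exists_integral_sq_le (L₃ 1) L₀ (m3 1) m0 hk0
  refine ⟨C₁ + C₂ + C₃ + C₄, by positivity, ?_⟩
  rintro q ⟨P, hP, hq⟩
  obtain rfl : q = E ⟨P, (MvPolynomial.mem_restrictTotalDegree _ _ _).mpr hP⟩ := funext hq
  set v : V := ⟨P, (MvPolynomial.mem_restrictTotalDegree _ _ _).mpr hP⟩
  have n0 := integral_sq_nonneg (μ := volume.restrict refCell) (L₀ v)
  have n1 := integral_sq_nonneg (μ := volume.restrict refCell) (L₁ v)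
  refine ⟨(H₁ v).trans ?_, (H₂ v).trans ?_, fun i => ?_⟩
  · exact mul_le_mul_of_nonneg_right (by linarith) n1
  · exact mul_le_mul_of_nonneg_right (by linarith) n0
  · fin_cases i
    · exact (H₃ v).trans (mul_le_mul_of_nonneg_right (by linarith) n0)
    · exact (H₄ v).trans (mul_le_mul_of_nonneg_right (by linarith) n0)

/-- The product of the squared edge bubble function and of a polynomial on the edge `x₁ = 0`,
constant in the direction of `x₁`. -/
def refEdgeBubble (P : Polynomial ℝ) (x : Plane) : ℝ := (x 0 * (1 - x 0 - x 1)) ^ 2 * P.eval (x 0)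

theorem contDiff_refEdgeBubble (P : Polynomial ℝ) : ContDiff ℝ ∞ (refEdgeBubble P) := by
  unfold refEdgeBubble
  have h : ContDiff ℝ ∞ fun x : Plane => P.eval (x 0) :=
    (by simpa using Polynomial.contDiff_aeval (𝕜 := ℝ) P ∞ : ContDiff ℝ ∞ fun s : ℝ => P.eval s).comp (by fun_prop : ContDiff ℝ ∞ fun x : Plane => x 0)
  exact ContDiff.mul (by fun_prop) h

/-- The weight `s (1 - s)` has no zero in the open interval, so it does not kill a nonzero
polynomial; the remaining bounds, including those for the extension to the triangle, hold because it
depends linearly on `P`. The squared weight again turns the pairing with `P` into a square integral.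
-/
theorem exists_refEdgeBubble_bound (m : ℕ) : ∃ C : ℝ, 0 < C ∧ ∀ P : Polynomial ℝ, P.natDegree ≤ m →
    ∫ s in Set.Ioc (0 : ℝ) 1, P.eval s ^ 2
      ≤ C * ∫ s in Set.Ioc (0 : ℝ) 1, (s * (1 - s) * P.eval s) ^ 2 ∧
    ∫ s in Set.Ioc (0 : ℝ) 1, ((s * (1 - s)) ^ 2 * P.eval s) ^ 2
      ≤ C * ∫ s in Set.Ioc (0 : ℝ) 1, P.eval s ^ 2 ∧
    ∫ x in refCell, refEdgeBubble P x ^ 2 ≤ C * ∫ s in Set.Ioc (0 : ℝ) 1, P.eval s ^ 2 ∧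
    ∀ i, ∫ x in refCell, pderiv i (refEdgeBubble P) x ^ 2
      ≤ C * ∫ s in Set.Ioc (0 : ℝ) 1, P.eval s ^ 2 := by
  -- The bound on the degree is strict here, hence `m + 1`.
  let V := Polynomial.degreeLT ℝ (m + 1)
  have : FiniteDimensional ℝ V := (Polynomial.degreeLTEquiv ℝ (m + 1)).symm.finiteDimensional
  let M (w : ℝ → ℝ) : V →ₗ[ℝ] (ℝ → ℝ) :=
    { toFun := fun v s => w s * v.1.eval s
      map_add' := fun v v' => by ext s; simp; ring
      map_smul' := fun t v => by ext s; simp; ring }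
  let F : V → Plane → ℝ := fun v => refEdgeBubble v.1
  have hF : ∀ v, ContDiff ℝ ∞ (F v) := fun v => contDiff_refEdgeBubble v.1
  have hadd : ∀ v w x, F (v + w) x = F v x + F w x := fun v w x => by
    simp [F, refEdgeBubble]; ring
  have hsmul : ∀ (t : ℝ) v x, F (t • v) x = t * F v x := fun t v x => by
    simp [F, refEdgeBubble]; ring
  let L₂ := smoothFamily F hadd hsmul
  let L₃ := smoothFamilyDeriv F hadd hsmul hF
  have mM : ∀ w : ℝ → ℝ, Continuous w → ∀ v,
      MemLp (M w v) 2 (volume.restrict (Set.Ioc (0 : ℝ) 1)) := fun w hw v =>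
    memLp_Ioc (hw.mul v.1.continuous)
  have m2 : ∀ v, MemLp (L₂ v) 2 (volume.restrict refCell) := fun v =>
    memLp_refCell (hF v).continuous
  have m3 : ∀ i v, MemLp (L₃ i v) 2 (volume.restrict refCell) := fun i v =>
    memLp_refCell (contDiff_pderiv (hF v) i).continuous
  have hk : ∀ w : ℝ → ℝ, Continuous w → (∀ s ∈ Set.Ioo (0 : ℝ) 1, w s ≠ 0) →
      ∀ v, M w v =ᵐ[volume.restrict (Set.Ioc (0 : ℝ) 1)] 0 → v = 0 := by
    intro w hw hw0 v hv
    have hv' := ae_restrict_of_ae_restrict_of_subset Set.Ioo_subset_Ioc_self hv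
    have h2 := Measure.eqOn_open_of_ae_eq hv' isOpen_Ioo
      (hw.mul v.1.continuous).continuousOn continuous_zero.continuousOn
    apply Subtype.ext
    apply Polynomial.eq_zero_of_infinite_isRoot
    apply (Set.Ioo_infinite (zero_lt_one (α := ℝ))).mono
    intro s hs
    have h3 : w s * v.1.eval s = 0 := h2 hs
    exact (mul_eq_zero.mp h3).resolve_left (hw0 s hs)
  have c1 : Continuous fun _ : ℝ => (1 : ℝ) := continuous_const
  have c2 : Continuous fun s : ℝ => s * (1 - s) := by fun_prop
  have c3 : Continuous fun s : ℝ => (s * (1 - s)) ^ 2 := by fun_prop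
  have hk1 := hk (fun _ => 1) c1 (by simp)
  have hk2 := hk (fun s => s * (1 - s)) c2 (fun s hs => by
    have := hs.1; have := hs.2; have : 0 < 1 - s := by linarith
    positivity)
  obtain ⟨C₁, hC₁, H₁⟩ := exists_integral_sq_le (M fun _ => 1) (M fun s => s * (1 - s))
    (mM _ c1) (mM _ c2) hk2
  obtain ⟨C₂, hC₂, H₂⟩ := exists_integral_sq_le (M fun s => (s * (1 - s)) ^ 2) (M fun _ => 1)
    (mM _ c3) (mM _ c1) hk1
  obtain ⟨C₃, hC₃, H₃⟩ := exists_integral_sq_le L₂ (M fun _ => 1) m2 (mM _ c1) hk1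
  obtain ⟨C₄, hC₄, H₄⟩ := exists_integral_sq_le (L₃ 0) (M fun _ => 1) (m3 0) (mM _ c1) hk1
  obtain ⟨C₅, hC₅, H₅⟩ := exists_integral_sq_le (L₃ 1) (M fun _ => 1) (m3 1) (mM _ c1) hk1
  refine ⟨C₁ + C₂ + C₃ + C₄ + C₅, by positivity, ?_⟩
  intro P hP
  let v : V := ⟨P, Polynomial.mem_degreeLT.mpr
    (Polynomial.degree_le_natDegree.trans_lt (by exact_mod_cast Nat.lt_succ_of_le hP))⟩
  have e1 : ∀ s, M (fun _ => 1) v s = P.eval s := fun s => one_mul _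
  have n0 := integral_sq_nonneg (μ := volume.restrict (Set.Ioc (0 : ℝ) 1)) fun s => P.eval s
  have n1 := integral_sq_nonneg (μ := volume.restrict (Set.Ioc (0 : ℝ) 1))
    fun s => s * (1 - s) * P.eval s
  replace H₁ := H₁ v
  replace H₂ := H₂ v
  replace H₃ := H₃ v
  replace H₄ := H₄ v
  replace H₅ := H₅ v
  simp only [e1] at H₁ H₂ H₃ H₄ H₅
  refine ⟨H₁.trans ?_, H₂.trans ?_, H₃.trans ?_, fun i => ?_⟩
  · exact mul_le_mul_of_nonneg_right (by linarith) n1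
  · exact mul_le_mul_of_nonneg_right (by linarith) n0
  · exact mul_le_mul_of_nonneg_right (by linarith) n0
  · fin_cases i
    · exact H₄.trans (mul_le_mul_of_nonneg_right (by linarith) n0)
    · exact H₅.trans (mul_le_mul_of_nonneg_right (by linarith) n0)

/-! ### Transformation to a triangle -/

theorem setIntegral_cell_comp {a b c : Plane} (h : det2 (b - a) (c - a) ≠ 0) (G : Plane → ℝ) :
    ∫ x in cell {a, b, c}, G (affCoord a b c x)
      = |det2 (b - a) (c - a)| * ∫ x in refCell, G x := by
  rw [setIntegral_cell h]
  simp only [affCoord_affMap h]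

/-- The size parameter `h` bounds two edges from above and the area from below. -/
structure IsShape (c₁ : ℝ) (a b c : Plane) (h : ℝ) : Prop where
  pos : 0 < h
  left : ‖b - a‖ ≤ h
  right : ‖c - a‖ ≤ h
  area : h ^ 2 ≤ c₁ * |det2 (b - a) (c - a)|
  det_ne : det2 (b - a) (c - a) ≠ 0

theorem abs_apply_le_norm (v : Plane) (i : Fin 2) : |v i| ≤ ‖v‖ := by
  simpa using PiLp.norm_apply_le v i

/-- By the chain rule a derivative on the triangle is `d⁻¹` times a combination of reference
derivatives with coefficients at most `h`. Together with the `|d|` of the change of variables, the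
extra factor `|d|` cancels `d⁻²`. -/
theorem setIntegral_cell_pderiv_sq_le {c₁ h : ℝ} {a b c : Plane} (hs : IsShape c₁ a b c h)
    {G : Plane → ℝ} (hG : ContDiff ℝ ∞ G) {B : ℝ}
    (hGB : ∀ i, ∫ x in refCell, pderiv i G x ^ 2 ≤ B) (i : Fin 2) :
    |det2 (b - a) (c - a)| * ∫ x in cell {a, b, c}, pderiv i (fun x => G (affCoord a b c x)) x ^ 2
      ≤ 4 * h ^ 2 * B := by
  set d := det2 (b - a) (c - a) with hd
  have hd0 : d ≠ 0 := hs.det_ne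
  set g : Plane → ℝ := fun x => G (affCoord a b c x) with hg
  have hgs : ContDiff ℝ ∞ g := hG.comp (contDiff_affCoord a b c)
  have hgG : (fun x => g (affMap a b c x)) = G := by
    ext x; simp only [hg, affCoord_affMap hs.det_ne]
  have hint : ∀ i, Integrable (fun x => pderiv i G x ^ 2) (volume.restrict refCell) := fun i =>
    (memLp_refCell (contDiff_pderiv hG i).continuous).integrable_sq
  have bound : ∀ (u v p q : ℝ), |u| ≤ h → |v| ≤ h →
      (d⁻¹ * (u * p - v * q)) ^ 2 ≤ (d⁻¹) ^ 2 * (2 * h ^ 2 * (p ^ 2 + q ^ 2)) := by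
    intro u v p q hu hv
    rw [mul_pow]
    have hu' : u ^ 2 ≤ h ^ 2 := sq_le_sq' (abs_le.mp hu).1 (abs_le.mp hu).2
    have hv' : v ^ 2 ≤ h ^ 2 := sq_le_sq' (abs_le.mp hv).1 (abs_le.mp hv).2
    gcongr
    nlinarith [sq_nonneg (u * p + v * q), mul_le_mul_of_nonneg_right hu' (sq_nonneg p),
      mul_le_mul_of_nonneg_right hv' (sq_nonneg q)]
  have hb : ∀ j, |(b - a) j| ≤ h := fun j => (abs_apply_le_norm _ j).trans hs.left
  have hc : ∀ j, |(c - a) j| ≤ h := fun j => (abs_apply_le_norm _ j).trans hs.right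
  have pt : ∀ x, pderiv i g (affMap a b c x) ^ 2 ≤
      (d⁻¹) ^ 2 * (2 * h ^ 2 * (pderiv 0 G x ^ 2 + pderiv 1 G x ^ 2)) := by
    intro x
    fin_cases i
    · have := pderiv_zero_affMap hs.det_ne hgs x
      rw [hgG, ← hd] at this
      simp only [Fin.zero_eta, this]
      exact bound _ _ _ _ (hc 1) (hb 1)
    · have := pderiv_one_affMap hs.det_ne hgs x
      rw [hgG, ← hd] at this
      simp only [Fin.mk_one, this]
      rw [add_comm (pderiv 0 G x ^ 2)]
      exact bound _ _ _ _ (hb 0) (hc 0)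
  rw [setIntegral_cell hs.det_ne, ← hd]
  have h1 : ∫ x in refCell, pderiv i g (affMap a b c x) ^ 2 ≤
      ∫ x in refCell, (d⁻¹) ^ 2 * (2 * h ^ 2 * (pderiv 0 G x ^ 2 + pderiv 1 G x ^ 2)) := by
    apply integral_mono
    · exact (memLp_refCell ((contDiff_pderiv hgs i).continuous.comp
        (contDiff_affMap a b c).continuous)).integrable_sq
    · exact (((hint 0).add (hint 1)).const_mul _).const_mul _
    · exact pt
  rw [integral_const_mul, integral_const_mul, integral_add (hint 0) (hint 1)] at h1
  have h2 : |d| * |d| * (d⁻¹) ^ 2 = 1 := by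
    rw [← sq, sq_abs, ← mul_pow, mul_inv_cancel₀ hd0, one_pow]
  calc |d| * (|d| * ∫ x in refCell, pderiv i g (affMap a b c x) ^ 2)
      ≤ |d| * (|d| * ((d⁻¹) ^ 2 * (2 * h ^ 2 * ((∫ x in refCell, pderiv 0 G x ^ 2)
          + ∫ x in refCell, pderiv 1 G x ^ 2)))) := by gcongr
    _ = (|d| * |d| * (d⁻¹) ^ 2) * (2 * h ^ 2 * ((∫ x in refCell, pderiv 0 G x ^ 2)
          + ∫ x in refCell, pderiv 1 G x ^ 2)) := by ring
    _ ≤ 2 * h ^ 2 * (B + B) := by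
        rw [h2, one_mul]; gcongr <;> apply hGB
    _ = 4 * h ^ 2 * B := by ring

theorem tsupport_comp_affCoord {a b c : Plane} (h : det2 (b - a) (c - a) ≠ 0) (χ : Plane → ℝ) :
    tsupport (fun x => χ (affCoord a b c x)) = affCoord a b c ⁻¹' tsupport χ :=
  tsupport_comp_eq_preimage χ (affHomeo a b c h).symm

theorem isTest_comp_affCoord {a b c : Plane} (h : det2 (b - a) (c - a) ≠ 0) {χ : Plane → ℝ}
    (h1 : ContDiff ℝ ∞ χ) (h2 : HasCompactSupport χ) (h3 : tsupport χ ⊆ refCell) :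
    IsTest (cell {a, b, c}) fun x => χ (affCoord a b c x) := by
  refine ⟨h1.comp (contDiff_affCoord a b c),
    h2.comp_homeomorph (affHomeo a b c h).symm, ?_⟩
  rw [tsupport_comp_affCoord h, cell_eq_preimage h]
  exact Set.preimage_mono h3

/-- Bubble functions on shape regular triangles. -/
theorem exists_cell_bubble (m : ℕ) (c₁ : ℝ) : ∃ C : ℝ, 0 < C ∧
    ∀ (a b c : Plane) (h : ℝ), IsShape c₁ a b c h → ∀ r, IsPoly m r →
      ∃ ψ, IsTest (cell {a, b, c}) ψ ∧
        (∫ x in cell {a, b, c}, ψ x ^ 2 ≤ C * ∫ x in cell {a, b, c}, r x ^ 2) ∧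
        (∀ i, h ^ 2 * ∫ x in cell {a, b, c}, pderiv i ψ x ^ 2
          ≤ C * ∫ x in cell {a, b, c}, r x ^ 2) ∧
        ∀ g, MemL2 (cell {a, b, c}) g → ∀ D, 0 ≤ D →
          (∫ x in cell {a, b, c}, g x * ψ x) ^ 2 ≤ D * ∫ x in cell {a, b, c}, r x ^ 2 →
          ∫ x in cell {a, b, c}, g x ^ 2
            ≤ C * ((∫ x in cell {a, b, c}, (g x - r x) ^ 2) + D) := by
  obtain ⟨χ, hχ, hχc, hχs, K, hK, H⟩ := exists_refCell_bump m
  -- The summands serve, in order, the norm of the bubble, its derivatives, and the constant of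
  -- `integral_sq_le_of_bubble`.
  refine ⟨K + 4 * c₁ ^ 2 * K + (2 + 4 * K ^ 3 + 4 * K ^ 2), by positivity, ?_⟩
  intro a b c h hs r hr
  have hd0 := hs.det_ne
  set d := det2 (b - a) (c - a) with hd
  set q : Plane → ℝ := fun x => r (affMap a b c x) with hq
  have hqp : IsPoly m q := hr.comp_affMap a b c
  obtain ⟨H1, H2, H3⟩ := H q hqp
  have er : ∀ x, r x = q (affCoord a b c x) := fun x => by
    simp only [hq, affMap_affCoord hd0]
  set G : Plane → ℝ := fun x => χ x ^ 2 * q x with hG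
  have hGs : ContDiff ℝ ∞ G := (hχ.pow 2).mul hqp.contDiff
  have hGc : HasCompactSupport G := by
    have : HasCompactSupport fun x => χ x ^ 2 := by
      simp only [sq]; exact hχc.mul_right
    exact this.mul_right
  have hGt : tsupport G ⊆ refCell := by
    refine subset_trans ?_ hχs
    apply closure_mono
    intro x hx hx'
    exact hx (by simp [hG, hx'])
  have ht := isTest_comp_affCoord hd0 hGs hGc hGt
  have er2 : ∫ x in cell {a, b, c}, r x ^ 2 = |d| * ∫ x in refCell, q x ^ 2 := by
    simp only [er]; exact setIntegral_cell_comp hd0 fun x => q x ^ 2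
  have eψ2 : ∫ x in cell {a, b, c}, G (affCoord a b c x) ^ 2 = |d| * ∫ x in refCell, G x ^ 2 :=
    setIntegral_cell_comp hd0 fun x => G x ^ 2
  have eψr : ∫ x in cell {a, b, c}, G (affCoord a b c x) * r x
      = |d| * ∫ x in refCell, (χ x * q x) ^ 2 := by
    simp only [er]
    rw [setIntegral_cell_comp hd0 fun x => G x * q x]
    congr 2; ext x; simp only [hG]; ring
  have hdp : 0 < |d| := abs_pos.mpr hd0
  have hR : 0 ≤ ∫ x in refCell, q x ^ 2 := integral_sq_nonneg _
  have hRT : 0 ≤ ∫ x in cell {a, b, c}, r x ^ 2 := integral_sq_nonneg _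
  have hψ : ∫ x in cell {a, b, c}, G (affCoord a b c x) ^ 2 ≤ K * ∫ x in cell {a, b, c}, r x ^ 2 := by
    rw [eψ2, er2, mul_left_comm]; gcongr
  refine ⟨_, ht, ?_, ?_, ?_⟩
  · refine hψ.trans (mul_le_mul_of_nonneg_right ?_ hRT)
    have : 0 ≤ 4 * c₁ ^ 2 * K + (2 + 4 * K ^ 3 + 4 * K ^ 2) := by positivity
    linarith
  · intro i
    have h1 := setIntegral_cell_pderiv_sq_le hs hGs H3 i
    rw [← hd] at h1
    have n1 : 0 ≤ ∫ x in cell {a, b, c}, pderiv i (fun x => G (affCoord a b c x)) x ^ 2 :=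
      integral_sq_nonneg _
    -- The area bound is used squared: one factor `|d|` cancels, the other turns the reference norm
    -- of `q` into the norm of `r` on the triangle.
    have hh : h ^ 2 * h ^ 2 ≤ c₁ ^ 2 * (|d| * |d|) := by
      have := hs.area
      rw [← hd] at this
      have h0 : 0 ≤ c₁ * |d| := (sq_nonneg h).trans this
      calc h ^ 2 * h ^ 2 ≤ (c₁ * |d|) * (c₁ * |d|) := by gcongr
        _ = _ := by ring
    have h2 : |d| * (h ^ 2 * ∫ x in cell {a, b, c}, pderiv i (fun x => G (affCoord a b c x)) x ^ 2)
        ≤ |d| * (4 * c₁ ^ 2 * K * ∫ x in cell {a, b, c}, r x ^ 2) := by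
      calc _ = h ^ 2 * (|d| * ∫ x in cell {a, b, c},
              pderiv i (fun x => G (affCoord a b c x)) x ^ 2) := by ring
        _ ≤ h ^ 2 * (4 * h ^ 2 * (K * ∫ x in refCell, q x ^ 2)) := by gcongr
        _ = 4 * (h ^ 2 * h ^ 2) * (K * ∫ x in refCell, q x ^ 2) := by ring
        _ ≤ 4 * (c₁ ^ 2 * (|d| * |d|)) * (K * ∫ x in refCell, q x ^ 2) := by gcongr
        _ = _ := by rw [er2]; ring
    refine (le_of_mul_le_mul_left h2 hdp).trans (mul_le_mul_of_nonneg_right ?_ hRT)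
    have : 0 ≤ K + (2 + 4 * K ^ 3 + 4 * K ^ 2) := by positivity
    linarith
  · intro g hg D hD hgD
    have hO : 0 ≤ ∫ x in cell {a, b, c}, (g x - r x) ^ 2 := integral_sq_nonneg fun x => g x - r x
    refine (integral_sq_le_of_bubble hg (memLp_cell hr.contDiff.continuous _)
      (memLp_cell ht.1.continuous _) hK.le hD ?_ hψ hgD).trans
      (mul_le_mul_of_nonneg_right ?_ (by positivity))
    · rw [eψr, er2, mul_left_comm]; gcongr
    · have : 0 ≤ K + 4 * c₁ ^ 2 * K := by positivity
      linarith

/-- Bubble functions on edges and their extensions to shape regular triangles. -/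
theorem exists_edge_bubble (m : ℕ) (c₁ : ℝ) : ∃ C : ℝ, 0 < C ∧
    ∀ P : Polynomial ℝ, P.natDegree ≤ m →
      (∀ J : ℝ → ℝ, MemLp J 2 (volume.restrict (Set.Ioc (0 : ℝ) 1)) → ∀ D, 0 ≤ D →
        (∫ s in Set.Ioc (0 : ℝ) 1, J s * ((s * (1 - s)) ^ 2 * P.eval s)) ^ 2
          ≤ D * ∫ s in Set.Ioc (0 : ℝ) 1, P.eval s ^ 2 →
        ∫ s in Set.Ioc (0 : ℝ) 1, J s ^ 2
          ≤ C * ((∫ s in Set.Ioc (0 : ℝ) 1, (J s - P.eval s) ^ 2) + D)) ∧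
      ∀ (a b c : Plane) (h : ℝ), IsShape c₁ a b c h →
        (∫ x in cell {a, b, c}, refEdgeBubble P (affCoord a b c x) ^ 2
          ≤ C * h ^ 2 * ∫ s in Set.Ioc (0 : ℝ) 1, P.eval s ^ 2) ∧
        ∀ i, ∫ x in cell {a, b, c}, pderiv i (fun x => refEdgeBubble P (affCoord a b c x)) x ^ 2
          ≤ C * ∫ s in Set.Ioc (0 : ℝ) 1, P.eval s ^ 2 := by
  obtain ⟨K, hK, H⟩ := exists_refEdgeBubble_bound m
  -- `2 K` comes from `|d| ≤ 2 h²`, and `4 |c₁| K` from `h² ≤ |c₁| |d|` in the bound for the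
  -- derivatives. The edge parameter stays in the unit interval, so the extension scales like `h`
  -- and its derivatives are scale free.
  refine ⟨2 * K + 4 * |c₁| * K + (2 + 4 * K ^ 3 + 4 * K ^ 2), by positivity, ?_⟩
  intro P hP
  obtain ⟨H1, H2, H3, H4⟩ := H P hP
  have hR : 0 ≤ ∫ s in Set.Ioc (0 : ℝ) 1, P.eval s ^ 2 := integral_sq_nonneg _
  refine ⟨?_, ?_⟩
  · intro J hJ D hD hJD
    have hO : 0 ≤ ∫ s in Set.Ioc (0 : ℝ) 1, (J s - P.eval s) ^ 2 :=
      integral_sq_nonneg fun x => J x - P.eval x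
    refine (integral_sq_le_of_bubble hJ (memLp_Ioc P.continuous) (memLp_Ioc
      (by have := P.continuous; fun_prop)) hK.le hD ?_ H2 hJD).trans
      (mul_le_mul_of_nonneg_right ?_ (by positivity))
    · refine H1.trans (le_of_eq ?_)
      congr 2; ext s; ring
    · have : 0 ≤ 2 * K + 4 * |c₁| * K := by positivity
      linarith
  · intro a b c h hs
    have hd0 := hs.det_ne
    set d := det2 (b - a) (c - a) with hd
    have hdp : 0 < |d| := abs_pos.mpr hd0
    constructor
    · have hdle : |d| ≤ 2 * h ^ 2 := by
        have hb : ∀ j, |(b - a) j| ≤ h := fun j => (abs_apply_le_norm _ j).trans hs.left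
        have hc : ∀ j, |(c - a) j| ≤ h := fun j => (abs_apply_le_norm _ j).trans hs.right
        have h0 := hs.pos
        calc |d| ≤ |(b - a) 0 * (c - a) 1| + |(b - a) 1 * (c - a) 0| := by
              rw [hd, det2]; exact abs_sub _ _
          _ ≤ h * h + h * h := by
              rw [abs_mul, abs_mul]
              gcongr <;> first | apply hb | apply hc
          _ = 2 * h ^ 2 := by ring
      have e : ∫ x in cell {a, b, c}, refEdgeBubble P (affCoord a b c x) ^ 2
          = |d| * ∫ x in refCell, refEdgeBubble P x ^ 2 :=
        setIntegral_cell_comp hd0 fun x => refEdgeBubble P x ^ 2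
      rw [e]
      calc |d| * ∫ x in refCell, refEdgeBubble P x ^ 2
          ≤ (2 * h ^ 2) * (K * ∫ s in Set.Ioc (0 : ℝ) 1, P.eval s ^ 2) := by
            gcongr
        _ = 2 * K * h ^ 2 * ∫ s in Set.Ioc (0 : ℝ) 1, P.eval s ^ 2 := by ring
        _ ≤ _ := by
            gcongr
            have : 0 ≤ 4 * |c₁| * K + (2 + 4 * K ^ 3 + 4 * K ^ 2) := by positivity
            linarith
    · intro i
      have h1 := setIntegral_cell_pderiv_sq_le hs (contDiff_refEdgeBubble P) H4 i
      rw [← hd] at h1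
      have h2 : |d| * ∫ x in cell {a, b, c},
            pderiv i (fun x => refEdgeBubble P (affCoord a b c x)) x ^ 2
          ≤ |d| * (4 * |c₁| * K * ∫ s in Set.Ioc (0 : ℝ) 1, P.eval s ^ 2) := by
        calc _ ≤ 4 * h ^ 2 * (K * ∫ s in Set.Ioc (0 : ℝ) 1, P.eval s ^ 2) := h1
          _ ≤ 4 * (|c₁| * |d|) * (K * ∫ s in Set.Ioc (0 : ℝ) 1, P.eval s ^ 2) := by
              have := hs.area.trans (mul_le_mul_of_nonneg_right (le_abs_self c₁) (abs_nonneg _))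
              gcongr
          _ = _ := by ring
      refine (le_of_mul_le_mul_left h2 hdp).trans (mul_le_mul_of_nonneg_right ?_ hR)
      have : 0 ≤ 2 * K + (2 + 4 * K ^ 3 + 4 * K ^ 2) := by positivity
      linarith

/-! ### Test functions and weak derivatives -/

theorem pderiv_comm {φ : Plane → ℝ} (hφ : ContDiff ℝ ∞ φ) (i j : Fin 2) (x : Plane) :
    pderiv i (pderiv j φ) x = pderiv j (pderiv i φ) x := by
  have hsymm : IsSymmSndFDerivAt ℝ φ x :=
    hφ.contDiffAt.isSymmSndFDerivAt (by
      rw [minSmoothness_of_isRCLikeNormedField]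
      exact WithTop.coe_le_coe.mpr (le_top : (2 : ℕ∞) ≤ ⊤))
  have hd : DifferentiableAt ℝ (fderiv ℝ φ) x :=
    (hφ.fderiv_right (m := ∞) (by simp)).differentiable (by simp) x
  have key : ∀ i j : Fin 2, pderiv i (pderiv j φ) x
      = fderiv ℝ (fderiv ℝ φ) x (EuclideanSpace.single i 1) (EuclideanSpace.single j 1) := by
    intro i j
    have h := hd.hasFDerivAt.clm_apply (hasFDerivAt_const (EuclideanSpace.single j (1 : ℝ)) x)
    have h' : pderiv i (pderiv j φ) x = fderiv ℝ (fun y => fderiv ℝ φ y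
      (EuclideanSpace.single j (1 : ℝ))) x (EuclideanSpace.single i 1) := rfl
    rw [h', h.fderiv]
    simp
  rw [key, key]
  exact hsymm _ _

theorem pderiv_mul {f g : Plane → ℝ} (hf : ContDiff ℝ ∞ f) (hg : ContDiff ℝ ∞ g) (i : Fin 2)
    (x : Plane) : pderiv i (fun x => f x * g x) x = pderiv i f x * g x + f x * pderiv i g x := by
  unfold pderiv
  rw [fderiv_fun_mul (hf.differentiable (by simp) x) (hg.differentiable (by simp) x)]
  simp
  ring

theorem IsTest.pderiv {U : Set Plane} {φ : Plane → ℝ} (hφ : IsTest U φ) (i : Fin 2) :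
    IsTest U (MixedFEM.pderiv i φ) := by
  refine ⟨contDiff_pderiv hφ.1 i, hφ.2.1.fderiv_apply ℝ _, ?_⟩
  refine subset_trans ?_ hφ.2.2
  refine subset_trans ?_ (tsupport_fderiv_subset ℝ (f := φ))
  apply closure_mono
  intro x hx hx'
  exact hx (by simp [MixedFEM.pderiv, hx'])

theorem IsTest.mono {U V : Set Plane} {φ : Plane → ℝ} (hφ : IsTest U φ) (h : U ⊆ V) :
    IsTest V φ := ⟨hφ.1, hφ.2.1, hφ.2.2.trans h⟩

theorem IsTest.memLp {U V : Set Plane} {φ : Plane → ℝ} (hφ : IsTest U φ) :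
    MemLp φ 2 (volume.restrict V) :=
  (hφ.1.continuous.memLp_of_hasCompactSupport hφ.2.1).restrict V

theorem IsTest.eq_zero {U : Set Plane} {φ : Plane → ℝ} (hφ : IsTest U φ) {x : Plane} (hx : x ∉ U) :
    φ x = 0 := image_eq_zero_of_notMem_tsupport fun h => hx (hφ.2.2 h)

theorem IsTest.setIntegral_mul_eq {U V : Set Plane} {φ : Plane → ℝ} (hφ : IsTest U φ)
    (hV : MeasurableSet V) (h : U ⊆ V) (f : Plane → ℝ) :
    ∫ x in V, f x * φ x = ∫ x in U, f x * φ x := by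
  apply setIntegral_eq_of_subset_of_forall_sdiff_eq_zero hV h
  intro x hx
  rw [hφ.eq_zero hx.2, mul_zero]

/-- The fundamental lemma of the calculus of variations; it makes the arbitrary choices in the weak
operators harmless. -/
theorem ae_eq_of_forall_test {U : Set Plane} (hU : IsOpen U) {f g : Plane → ℝ} (hf : MemL2 U f)
    (hg : MemL2 U g) (h : ∀ φ, IsTest U φ → ∫ x in U, f x * φ x = ∫ x in U, g x * φ x) :
    f =ᵐ[volume.restrict U] g := by
  have hloc : LocallyIntegrableOn (f - g) U volume := by
    have := (hf.sub hg).locallyIntegrable one_le_two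
    rw [locallyIntegrableOn_iff hU.isLocallyClosed]
    intro k hk hkc
    have := this.integrableOn_isCompact hkc
    rwa [IntegrableOn, Measure.restrict_restrict hkc.measurableSet,
      Set.inter_eq_left.mpr hk] at this
  have := hU.ae_eq_zero_of_integral_contDiff_smul_eq_zero hloc (by
    intro φ h1 h2 h3
    have ht : IsTest U φ := ⟨h1, h2, h3⟩
    have e : ∀ x, φ x • (f - g) x = (f x - g x) * φ x := fun x => by simp [mul_comm]
    simp only [e]
    have e2 := ht.setIntegral_mul_eq MeasurableSet.univ (Set.subset_univ U) (fun x => f x - g x)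
    rw [setIntegral_univ] at e2
    rw [e2]
    simp only [sub_mul]
    rw [integral_sub (integrable_mul_of_memLp hf ht.memLp) (integrable_mul_of_memLp hg ht.memLp),
      h φ ht, sub_self])
  rw [EventuallyEq, ae_restrict_iff' hU.measurableSet]
  filter_upwards [this] with x hx hxU
  exact sub_eq_zero.mp (hx hxU)

theorem MemL2.apply {U : Set Plane} {G : Plane → Plane} (hG : MemL2 U G) (i : Fin 2) :
    MemL2 U fun x => G x i := by
  have := (EuclideanSpace.proj i : Plane →L[ℝ] ℝ).comp_memLp' hG
  exact this

theorem MemL2.mono_set {F : Type*} [NormedAddCommGroup F] {U V : Set Plane} {g : Plane → F}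
    (hg : MemL2 V g) (h : U ⊆ V) : MemL2 U g :=
  hg.mono_measure (Measure.restrict_mono h le_rfl)

theorem MemH1.weakGrad_spec {U : Set Plane} {v : Plane → ℝ} (hv : MemH1 U v) :
    MemL2 U (weakGrad U v) ∧ HasWeakGrad U v (weakGrad U v) := by
  rw [weakGrad, dif_pos hv.2]
  exact hv.2.choose_spec

theorem MemHDiv.weakDiv_spec {U : Set Plane} {q : Plane → Plane} (hq : MemHDiv U q) :
    MemL2 U (weakDiv U q) ∧ HasWeakDiv U q (weakDiv U q) := by
  rw [weakDiv, dif_pos hq.2]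
  exact hq.2.choose_spec

theorem HasWeakGrad.mono {U V : Set Plane} {v : Plane → ℝ} {G : Plane → Plane}
    (hG : HasWeakGrad V v G) (hV : MeasurableSet V) (h : U ⊆ V) : HasWeakGrad U v G := by
  intro φ hφ i
  have := hG φ (hφ.mono h) i
  rwa [(hφ.pderiv i).setIntegral_mul_eq hV h, hφ.setIntegral_mul_eq hV h] at this

/-- Curl of a gradient: the derivatives of `φ` are themselves admissible tests for the weak
gradient, and mixed second derivatives commute. -/
theorem HasWeakGrad.integral_curl_eq_zero {U : Set Plane} {v : Plane → ℝ} {G : Plane → Plane}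
    (hG : HasWeakGrad U v G) (hG2 : MemL2 U G) {φ : Plane → ℝ} (hφ : IsTest U φ) :
    ∫ x in U, (G x 1 * pderiv 0 φ x - G x 0 * pderiv 1 φ x) = 0 := by
  have h1 := hG _ (hφ.pderiv 0) 1
  have h2 := hG _ (hφ.pderiv 1) 0
  rw [integral_sub (integrable_mul_of_memLp (hG2.apply 1) (hφ.pderiv 0).memLp)
    (integrable_mul_of_memLp (hG2.apply 0) (hφ.pderiv 1).memLp)]
  simp only [pderiv_comm hφ.1 1 0] at h1
  linarith

theorem HasWeakDiv.unique {U : Set Plane} (hU : IsOpen U) {q : Plane → Plane} {d d' : Plane → ℝ}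
    (h : HasWeakDiv U q d) (h' : HasWeakDiv U q d') (hd : MemL2 U d) (hd' : MemL2 U d') :
    d =ᵐ[volume.restrict U] d' :=
  ae_eq_of_forall_test hU hd hd' fun φ hφ => by
    have h1 := h φ hφ
    have h2 := h' φ hφ
    linarith

theorem HasWeakDiv.sub {U : Set Plane} {q q' : Plane → Plane} {d d' : Plane → ℝ}
    (h : HasWeakDiv U q d) (h' : HasWeakDiv U q' d') (hq : MemL2 U q) (hq' : MemL2 U q')
    (hd : MemL2 U d) (hd' : MemL2 U d') : HasWeakDiv U (q - q') (d - d') := by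
  intro φ hφ
  have i1 : ∀ p : Plane → Plane, MemL2 U p →
      Integrable (fun x => p x 0 * pderiv 0 φ x + p x 1 * pderiv 1 φ x) (volume.restrict U) :=
    fun p hp => (integrable_mul_of_memLp (hp.apply 0) (hφ.pderiv 0).memLp).add
      (integrable_mul_of_memLp (hp.apply 1) (hφ.pderiv 1).memLp)
  have h1 := h φ hφ
  have h2 := h' φ hφ
  have e1 := integral_sub (i1 q hq) (i1 q' hq')
  have e2 := integral_sub (integrable_mul_of_memLp hd (hφ.memLp (V := U)))
    (integrable_mul_of_memLp hd' (hφ.memLp (V := U)))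
  have e3 : ∫ x in U, (d - d') x * φ x = (∫ x in U, d x * φ x) - ∫ x in U, d' x * φ x := by
    rw [← e2]; congr 1; ext x; simp only [Pi.sub_apply]; ring
  rw [e3]
  have e4 : ∫ x in U, ((q - q') x 0 * pderiv 0 φ x + (q - q') x 1 * pderiv 1 φ x)
      = (∫ x in U, (q x 0 * pderiv 0 φ x + q x 1 * pderiv 1 φ x))
        - ∫ x in U, (q' x 0 * pderiv 0 φ x + q' x 1 * pderiv 1 φ x) := by
    rw [← e1]; congr 1; ext x; simp only [Pi.sub_apply, PiLp.sub_apply]; ring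
  rw [e4]
  linarith

/-- The weak gradients of the components provide an `L²` curl, so `weakCurl` is not its default
value here. -/
theorem weakCurl_spec {U : Set Plane} {σ : Plane → Plane} (h : ∀ i, MemH1 U fun x => σ x i) :
    (MemL2 U (weakCurl U σ) ∧ HasWeakCurl U σ (weakCurl U σ)) ∧
      MemL2 U (fun x => weakGrad U (fun x => σ x 1) x 0 - weakGrad U (fun x => σ x 0) x 1) ∧
      HasWeakCurl U σ
        (fun x => weakGrad U (fun x => σ x 1) x 0 - weakGrad U (fun x => σ x 0) x 1) := by
  have h0 := (h 0).weakGrad_spec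
  have h1 := (h 1).weakGrad_spec
  have hL : MemL2 U
      (fun x => weakGrad U (fun x => σ x 1) x 0 - weakGrad U (fun x => σ x 0) x 1) :=
    (h1.1.apply 0).sub (h0.1.apply 1)
  have hC : HasWeakCurl U σ
      (fun x => weakGrad U (fun x => σ x 1) x 0 - weakGrad U (fun x => σ x 0) x 1) := by
    intro φ hφ
    have e0 := h0.2 φ hφ 1
    have e1 := h1.2 φ hφ 0
    have f1 := integral_sub (integrable_mul_of_memLp (h 1).1 (hφ.pderiv 0).memLp)
      (integrable_mul_of_memLp (h 0).1 (hφ.pderiv 1).memLp)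
    have f2 := integral_sub (integrable_mul_of_memLp (h1.1.apply 0) hφ.memLp)
      (integrable_mul_of_memLp (h0.1.apply 1) hφ.memLp)
    simp only [sub_mul]
    rw [f1, f2]
    linarith
  refine ⟨?_, hL, hC⟩
  have hex : ∃ c : Plane → ℝ, MemL2 U c ∧ HasWeakCurl U σ c := ⟨_, hL, hC⟩
  rw [weakCurl, dif_pos hex]
  exact hex.choose_spec

theorem weakCurl_ae_eq {U : Set Plane} (hU : IsOpen U) {σ : Plane → Plane}
    (h : ∀ i, MemH1 U fun x => σ x i) : weakCurl U σ =ᵐ[volume.restrict U]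
      fun x => weakGrad U (fun x => σ x 1) x 0 - weakGrad U (fun x => σ x 0) x 1 := by
  obtain ⟨⟨h1, h2⟩, h3, h4⟩ := weakCurl_spec h
  exact ae_eq_of_forall_test hU h1 h3 fun φ hφ => by
    have e1 := h2 φ hφ
    have e2 := h4 φ hφ
    linarith

theorem HasWeakGrad.of_contDiff (U : Set Plane) {v : Plane → ℝ}
    (hv : ContDiff ℝ ∞ v) : HasWeakGrad U v fun x => !₂[pderiv 0 v x, pderiv 1 v x] := by
  intro φ hφ i
  have e : ∀ x, ![pderiv 0 v x, pderiv 1 v x] i = pderiv i v x := by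
    intro x; fin_cases i <;> simp
  simp only [e]
  rw [← (hφ.pderiv i).setIntegral_mul_eq MeasurableSet.univ (Set.subset_univ U),
    ← hφ.setIntegral_mul_eq MeasurableSet.univ (Set.subset_univ U), setIntegral_univ,
    setIntegral_univ]
  have c1 : HasCompactSupport fun x => pderiv i v x * φ x := hφ.2.1.mul_left
  have c2 : HasCompactSupport fun x => v x * pderiv i φ x := (hφ.pderiv i).2.1.mul_left
  have c3 : HasCompactSupport fun x => v x * φ x := hφ.2.1.mul_left
  exact integral_mul_fderiv_eq_neg_fderiv_mul_of_integrable (μ := volume)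
    (((contDiff_pderiv hv i).continuous.mul hφ.1.continuous).integrable_of_hasCompactSupport c1)
    ((hv.continuous.mul (contDiff_pderiv hφ.1 i).continuous).integrable_of_hasCompactSupport c2)
    ((hv.continuous.mul hφ.1.continuous).integrable_of_hasCompactSupport c3)
    (fun x _ => hv.differentiable (by simp) x) (fun x _ => hφ.1.differentiable (by simp) x)

theorem MemL2.of_apply {U : Set Plane} {G : Plane → Plane} (h : ∀ i, MemL2 U fun x => G x i) :
    MemL2 U G := by
  have h0 : MemLp (fun x => G x 0 • (EuclideanSpace.single 0 1 : Plane)) 2 (volume.restrict U) :=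
    (ContinuousLinearMap.toSpanSingleton ℝ (EuclideanSpace.single 0 1 : Plane)).comp_memLp' (h 0)
  have h1 : MemLp (fun x => G x 1 • (EuclideanSpace.single 1 1 : Plane)) 2 (volume.restrict U) :=
    (ContinuousLinearMap.toSpanSingleton ℝ (EuclideanSpace.single 1 1 : Plane)).comp_memLp' (h 1)
  have := h0.add h1
  have e : G = (fun x => G x 0 • (EuclideanSpace.single 0 1 : Plane))
      + fun x => G x 1 • (EuclideanSpace.single 1 1 : Plane) := by
    ext x i; fin_cases i <;> simp
  rw [MemL2, e]
  exact this

/-- Ensures that the elementwise weak gradient of a discrete displacement is the true one and not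
the default value. -/
theorem memH1_cell_of_ae_eq_isPoly {T : Finset Plane} {m : ℕ} {v q : Plane → ℝ} (hq : IsPoly m q)
    (h : v =ᵐ[volume.restrict (cell T)] q) : MemH1 (cell T) v := by
  have hs := hq.contDiff
  refine ⟨(memLp_cell hs.continuous T).ae_eq h.symm, fun x => !₂[pderiv 0 q x, pderiv 1 q x], ?_,
    fun φ hφ i => ?_⟩
  · apply MemL2.of_apply
    intro i
    fin_cases i
    · exact memLp_cell (contDiff_pderiv hs 0).continuous T
    · exact memLp_cell (contDiff_pderiv hs 1).continuous T
  · rw [← HasWeakGrad.of_contDiff (cell T) hs φ hφ i]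
    apply integral_congr_ae
    filter_upwards [h] with x hx
    rw [hx]

/-! ### Bounds on one triangle -/

theorem sq_sub_le_two (x y : ℝ) : (x - y) ^ 2 ≤ 2 * (x ^ 2 + y ^ 2) := by
  nlinarith [sq_nonneg (x + y)]

/-- The test identity puts a derivative on the bubble; the weight `h²` pays for it. The field `ε`
will be `∇u - σ` and `g` the curl of `σ`. -/
theorem exists_curl_bound (m : ℕ) (c₁ : ℝ) : ∃ C : ℝ, 0 < C ∧
    ∀ (a b c : Plane) (h : ℝ), IsShape c₁ a b c h → ∀ (ε : Plane → Plane) (g : Plane → ℝ),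
      (∀ i, MemL2 (cell {a, b, c}) fun x => ε x i) → MemL2 (cell {a, b, c}) g →
      (∀ φ, IsTest (cell {a, b, c}) φ → ∫ x in cell {a, b, c}, g x * φ x
        = ∫ x in cell {a, b, c}, (ε x 1 * pderiv 0 φ x - ε x 0 * pderiv 1 φ x)) →
      ∀ r, IsPoly m r → h ^ 2 * ∫ x in cell {a, b, c}, g x ^ 2
        ≤ C * ((∫ x in cell {a, b, c}, ε x 0 ^ 2) + (∫ x in cell {a, b, c}, ε x 1 ^ 2)
          + h ^ 2 * ∫ x in cell {a, b, c}, (g x - r x) ^ 2) := by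
  obtain ⟨K, hK, H⟩ := exists_cell_bubble m c₁
  refine ⟨K + 2 * K ^ 2, by positivity, ?_⟩
  intro a b c h hs ε g hε hg hgt r hr
  obtain ⟨ψ, hψ, -, Hd, Hg⟩ := H a b c h hs r hr
  have hh := hs.pos
  have hd := fun i => (hψ.pderiv i).memLp (V := cell {a, b, c})
  have c0 := sq_integral_mul_le (hε 0) (hd 1)
  have c1 := sq_integral_mul_le (hε 1) (hd 0)
  have e0 : 0 ≤ ∫ x in cell {a, b, c}, ε x 0 ^ 2 := integral_sq_nonneg _
  have e1 : 0 ≤ ∫ x in cell {a, b, c}, ε x 1 ^ 2 := integral_sq_nonneg _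
  have eo : 0 ≤ ∫ x in cell {a, b, c}, (g x - r x) ^ 2 := integral_sq_nonneg fun x => g x - r x
  have hd' : ∀ i, ∫ x in cell {a, b, c}, pderiv i ψ x ^ 2
      ≤ K * (∫ x in cell {a, b, c}, r x ^ 2) / h ^ 2 := fun i => by
    rw [le_div_iff₀ (by positivity), mul_comm]; exact Hd i
  -- The factor `2` is from `sq_sub_le_two`, and `K / h²` is the bound for the bubble derivatives
  -- after Cauchy–Schwarz.
  have key := Hg g hg (2 * K * ((∫ x in cell {a, b, c}, ε x 0 ^ 2)
    + ∫ x in cell {a, b, c}, ε x 1 ^ 2) / h ^ 2) (by positivity) (by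
      rw [hgt ψ hψ, integral_sub (integrable_mul_of_memLp (hε 1) (hd 0))
        (integrable_mul_of_memLp (hε 0) (hd 1))]
      refine (sq_sub_le_two _ _).trans ?_
      calc _ ≤ 2 * ((∫ x in cell {a, b, c}, ε x 1 ^ 2)
              * (K * (∫ x in cell {a, b, c}, r x ^ 2) / h ^ 2)
            + (∫ x in cell {a, b, c}, ε x 0 ^ 2)
              * (K * (∫ x in cell {a, b, c}, r x ^ 2) / h ^ 2)) := by
            gcongr
            · exact c1.trans (mul_le_mul_of_nonneg_left (hd' 0) e1)
            · exact c0.trans (mul_le_mul_of_nonneg_left (hd' 1) e0)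
        _ = _ := by ring)
  calc _ ≤ h ^ 2 * (K * ((∫ x in cell {a, b, c}, (g x - r x) ^ 2)
        + 2 * K * ((∫ x in cell {a, b, c}, ε x 0 ^ 2)
          + ∫ x in cell {a, b, c}, ε x 1 ^ 2) / h ^ 2)) := by gcongr
    _ = K * (h ^ 2 * ∫ x in cell {a, b, c}, (g x - r x) ^ 2)
        + 2 * K ^ 2 * ((∫ x in cell {a, b, c}, ε x 0 ^ 2)
          + ∫ x in cell {a, b, c}, ε x 1 ^ 2) := by field_simp
    _ ≤ (K + 2 * K ^ 2) * (h ^ 2 * ∫ x in cell {a, b, c}, (g x - r x) ^ 2)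
        + (K + 2 * K ^ 2) * ((∫ x in cell {a, b, c}, ε x 0 ^ 2)
          + ∫ x in cell {a, b, c}, ε x 1 ^ 2) := by
        gcongr <;> nlinarith
    _ = _ := by ring

/-- With `w = u - u_h` and `ε = ∂ᵢu - σᵢ`, the residual `g = σᵢ - ∂ᵢu_h` equals `∂ᵢw - ε`. Only `w`
meets a derivative of the bubble, which is why `h²` stays in front of `ε` alone. -/
theorem exists_gradResidual_bound (m : ℕ) (c₁ : ℝ) : ∃ C : ℝ, 0 < C ∧
    ∀ (a b c : Plane) (h : ℝ), IsShape c₁ a b c h → ∀ (i : Fin 2) (ε w g : Plane → ℝ),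
      MemL2 (cell {a, b, c}) ε → MemL2 (cell {a, b, c}) w → MemL2 (cell {a, b, c}) g →
      (∀ φ, IsTest (cell {a, b, c}) φ → ∫ x in cell {a, b, c}, g x * φ x
        = -(∫ x in cell {a, b, c}, w x * pderiv i φ x) - ∫ x in cell {a, b, c}, ε x * φ x) →
      ∀ r, IsPoly m r → h ^ 2 * ∫ x in cell {a, b, c}, g x ^ 2
        ≤ C * ((∫ x in cell {a, b, c}, w x ^ 2) + h ^ 2 * (∫ x in cell {a, b, c}, ε x ^ 2)
          + h ^ 2 * ∫ x in cell {a, b, c}, (g x - r x) ^ 2) := by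
  obtain ⟨K, hK, H⟩ := exists_cell_bubble m c₁
  refine ⟨K + 2 * K ^ 2, by positivity, ?_⟩
  intro a b c h hs i ε w g hε hw hg hgt r hr
  obtain ⟨ψ, hψ, Hψ, Hd, Hg⟩ := H a b c h hs r hr
  have hh := hs.pos
  have c0 := sq_integral_mul_le hw ((hψ.pderiv i).memLp (V := cell {a, b, c}))
  have c1 := sq_integral_mul_le hε (hψ.memLp (V := cell {a, b, c}))
  have e0 : 0 ≤ ∫ x in cell {a, b, c}, w x ^ 2 := integral_sq_nonneg _
  have e1 : 0 ≤ ∫ x in cell {a, b, c}, ε x ^ 2 := integral_sq_nonneg _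
  have eo : 0 ≤ ∫ x in cell {a, b, c}, (g x - r x) ^ 2 := integral_sq_nonneg fun x => g x - r x
  have hd' : ∫ x in cell {a, b, c}, pderiv i ψ x ^ 2
      ≤ K * (∫ x in cell {a, b, c}, r x ^ 2) / h ^ 2 := by
    rw [le_div_iff₀ (by positivity), mul_comm]; exact Hd i
  have key := Hg g hg (2 * K * ((∫ x in cell {a, b, c}, w x ^ 2) / h ^ 2
    + ∫ x in cell {a, b, c}, ε x ^ 2)) (by positivity) (by
      rw [hgt ψ hψ]
      refine (sq_sub_le_two _ _).trans ?_
      rw [neg_sq]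
      calc _ ≤ 2 * ((∫ x in cell {a, b, c}, w x ^ 2)
              * (K * (∫ x in cell {a, b, c}, r x ^ 2) / h ^ 2)
            + (∫ x in cell {a, b, c}, ε x ^ 2) * (K * ∫ x in cell {a, b, c}, r x ^ 2)) := by
            gcongr
            · exact c0.trans (mul_le_mul_of_nonneg_left hd' e0)
            · exact c1.trans (mul_le_mul_of_nonneg_left Hψ e1)
        _ = _ := by ring)
  calc _ ≤ h ^ 2 * (K * ((∫ x in cell {a, b, c}, (g x - r x) ^ 2)
        + 2 * K * ((∫ x in cell {a, b, c}, w x ^ 2) / h ^ 2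
          + ∫ x in cell {a, b, c}, ε x ^ 2))) := by gcongr
    _ = K * (h ^ 2 * ∫ x in cell {a, b, c}, (g x - r x) ^ 2)
        + 2 * K ^ 2 * ((∫ x in cell {a, b, c}, w x ^ 2)
          + h ^ 2 * ∫ x in cell {a, b, c}, ε x ^ 2) := by field_simp
    _ ≤ (K + 2 * K ^ 2) * (h ^ 2 * ∫ x in cell {a, b, c}, (g x - r x) ^ 2)
        + (K + 2 * K ^ 2) * ((∫ x in cell {a, b, c}, w x ^ 2)
          + h ^ 2 * ∫ x in cell {a, b, c}, ε x ^ 2) := by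
        gcongr <;> nlinarith
    _ = _ := by ring

/-! ### Geometry of triangulations -/

theorem det2_ne_zero_of_affineIndependent {a b c : Plane} (hab : a ≠ b) (hac : a ≠ c) (hbc : b ≠ c)
    (h : AffineIndependent ℝ ((↑) : ({a, b, c} : Finset Plane) → Plane)) :
    det2 (b - a) (c - a) ≠ 0 := by
  intro hd
  let f : Fin 3 ↪ ({a, b, c} : Finset Plane) :=
    ⟨![⟨a, by simp⟩, ⟨b, by simp⟩, ⟨c, by simp⟩], by
      intro i j hij
      fin_cases i <;> fin_cases j <;> simp_all [Ne.symm]⟩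
  have h3 : AffineIndependent ℝ ![a, b, c] := by
    convert h.comp_embedding f using 1
    ext i : 1
    fin_cases i <;> rfl
  rw [affineIndependent_iff_not_collinear_set] at h3
  apply h3
  rw [collinear_iff_of_mem (p₀ := a) (by simp)]
  have hv : ∃ r : ℝ, c - a = r • (b - a) := by
    simp only [det2] at hd
    by_cases h0 : (b - a) 0 = 0
    · have h1 : (b - a) 1 ≠ 0 := by
        intro h1
        exact hab (sub_eq_zero.mp (plane_ext (x := b - a) (y := 0) h0 h1)).symm
      refine ⟨(c - a) 1 / (b - a) 1, plane_ext ?_ ?_⟩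
      · rw [h0, zero_mul, zero_sub, neg_eq_zero, mul_eq_zero] at hd
        rw [PiLp.smul_apply, h0, smul_zero]
        exact hd.resolve_left h1
      · rw [PiLp.smul_apply, smul_eq_mul, div_mul_cancel₀ _ h1]
    · refine ⟨(c - a) 0 / (b - a) 0, plane_ext ?_ ?_⟩
      · rw [PiLp.smul_apply, smul_eq_mul, div_mul_cancel₀ _ h0]
      · rw [PiLp.smul_apply, smul_eq_mul, div_mul_eq_mul_div, eq_div_iff h0]
        linarith
  obtain ⟨r, hr⟩ := hv
  refine ⟨b - a, ?_⟩
  intro p hp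
  simp only [Set.mem_insert_iff, Set.mem_singleton_iff] at hp
  rcases hp with rfl | rfl | rfl
  · exact ⟨0, by simp⟩
  · exact ⟨1, by simp⟩
  · exact ⟨r, by rw [← hr]; simp⟩

/-- The order of `a` and `b` is prescribed, so that both triangles at an edge parametrise it in the
same direction. -/
theorem IsTriangle.exists_third {T : Finset Plane} (hT : IsTriangle T) {a b : Plane} (hab : a ≠ b)
    (ha : a ∈ T) (hb : b ∈ T) :
    ∃ c, c ≠ a ∧ c ≠ b ∧ T = {a, b, c} ∧ det2 (b - a) (c - a) ≠ 0 := by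
  obtain ⟨x, y, z, hxy, hxz, hyz, rfl⟩ := Finset.card_eq_three.mp hT.1
  have key : ∃ c, c ≠ a ∧ c ≠ b ∧ ({x, y, z} : Finset Plane) = {a, b, c} := by
    simp only [Finset.mem_insert, Finset.mem_singleton] at ha hb
    rcases ha with rfl | rfl | rfl <;> rcases hb with rfl | rfl | rfl
    · exact absurd rfl hab
    · exact ⟨z, hxz.symm, hyz.symm, rfl⟩
    · exact ⟨y, hxy.symm, hyz, by ext; simp; tauto⟩
    · exact ⟨z, hyz.symm, hxz.symm, by ext; simp; tauto⟩
    · exact absurd rfl hab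
    · exact ⟨x, hxy, hxz, by ext; simp; tauto⟩
    · exact ⟨y, hyz, hxy.symm, by ext; simp; tauto⟩
    · exact ⟨x, hxz, hxy, by ext; simp; tauto⟩
    · exact absurd rfl hab
  obtain ⟨c, hca, hcb, hc⟩ := key
  rw [hc] at hT
  exact ⟨c, hca, hcb, hc, det2_ne_zero_of_affineIndependent hab hca.symm hcb.symm hT.2⟩

theorem IsTriangle.exists_eq {T : Finset Plane} (hT : IsTriangle T) {v : Plane} (hv : v ∈ T) :
    ∃ a b, a ≠ b ∧ v ≠ a ∧ v ≠ b ∧ T = {a, b, v} ∧ det2 (b - a) (v - a) ≠ 0 := by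
  have h2 : (T.erase v).card = 2 := by rw [Finset.card_erase_of_mem hv, hT.1]
  obtain ⟨a, b, hab, he⟩ := Finset.card_eq_two.mp h2
  have ha : a ∈ T.erase v := by rw [he]; simp
  have hb : b ∈ T.erase v := by rw [he]; simp
  obtain ⟨c, hca, hcb, hT', hd⟩ := hT.exists_third hab (Finset.mem_of_mem_erase ha)
    (Finset.mem_of_mem_erase hb)
  have hva := (Finset.ne_of_mem_erase ha).symm
  have hvb := (Finset.ne_of_mem_erase hb).symm
  have : v = c := by
    rw [hT'] at hv
    simp only [Finset.mem_insert, Finset.mem_singleton] at hv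
    tauto
  subst this
  exact ⟨a, b, hab, hva, hvb, hT', hd⟩

theorem convexHull_subset_line {V : Set Plane} {p q : Plane} (hV : V ⊆ {p, q}) {x : Plane}
    (hx : x ∈ convexHull ℝ V) : det2 (q - p) (x - p) = 0 := by
  have hx' := convexHull_mono hV hx
  rw [convexHull_pair, segment_eq_image'] at hx'
  obtain ⟨s, -, rfl⟩ := hx'
  simp only [det2, PiLp.sub_apply, PiLp.add_apply, PiLp.smul_apply, smul_eq_mul]
  ring

variable {Ω : Set Plane}

theorem Triangulation.hull_subset (𝒯 : Triangulation Ω) {T : Finset Plane} (hT : T ∈ 𝒯.tri) :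
    hull T ⊆ closure Ω := by
  rw [← 𝒯.cover]
  exact Set.subset_biUnion_of_mem (u := fun T => hull T) hT

theorem Triangulation.cell_subset (𝒯 : Triangulation Ω) (hΩ : IsPolygonalDomain Ω)
    {T : Finset Plane} (hT : T ∈ 𝒯.tri) : cell T ⊆ Ω := by
  rw [← hΩ.2.2.1]
  exact interior_mono (𝒯.hull_subset hT)

/-- Some vertex of `T` is missing in `S`, so conformity puts any common point on the line through
the other two vertices of `T`, where an affine coordinate that is positive inside `T` vanishes. -/
theorem Triangulation.disjoint_cell (𝒯 : Triangulation Ω) {S T : Finset Plane} (hS : S ∈ 𝒯.tri)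
    (hT : T ∈ 𝒯.tri) (hST : S ≠ T) : Disjoint (cell S) (cell T) := by
  rw [Set.disjoint_left]
  intro x hxS hxT
  have hx : x ∈ convexHull ℝ ((S : Set Plane) ∩ T) := by
    rw [← 𝒯.conforming S hS T hT]
    exact ⟨cell_subset_hull S hxS, cell_subset_hull T hxT⟩
  have hnot : ¬ T ⊆ S := by
    intro h
    exact hST (Finset.eq_of_subset_of_card_le h
      (by rw [(𝒯.isTriangle S hS).1, (𝒯.isTriangle T hT).1])).symm
  obtain ⟨v, hvT, hvS⟩ := Finset.not_subset.mp hnot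
  obtain ⟨a, b, hab, hva, hvb, rfl, hd⟩ := (𝒯.isTriangle T hT).exists_eq hvT
  have hsub : ((S : Set Plane) ∩ (({a, b, v} : Finset Plane) : Set Plane)) ⊆ {a, b} := by
    rintro y ⟨hyS, hyT⟩
    simp only [Finset.coe_insert, Finset.coe_singleton, Set.mem_insert_iff,
      Set.mem_singleton_iff] at hyT
    rcases hyT with rfl | rfl | rfl
    · simp
    · simp
    · exact absurd hyS hvS
  have h0 := convexHull_subset_line hsub hx
  rw [cell_eq_preimage hd] at hxT
  have h1 := hxT.2.1
  simp [affCoord, h0] at h1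

/-- Neighbours lie on opposite sides of their common edge: otherwise a point slightly off its
midpoint would be in both triangles, while conformity confines their intersection to the edge. -/
theorem Triangulation.det2_mul_neg (𝒯 : Triangulation Ω) {a b c c' : Plane}
    (hT : {a, b, c} ∈ 𝒯.tri) (hT' : {a, b, c'} ∈ 𝒯.tri)
    (hne : ({a, b, c} : Finset Plane) ≠ {a, b, c'})
    (hd : det2 (b - a) (c - a) ≠ 0) (hd' : det2 (b - a) (c' - a) ≠ 0) :
    det2 (b - a) (c - a) * det2 (b - a) (c' - a) < 0 := by
  by_contra hcon
  have hpos : 0 < det2 (b - a) (c - a) / det2 (b - a) (c' - a) := by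
    rcases lt_or_gt_of_ne hd with h | h <;> rcases lt_or_gt_of_ne hd' with h' | h'
    · exact div_pos_of_neg_of_neg h h'
    · exact absurd (mul_neg_of_neg_of_pos h h') hcon
    · exact absurd (mul_neg_of_pos_of_neg h h') hcon
    · exact div_pos h h'
  set k := det2 (b - a) (c - a) / det2 (b - a) (c' - a) with hk
  set r := det2 (c - a) (c' - a) / det2 (b - a) (c' - a) with hr
  -- The point at height `δ` above the midpoint has coordinates `1/2 + δ r` and `δ k` in the second
  -- triangle; this `δ` keeps `δ |r|`, `δ k` and `δ` itself at most `1/4`.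
  set δ : ℝ := 1 / (4 * (|r| + k + 1)) with hδ
  have hM : 0 < 4 * (|r| + k + 1) := by positivity
  have hδ0 : 0 < δ := by positivity
  have hδM : δ * (4 * (|r| + k + 1)) = 1 := one_div_mul_cancel hM.ne'
  have hδr : δ * |r| ≤ 1 / 4 := by nlinarith [mul_pos hδ0 hpos]
  have hδk : δ * k ≤ 1 / 4 := by nlinarith [mul_nonneg hδ0.le (abs_nonneg r)]
  have hδ1 : δ ≤ 1 / 4 := by nlinarith [mul_pos hδ0 hpos, mul_nonneg hδ0.le (abs_nonneg r)]
  set y : Plane := affMap a b c !₂[1 / 2, δ] with hy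
  have hyT : y ∈ hull {a, b, c} := by
    rw [hull_eq_image]
    refine ⟨_, ⟨?_, ?_, ?_⟩, rfl⟩ <;> simp <;> linarith
  have e0 : affCoord a b c' y 0 = 1 / 2 + δ * r := by
    simp only [affCoord, PiLp.toLp_apply, Matrix.cons_val_zero]
    rw [div_eq_iff hd', hr]
    have : δ * (det2 (c - a) (c' - a) / det2 (b - a) (c' - a)) * det2 (b - a) (c' - a)
        = δ * det2 (c - a) (c' - a) := by field_simp
    rw [add_mul, this]
    simp [det2, hy, affMap_apply]
    ring
  have e1 : affCoord a b c' y 1 = δ * k := by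
    simp only [affCoord, PiLp.toLp_apply, Matrix.cons_val_one, Matrix.cons_val_fin_one]
    rw [div_eq_iff hd', hk]
    have : δ * (det2 (b - a) (c - a) / det2 (b - a) (c' - a)) * det2 (b - a) (c' - a)
        = δ * det2 (b - a) (c - a) := by field_simp
    rw [this]
    simp [det2, hy, affMap_apply]
    ring
  have hyT' : y ∈ hull {a, b, c'} := by
    rw [hull_eq_preimage hd']
    have h1 := abs_le.mp (show |δ * r| ≤ 1 / 4 by rwa [abs_mul, abs_of_pos hδ0])
    refine ⟨?_, ?_, ?_⟩
    · rw [e0]; linarith [h1.1]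
    · rw [e1]; positivity
    · rw [e0, e1]; linarith [h1.2]
  have hyc : y ∈ convexHull ℝ ((({a, b, c} : Finset Plane) : Set Plane)
      ∩ (({a, b, c'} : Finset Plane) : Set Plane)) := by
    rw [← 𝒯.conforming _ hT _ hT']
    exact ⟨hyT, hyT'⟩
  have hcc : c ≠ c' := by rintro rfl; exact hne rfl
  have hsub : ((({a, b, c} : Finset Plane) : Set Plane)
      ∩ (({a, b, c'} : Finset Plane) : Set Plane)) ⊆ {a, b} := by
    rintro z ⟨hz, hz'⟩
    simp only [Finset.coe_insert, Finset.coe_singleton, Set.mem_insert_iff,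
      Set.mem_singleton_iff] at hz hz' ⊢
    rcases hz with h | h | h
    · exact Or.inl h
    · exact Or.inr h
    · rcases hz' with h' | h' | h'
      · exact Or.inl h'
      · exact Or.inr h'
      · exact absurd (h.symm.trans h') hcc
  have h0 := convexHull_subset_line hsub hyc
  have h2 : det2 (b - a) (y - a) = δ * det2 (b - a) (c - a) := by
    simp [det2, hy, affMap_apply]
    ring
  rw [h2] at h0
  exact (mul_ne_zero hδ0.ne' hd) h0

/-- Suppose the point is in `Ω` and move it slightly away from `c`. It stays in the open set `Ω`, so
some triangle `S` covers it. This `S` is not the given triangle, whose points have nonnegative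
coordinate in the direction of `c`; nor can it be another one, which lacks `a` or `b` and so meets
the given triangle in at most an edge ending at `c`, away from the original point. -/
theorem Triangulation.notMem_of_boundary (𝒯 : Triangulation Ω) (hΩ : IsOpen Ω) {a b c : Plane}
    (hT : {a, b, c} ∈ 𝒯.tri) (hd : det2 (b - a) (c - a) ≠ 0)
    (huniq : ∀ S ∈ 𝒯.tri, a ∈ S → b ∈ S → S = {a, b, c}) {s : ℝ} (hs : s ∈ Set.Ioo (0 : ℝ) 1) :
    a + s • (b - a) ∉ Ω := by
  classical
  intro hx
  set x := a + s • (b - a) with hxdef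
  -- Avoiding this closed set forces every triangle that contains the moved point to contain `x` as
  -- well.
  let K : Set Plane := ⋃ S ∈ 𝒯.tri.filter (fun S => x ∉ hull S), hull S
  have hK : IsClosed K := by
    apply Set.Finite.isClosed_biUnion (Finset.finite_toSet _)
    intro S _
    exact (isCompact_hull S).isClosed
  have hxK : x ∉ K := by
    simp only [K, Set.mem_iUnion, not_exists, Finset.mem_filter]
    rintro S ⟨-, hS⟩
    exact hS
  have hopen : IsOpen (Ω ∩ Kᶜ) := hΩ.inter hK.isOpen_compl
  have hcont : Continuous fun δ : ℝ => x - δ • (c - a) := by fun_prop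
  have h0 : (fun δ : ℝ => x - δ • (c - a)) ⁻¹' (Ω ∩ Kᶜ) ∈ 𝓝 (0 : ℝ) :=
    (hopen.preimage hcont).mem_nhds (by simpa using ⟨hx, hxK⟩)
  obtain ⟨ε, hε, hball⟩ := Metric.mem_nhds_iff.mp h0
  have hy := hball (show ε / 2 ∈ Metric.ball (0 : ℝ) ε by
    rw [Metric.mem_ball, Real.dist_0_eq_abs, abs_of_pos (by positivity)]; linarith)
  obtain ⟨hyΩ, hyK⟩ := hy
  have hcl := subset_closure hyΩ
  rw [← 𝒯.cover] at hcl
  simp only [Set.mem_iUnion] at hcl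
  obtain ⟨S, hS, hyS⟩ := hcl
  have hxS : x ∈ hull S := by
    by_contra hxS
    apply hyK
    simp only [K, Set.mem_iUnion, Finset.mem_filter]
    exact ⟨S, ⟨hS, hxS⟩, hyS⟩
  have hs0 := hs.1
  have hs1 := hs.2
  by_cases hST : S = {a, b, c}
  · rw [hST, hull_eq_preimage hd] at hyS
    have h1 := hyS.2.1
    simp only [affCoord, PiLp.toLp_apply, Matrix.cons_val_one, Matrix.cons_val_fin_one] at h1
    have h2 : det2 (b - a) (x - (ε / 2) • (c - a) - a) = -(ε / 2) * det2 (b - a) (c - a) := by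
      simp [det2, hxdef]
      ring
    rw [h2, mul_div_cancel_right₀ _ hd] at h1
    linarith
  · have hxT : x ∈ hull {a, b, c} := by
      rw [hull_eq_image]
      refine ⟨!₂[s, 0], ⟨?_, ?_, ?_⟩, ?_⟩
      · simpa using hs0.le
      · simp
      · simpa using hs1.le
      · apply plane_ext <;> simp [affMap_apply, hxdef]
    have hxc : x ∈ convexHull ℝ ((S : Set Plane) ∩ (({a, b, c} : Finset Plane) : Set Plane)) := by
      rw [← 𝒯.conforming _ hS _ hT]
      exact ⟨hxS, hxT⟩
    by_cases ha : a ∈ S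
    · have hb : b ∉ S := fun hb => hST (huniq S hS ha hb)
      have hsub : ((S : Set Plane) ∩ (({a, b, c} : Finset Plane) : Set Plane)) ⊆ {a, c} := by
        rintro z ⟨hzS, hzT⟩
        simp only [Finset.coe_insert, Finset.coe_singleton, Set.mem_insert_iff,
          Set.mem_singleton_iff] at hzT
        rcases hzT with h | h | h
        · exact Or.inl h
        · exact absurd (h ▸ hzS) hb
        · exact Or.inr h
      have h0 := convexHull_subset_line hsub hxc
      have h2 : det2 (c - a) (x - a) = -s * det2 (b - a) (c - a) := by
        simp [det2, hxdef]
        ring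
      rw [h2] at h0
      exact (mul_ne_zero (by linarith) hd) h0
    · have hsub : ((S : Set Plane) ∩ (({a, b, c} : Finset Plane) : Set Plane)) ⊆ {b, c} := by
        rintro z ⟨hzS, hzT⟩
        simp only [Finset.coe_insert, Finset.coe_singleton, Set.mem_insert_iff,
          Set.mem_singleton_iff] at hzT
        rcases hzT with h | h | h
        · exact absurd (h ▸ hzS) ha
        · exact Or.inl h
        · exact Or.inr h
      have h0 := convexHull_subset_line hsub hxc
      have h2 : det2 (c - b) (x - b) = (1 - s) * det2 (b - a) (c - a) := by
        simp [det2, hxdef]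
        ring
      rw [h2] at h0
      exact (mul_ne_zero (by linarith) hd) h0

/-- Three nonzero real numbers cannot have pairwise opposite signs. -/
theorem Triangulation.card_filter_le_two (𝒯 : Triangulation Ω) {a b : Plane} (hab : a ≠ b)
    [DecidablePred fun T : Finset Plane => a ∈ T ∧ b ∈ T] :
    (𝒯.tri.filter fun T => a ∈ T ∧ b ∈ T).card ≤ 2 := by
  by_contra hcon
  obtain ⟨S, hS, T, hT, R, hR, hST, hSR, hTR⟩ := Finset.two_lt_card.mp (not_le.mp hcon)
  simp only [Finset.mem_filter] at hS hT hR
  obtain ⟨c, -, -, rfl, h1⟩ := (𝒯.isTriangle S hS.1).exists_third hab hS.2.1 hS.2.2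
  obtain ⟨c', -, -, rfl, h2⟩ := (𝒯.isTriangle T hT.1).exists_third hab hT.2.1 hT.2.2
  obtain ⟨c'', -, -, rfl, h3⟩ := (𝒯.isTriangle R hR.1).exists_third hab hR.2.1 hR.2.2
  have k1 := 𝒯.det2_mul_neg hS.1 hT.1 hST h1 h2
  have k2 := 𝒯.det2_mul_neg hS.1 hR.1 hSR h1 h3
  have k3 := 𝒯.det2_mul_neg hT.1 hR.1 hTR h2 h3
  nlinarith [mul_pos_of_neg_of_neg k1 k2, sq_nonneg (det2 (b - a) (c - a))]

/-! ### Sizes and shape regularity -/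

theorem dist_le_size {T : Finset Plane} {x y : Plane} (hx : x ∈ T) (hy : y ∈ T) :
    ‖x - y‖ ≤ size T := by
  rw [← dist_eq_norm]
  exact Metric.dist_le_diam_of_mem (isCompact_hull T).isBounded
    (subset_convexHull ℝ _ hx) (subset_convexHull ℝ _ hy)

theorem size_pair (a b : Plane) : size {a, b} = ‖b - a‖ := by
  rw [size, hull, convexHull_diam, Finset.coe_pair, Metric.diam_pair, dist_eq_norm, norm_sub_rev]

theorem Triangulation.ShapeRegular.isShape {𝒯 : Triangulation Ω} {c₁ : ℝ} (hc₁ : 0 < c₁)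
    (h : 𝒯.ShapeRegular c₁) {a b c : Plane} (hT : {a, b, c} ∈ 𝒯.tri) (hab : a ≠ b)
    (hd : det2 (b - a) (c - a) ≠ 0) : IsShape c₁ a b c (size {a, b, c}) where
  pos := (norm_pos_iff.mpr (sub_ne_zero.mpr hab.symm)).trans_le
    (dist_le_size (by simp) (by simp))
  left := dist_le_size (by simp) (by simp)
  right := dist_le_size (by simp) (by simp)
  area := by
    have h1 := (h _ hT).1.trans (volume_hull_le hd)
    rwa [inv_mul_le_iff₀ hc₁] at h1
  det_ne := hd

theorem Triangulation.size_le (𝒯 : Triangulation Ω) (hΩ : IsPolygonalDomain Ω) {T : Finset Plane}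
    (hT : T ∈ 𝒯.tri) : size T ≤ Metric.diam (closure Ω) := by
  apply Metric.diam_mono (𝒯.hull_subset hT)
  obtain ⟨𝒮, -, h⟩ := hΩ.2.2.2
  rw [← h]
  exact (𝒮.finite_toSet.isCompact_biUnion fun S _ => isCompact_hull S).isBounded

/-! ### Green's formula with traces -/

/-- Cauchy–Schwarz: strong `L²` convergence implies weak convergence. -/
theorem tendsto_integral_mul {X : Type*} [MeasurableSpace X] {μ : Measure X} {F : ℕ → X → ℝ}
    {f ψ : X → ℝ} (hF : ∀ k, MemLp (F k) 2 μ) (hf : MemLp f 2 μ) (hψ : MemLp ψ 2 μ)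
    (h : Tendsto (fun k => ∫ x, (F k x - f x) ^ 2 ∂μ) atTop (𝓝 0)) :
    Tendsto (fun k => ∫ x, F k x * ψ x ∂μ) atTop (𝓝 (∫ x, f x * ψ x ∂μ)) := by
  rw [← tendsto_sub_nhds_zero_iff]
  have h1 : ∀ k, |(∫ x, F k x * ψ x ∂μ) - ∫ x, f x * ψ x ∂μ|
      ≤ Real.sqrt ((∫ x, (F k x - f x) ^ 2 ∂μ) * ∫ x, ψ x ^ 2 ∂μ) := by
    intro k
    apply Real.abs_le_sqrt
    rw [← integral_sub (integrable_mul_of_memLp (hF k) hψ) (integrable_mul_of_memLp hf hψ)]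
    have := sq_integral_mul_le ((hF k).sub hf) hψ
    simpa only [Pi.sub_apply, sub_mul] using this
  have h2 : Tendsto (fun k => Real.sqrt ((∫ x, (F k x - f x) ^ 2 ∂μ) * ∫ x, ψ x ^ 2 ∂μ)) atTop
      (𝓝 0) := by
    have := (h.mul_const (∫ x, ψ x ^ 2 ∂μ)).sqrt
    simpa using this
  exact squeeze_zero_norm h1 h2

/-- The edge bubble function of the edge `[a, b]` of the triangle `a, b, c`, times a polynomial. -/
def edgeTest (a b c : Plane) (P : Polynomial ℝ) (x : Plane) : ℝ :=
  refEdgeBubble P (affCoord a b c x)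

/-- A rotation of the vector `b - a`. -/
def edgeNormal (a b : Plane) (i : Fin 2) : ℝ := ![(b - a) 1, -(b - a) 0] i

theorem contDiff_edgeTest (a b c : Plane) (P : Polynomial ℝ) : ContDiff ℝ ∞ (edgeTest a b c P) :=
  (contDiff_refEdgeBubble P).comp (contDiff_affCoord a b c)

theorem edgeTest_line {a b c : Plane} (hd : det2 (b - a) (c - a) ≠ 0) (P : Polynomial ℝ) (s : ℝ) :
    edgeTest a b c P (a + s • (b - a)) = (s * (1 - s)) ^ 2 * P.eval s := by
  have : a + s • (b - a) = affMap a b c !₂[s, 0] := by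
    apply plane_ext <;> simp [affMap_apply]
  rw [edgeTest, this, affCoord_affMap hd, refEdgeBubble]
  simp

theorem green_edgeTest {a b c : Plane} (hd : det2 (b - a) (c - a) ≠ 0) (P : Polynomial ℝ)
    {f : Plane → ℝ} (hf : ContDiff ℝ ∞ f) (i : Fin 2) :
    ∫ x in cell {a, b, c}, (pderiv i f x * edgeTest a b c P x
        + f x * pderiv i (edgeTest a b c P) x)
      = |det2 (b - a) (c - a)| / det2 (b - a) (c - a) * (edgeNormal a b i *
        ∫ s in Set.Ioc (0 : ℝ) 1, f (a + s • (b - a)) * ((s * (1 - s)) ^ 2 * P.eval s)) := by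
  have hψ := contDiff_edgeTest a b c P
  have h := green_cell hd (hf.mul hψ)
    (fun x _ hx => by rw [edgeTest, affCoord_affMap hd, refEdgeBubble, hx]; simp)
    (fun x _ hx => by
      rw [edgeTest, affCoord_affMap hd, refEdgeBubble]
      have : 1 - x 0 - x 1 = 0 := by linarith
      rw [this]; simp)
  rw [intervalIntegral.integral_of_le zero_le_one] at h
  simp only [pderiv_mul hf hψ, edgeTest_line hd] at h
  fin_cases i
  · simpa [edgeNormal, mul_assoc] using h.1
  · refine h.2.trans ?_
    simp only [edgeNormal, Fin.mk_one, Matrix.cons_val_one, Matrix.cons_val_fin_one]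
    ring

/-- The smooth functions that define the trace satisfy the classical formula, and both sides are
continuous under their convergence in `H¹` and on the edge. -/
theorem IsTrace.green {a b c : Plane} (hab : a ≠ b) (hd : det2 (b - a) (c - a) ≠ 0)
    (P : Polynomial ℝ) {v g : Plane → ℝ} (hv : MemH1 (cell {a, b, c}) v)
    (hg : IsTrace (cell {a, b, c}) (hull {a, b}) v g) (i : Fin 2) :
    ∫ x in cell {a, b, c}, (weakGrad (cell {a, b, c}) v x i * edgeTest a b c P x
        + v x * pderiv i (edgeTest a b c P) x)
      = |det2 (b - a) (c - a)| / det2 (b - a) (c - a) * (edgeNormal a b i *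
        ∫ s in Set.Ioc (0 : ℝ) 1, g (a + s • (b - a)) * ((s * (1 - s)) ^ 2 * P.eval s)) := by
  obtain ⟨hgL, φ, hφ, ⟨ht0, ht1⟩, htr⟩ := hg
  have hψ := contDiff_edgeTest a b c P
  have hL : 0 < ‖b - a‖ := norm_pos_iff.mpr (sub_ne_zero.mpr hab.symm)
  have mψ := memLp_cell hψ.continuous {a, b, c}
  have mdψ := memLp_cell (contDiff_pderiv hψ i).continuous {a, b, c}
  have mG := hv.weakGrad_spec.1.apply i
  have mφ := fun k => memLp_cell (hφ k).continuous {a, b, c}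
  have mdφ := fun k => memLp_cell (contDiff_pderiv (hφ k) i).continuous {a, b, c}
  have t1 := (tendsto_integral_mul mdφ mG mψ (ht1 i)).add
    (tendsto_integral_mul mφ hv.1 mdψ ht0)
  rw [← integral_add (integrable_mul_of_memLp mG mψ) (integrable_mul_of_memLp hv.1 mdψ)] at t1
  have t2 : Tendsto (fun k => ∫ s in Set.Ioc (0 : ℝ) 1,
      (φ k (a + s • (b - a)) - g (a + s • (b - a))) ^ 2) atTop (𝓝 0) := by
    have := htr.const_mul ‖b - a‖⁻¹
    simp only [integral_arc hab, intervalIntegral.integral_of_le zero_le_one] at this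
    simpa [inv_mul_cancel_left₀ hL.ne'] using this
  have t3 := tendsto_integral_mul (ψ := fun s : ℝ => (s * (1 - s)) ^ 2 * P.eval s)
    (fun k => memLp_Ioc (F := fun s => φ k (a + s • (b - a)))
      ((hφ k).continuous.comp (by fun_prop))) (memLp_arc hab hgL)
    (memLp_Ioc (by have := P.continuous; fun_prop)) t2
  refine tendsto_nhds_unique t1 (((t3.const_mul (edgeNormal a b i)).const_mul _).congr fun k => ?_)
  rw [← green_edgeTest hd P (hφ k) i]
  exact integral_add (integrable_mul_of_memLp (mdφ k) mψ) (integrable_mul_of_memLp (mφ k) mdψ)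

/-- The difference of Green's formulas for the two components: the normal factors combine to the
product with `b - a`, which is the tangential component times the edge length. -/
theorem integral_weakCurl_edgeTest {a b c : Plane} (hab : a ≠ b) (hd : det2 (b - a) (c - a) ≠ 0)
    (P : Polynomial ℝ) {σ γ : Plane → Plane} (hσ : ∀ i, MemH1 (cell {a, b, c}) fun x => σ x i)
    (hγ : ∀ i, IsTrace (cell {a, b, c}) (hull {a, b}) (fun x => σ x i) fun x => γ x i) :
    (∫ x in cell {a, b, c}, weakCurl (cell {a, b, c}) σ x * edgeTest a b c P x)
      + ∫ x in cell {a, b, c}, (σ x 1 * pderiv 0 (edgeTest a b c P) x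
        - σ x 0 * pderiv 1 (edgeTest a b c P) x)
      = |det2 (b - a) (c - a)| / det2 (b - a) (c - a) * ∫ s in Set.Ioc (0 : ℝ) 1,
        (γ (a + s • (b - a)) 0 * (b - a) 0 + γ (a + s • (b - a)) 1 * (b - a) 1)
          * ((s * (1 - s)) ^ 2 * P.eval s) := by
  have hψ := contDiff_edgeTest a b c P
  have mψ := memLp_cell hψ.continuous {a, b, c}
  have mdψ := fun i => memLp_cell (contDiff_pderiv hψ i).continuous {a, b, c}
  have mG := fun i j => (hσ i).weakGrad_spec.1.apply j
  have h1 := IsTrace.green hab hd P (hσ 1) (hγ 1) 0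
  have h0 := IsTrace.green hab hd P (hσ 0) (hγ 0) 1
  have mw : MemLp (fun s : ℝ => (s * (1 - s)) ^ 2 * P.eval s) 2
      (volume.restrict (Set.Ioc (0 : ℝ) 1)) := memLp_Ioc (by have := P.continuous; fun_prop)
  have mγ := fun i => integrable_mul_of_memLp (memLp_arc hab (hγ i).1) mw
  rw [integral_add (integrable_mul_of_memLp (mG 1 0) mψ)
    (integrable_mul_of_memLp (hσ 1).1 (mdψ 0))] at h1
  rw [integral_add (integrable_mul_of_memLp (mG 0 1) mψ)
    (integrable_mul_of_memLp (hσ 0).1 (mdψ 1))] at h0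
  have e1 : ∫ x in cell {a, b, c}, weakCurl (cell {a, b, c}) σ x * edgeTest a b c P x
      = (∫ x in cell {a, b, c}, weakGrad (cell {a, b, c}) (fun x => σ x 1) x 0
          * edgeTest a b c P x)
        - ∫ x in cell {a, b, c}, weakGrad (cell {a, b, c}) (fun x => σ x 0) x 1
          * edgeTest a b c P x := by
    rw [← integral_sub (integrable_mul_of_memLp (mG 1 0) mψ)
      (integrable_mul_of_memLp (mG 0 1) mψ)]
    apply integral_congr_ae
    filter_upwards [weakCurl_ae_eq (isOpen_cell _) hσ] with x hx
    rw [hx, sub_mul]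
  have e2 : ∫ s in Set.Ioc (0 : ℝ) 1,
        (γ (a + s • (b - a)) 0 * (b - a) 0 + γ (a + s • (b - a)) 1 * (b - a) 1)
          * ((s * (1 - s)) ^ 2 * P.eval s)
      = (b - a) 0 * (∫ s in Set.Ioc (0 : ℝ) 1, γ (a + s • (b - a)) 0
          * ((s * (1 - s)) ^ 2 * P.eval s))
        + (b - a) 1 * ∫ s in Set.Ioc (0 : ℝ) 1, γ (a + s • (b - a)) 1
          * ((s * (1 - s)) ^ 2 * P.eval s) := by
    rw [← integral_const_mul, ← integral_const_mul,
      ← integral_add ((mγ 0).const_mul _) ((mγ 1).const_mul _)]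
    congr 1; ext s; ring
  rw [e1, e2, integral_sub (integrable_mul_of_memLp (hσ 1).1 (mdψ 0))
    (integrable_mul_of_memLp (hσ 0).1 (mdψ 1))]
  simp only [edgeNormal, Matrix.cons_val_zero, Matrix.cons_val_one, Matrix.cons_val_fin_one]
    at h0 h1
  linear_combination h1 - h0

/-- The area term drops out because a smooth gradient is curl-free; the tangential derivative along
the edge remains. -/
theorem integral_grad_edgeTest {a b c : Plane} (hd : det2 (b - a) (c - a) ≠ 0)
    (P : Polynomial ℝ) {φ : Plane → ℝ} (hφ : ContDiff ℝ ∞ φ) :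
    ∫ x in cell {a, b, c}, (pderiv 1 φ x * pderiv 0 (edgeTest a b c P) x
        - pderiv 0 φ x * pderiv 1 (edgeTest a b c P) x)
      = |det2 (b - a) (c - a)| / det2 (b - a) (c - a) * ∫ s in Set.Ioc (0 : ℝ) 1,
        ((b - a) 0 * pderiv 0 φ (a + s • (b - a)) + (b - a) 1 * pderiv 1 φ (a + s • (b - a)))
          * ((s * (1 - s)) ^ 2 * P.eval s) := by
  have hψ := contDiff_edgeTest a b c P
  have hφd := fun i => contDiff_pderiv hφ i
  have mψ := memLp_cell hψ.continuous {a, b, c}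
  have mdψ := fun i => memLp_cell (contDiff_pderiv hψ i).continuous {a, b, c}
  have mφ := fun i => memLp_cell (hφd i).continuous {a, b, c}
  have mdφ := fun i j => memLp_cell (contDiff_pderiv (hφd i) j).continuous {a, b, c}
  have h1 := green_edgeTest hd P (hφd 1) 0
  have h0 := green_edgeTest hd P (hφd 0) 1
  rw [integral_add (integrable_mul_of_memLp (mdφ 1 0) mψ)
    (integrable_mul_of_memLp (mφ 1) (mdψ 0))] at h1
  rw [integral_add (integrable_mul_of_memLp (mdφ 0 1) mψ)
    (integrable_mul_of_memLp (mφ 0) (mdψ 1))] at h0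
  simp only [pderiv_comm hφ 1 0] at h0
  have mw : MemLp (fun s : ℝ => (s * (1 - s)) ^ 2 * P.eval s) 2
      (volume.restrict (Set.Ioc (0 : ℝ) 1)) := memLp_Ioc (by have := P.continuous; fun_prop)
  have mγ := fun i => integrable_mul_of_memLp
    (memLp_Ioc (F := fun s => pderiv i φ (a + s • (b - a)))
      ((hφd i).continuous.comp (by fun_prop))) mw
  have e2 : ∫ s in Set.Ioc (0 : ℝ) 1,
        ((b - a) 0 * pderiv 0 φ (a + s • (b - a)) + (b - a) 1 * pderiv 1 φ (a + s • (b - a)))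
          * ((s * (1 - s)) ^ 2 * P.eval s)
      = (b - a) 0 * (∫ s in Set.Ioc (0 : ℝ) 1, pderiv 0 φ (a + s • (b - a))
          * ((s * (1 - s)) ^ 2 * P.eval s))
        + (b - a) 1 * ∫ s in Set.Ioc (0 : ℝ) 1, pderiv 1 φ (a + s • (b - a))
          * ((s * (1 - s)) ^ 2 * P.eval s) := by
    rw [← integral_const_mul, ← integral_const_mul,
      ← integral_add ((mγ 0).const_mul _) ((mγ 1).const_mul _)]
    congr 1; ext s; ring
  rw [e2, integral_sub (integrable_mul_of_memLp (mφ 1) (mdψ 0))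
    (integrable_mul_of_memLp (mφ 0) (mdψ 1))]
  simp only [edgeNormal, Matrix.cons_val_zero, Matrix.cons_val_one, Matrix.cons_val_fin_one]
    at h0 h1
  linear_combination h1 - h0

/-- The pairing of a vector field with the rotated gradient of an edge bubble function. -/
def edgePairing (a b c : Plane) (P : Polynomial ℝ) (G : Plane → Plane) : ℝ :=
  ∫ x in cell {a, b, c}, (G x 1 * pderiv 0 (edgeTest a b c P) x
    - G x 0 * pderiv 1 (edgeTest a b c P) x)

theorem tendsto_edgePairing {Ω : Set Plane} {u : Plane → ℝ} {φ : ℕ → Plane → ℝ}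
    (hu : MemH1 Ω u) (hφ : ∀ k, IsTest Ω (φ k)) (hφu : TendstoH1 Ω φ u) (a b c : Plane)
    (hT : cell {a, b, c} ⊆ Ω) (P : Polynomial ℝ) :
    Tendsto (fun k => ∫ x in cell {a, b, c}, (pderiv 1 (φ k) x * pderiv 0 (edgeTest a b c P) x
        - pderiv 0 (φ k) x * pderiv 1 (edgeTest a b c P) x)) atTop
      (𝓝 (edgePairing a b c P (weakGrad Ω u))) := by
  have hψ := contDiff_edgeTest a b c P
  have mdψ := fun i => memLp_cell (contDiff_pderiv hψ i).continuous {a, b, c}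
  have mG := fun i => (hu.weakGrad_spec.1.apply i).mono_set hT
  have mφ := fun k i => ((hφ k).pderiv i).memLp (V := cell {a, b, c})
  have t : ∀ i, Tendsto (fun k => ∫ x in cell {a, b, c},
      (pderiv i (φ k) x - weakGrad Ω u x i) ^ 2) atTop (𝓝 0) := by
    intro i
    refine squeeze_zero (fun k => integral_sq_nonneg fun x => pderiv i (φ k) x - weakGrad Ω u x i)
      (fun k => ?_) (hφu.2 i)
    apply setIntegral_mono_set
    · exact ((((hφ k).pderiv i).memLp (V := Ω)).sub (hu.weakGrad_spec.1.apply i)).integrable_sq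
    · exact Eventually.of_forall fun x => sq_nonneg _
    · exact hT.eventuallyLE
  have h := (tendsto_integral_mul (fun k => mφ k 1) (mG 1) (mdψ 0) (t 1)).sub
    (tendsto_integral_mul (fun k => mφ k 0) (mG 0) (mdψ 1) (t 0))
  rw [← integral_sub (integrable_mul_of_memLp (mG 1) (mdψ 0))
    (integrable_mul_of_memLp (mG 0) (mdψ 1))] at h
  refine h.congr fun k => ?_
  exact (integral_sub (integrable_mul_of_memLp (mφ k 1) (mdψ 0))
    (integrable_mul_of_memLp (mφ k 0) (mdψ 1))).symm

theorem abs_div_self_add_of_mul_neg {x y : ℝ} (h : x * y < 0) : |x| / x + |y| / y = 0 := by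
  rcases mul_neg_iff.mp h with ⟨hx, hy⟩ | ⟨hx, hy⟩
  · rw [abs_of_pos hx, abs_of_neg hy, neg_div, div_self hx.ne', div_self hy.ne]; ring
  · rw [abs_of_pos hy, abs_of_neg hx, neg_div, div_self hx.ne, div_self hy.ne']; ring

/-- For a smooth function both pairings are the same edge integral with opposite orientation signs;
pass to the limit. No trace of `∇u` is involved. -/
theorem edgePairing_interior {Ω : Set Plane} {u : Plane → ℝ} (hu : MemH10 Ω u) {a b c c' : Plane}
    (hT : cell {a, b, c} ⊆ Ω) (hT' : cell {a, b, c'} ⊆ Ω)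
    (h : det2 (b - a) (c - a) * det2 (b - a) (c' - a) < 0) (P : Polynomial ℝ) :
    edgePairing a b c P (weakGrad Ω u) + edgePairing a b c' P (weakGrad Ω u) = 0 := by
  obtain ⟨hu1, φ, hφ, hφu⟩ := hu
  have t := (tendsto_edgePairing hu1 hφ hφu a b c hT P).add
    (tendsto_edgePairing hu1 hφ hφu a b c' hT' P)
  refine tendsto_nhds_unique t (tendsto_const_nhds.congr fun k => ?_)
  rw [integral_grad_edgeTest (left_ne_zero_of_mul h.ne) P (hφ k).1,
    integral_grad_edgeTest (right_ne_zero_of_mul h.ne) P (hφ k).1, ← add_mul,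
    abs_div_self_add_of_mul_neg h, zero_mul]

/-- This is where `u = 0` on the boundary enters: the approximating test functions vanish along the
edge, and so do their tangential derivatives. -/
theorem edgePairing_boundary {Ω : Set Plane} {u : Plane → ℝ} (hu : MemH10 Ω u) {a b c : Plane}
    (hT : cell {a, b, c} ⊆ Ω) (hd : det2 (b - a) (c - a) ≠ 0)
    (h : ∀ s ∈ Set.Ioo (0 : ℝ) 1, a + s • (b - a) ∉ Ω) (P : Polynomial ℝ) :
    edgePairing a b c P (weakGrad Ω u) = 0 := by
  obtain ⟨hu1, φ, hφ, hφu⟩ := hu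
  refine tendsto_nhds_unique (tendsto_edgePairing hu1 hφ hφu a b c hT P)
    (tendsto_const_nhds.congr fun k => ?_)
  rw [integral_grad_edgeTest hd P (hφ k).1, integral_Ioc_eq_integral_Ioo,
    setIntegral_eq_zero_of_forall_eq_zero, mul_zero]
  intro s hs
  have h1 := hasDerivAt_comp_line (hφ k).1 a (b - a) s
  have h2 : HasDerivAt (fun s : ℝ => φ k (a + s • (b - a))) 0 s := by
    apply (hasDerivAt_const s (0 : ℝ)).congr_of_eventuallyEq
    filter_upwards [isOpen_Ioo.mem_nhds hs] with t ht
    exact (hφ k).eq_zero (h t ht)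
  rw [h1.unique h2, zero_mul]

/-! ### Bounds on an edge -/

/-- Green's formula turns the edge term into area terms, in which `σ` occurs only through `curl σ`
and `G - σ` once the pairing of `G` is subtracted. That pairing cancels over an interior edge and
vanishes on a boundary edge, so it is kept apart here. -/
theorem exists_edge_residual_bound (m : ℕ) (c₁ : ℝ) : ∃ C : ℝ, 0 < C ∧
    ∀ (a b c : Plane) (h : ℝ), a ≠ b → IsShape c₁ a b c h → ∀ P : Polynomial ℝ, P.natDegree ≤ m →
      ∀ σ γ G : Plane → Plane, (∀ i, MemH1 (cell {a, b, c}) fun x => σ x i) →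
        (∀ i, IsTrace (cell {a, b, c}) (hull {a, b}) (fun x => σ x i) fun x => γ x i) →
        MemL2 (cell {a, b, c}) G →
        (|det2 (b - a) (c - a)| / det2 (b - a) (c - a) * (∫ s in Set.Ioc (0 : ℝ) 1,
          (γ (a + s • (b - a)) 0 * (b - a) 0 + γ (a + s • (b - a)) 1 * (b - a) 1)
            * ((s * (1 - s)) ^ 2 * P.eval s)) - edgePairing a b c P G) ^ 2
        ≤ C * (h ^ 2 * (∫ x in cell {a, b, c}, weakCurl (cell {a, b, c}) σ x ^ 2)
          + (∫ x in cell {a, b, c}, (G x 0 - σ x 0) ^ 2)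
          + ∫ x in cell {a, b, c}, (G x 1 - σ x 1) ^ 2) *
            ∫ s in Set.Ioc (0 : ℝ) 1, P.eval s ^ 2 := by
  obtain ⟨K, hK, H⟩ := exists_edge_bubble m c₁
  refine ⟨3 * K, by positivity, ?_⟩
  intro a b c h hab hs P hP σ γ G hσ hγ hG
  have hd := hs.det_ne
  obtain ⟨b1, b2⟩ := (H P hP).2 a b c h hs
  have hψ := contDiff_edgeTest a b c P
  have mψ := memLp_cell hψ.continuous {a, b, c}
  have mdψ := fun i => memLp_cell (contDiff_pderiv hψ i).continuous {a, b, c}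
  have mc := (weakCurl_spec hσ).1.1
  have mε : ∀ i, MemLp (fun x => G x i - σ x i) 2 (volume.restrict (cell {a, b, c})) :=
    fun i => (hG.apply i).sub (hσ i).1
  rw [← integral_weakCurl_edgeTest hab hd P hσ hγ, edgePairing]
  have i1 : ∀ F : Plane → Plane, (∀ i, MemL2 (cell {a, b, c}) fun x => F x i) →
      Integrable (fun x => F x 1 * pderiv 0 (edgeTest a b c P) x
        - F x 0 * pderiv 1 (edgeTest a b c P) x) (volume.restrict (cell {a, b, c})) := fun F hF =>
    (integrable_mul_of_memLp (hF 1) (mdψ 0)).sub (integrable_mul_of_memLp (hF 0) (mdψ 1))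
  have e : (∫ x in cell {a, b, c}, weakCurl (cell {a, b, c}) σ x * edgeTest a b c P x)
      + (∫ x in cell {a, b, c}, (σ x 1 * pderiv 0 (edgeTest a b c P) x
        - σ x 0 * pderiv 1 (edgeTest a b c P) x))
      - (∫ x in cell {a, b, c}, (G x 1 * pderiv 0 (edgeTest a b c P) x
        - G x 0 * pderiv 1 (edgeTest a b c P) x))
      = (∫ x in cell {a, b, c}, weakCurl (cell {a, b, c}) σ x * edgeTest a b c P x)
      - (∫ x in cell {a, b, c}, (G x 1 - σ x 1) * pderiv 0 (edgeTest a b c P) x)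
      + ∫ x in cell {a, b, c}, (G x 0 - σ x 0) * pderiv 1 (edgeTest a b c P) x := by
    have e1 := integral_sub (i1 σ fun i => (hσ i).1) (i1 G fun i => hG.apply i)
    have e2 := integral_sub (integrable_mul_of_memLp (mε 0) (mdψ 1))
      (integrable_mul_of_memLp (mε 1) (mdψ 0))
    have e3 : ∫ x in cell {a, b, c}, ((σ x 1 * pderiv 0 (edgeTest a b c P) x
        - σ x 0 * pderiv 1 (edgeTest a b c P) x) - (G x 1 * pderiv 0 (edgeTest a b c P) x
        - G x 0 * pderiv 1 (edgeTest a b c P) x))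
        = ∫ x in cell {a, b, c}, ((G x 0 - σ x 0) * pderiv 1 (edgeTest a b c P) x
          - (G x 1 - σ x 1) * pderiv 0 (edgeTest a b c P) x) := by
      congr 1; ext x; ring
    linarith
  rw [e]
  have c0 := sq_integral_mul_le mc mψ
  have c1 := sq_integral_mul_le (mε 1) (mdψ 0)
  have c2 := sq_integral_mul_le (mε 0) (mdψ 1)
  have n0 : 0 ≤ ∫ x in cell {a, b, c}, weakCurl (cell {a, b, c}) σ x ^ 2 := integral_sq_nonneg _
  have n1 : ∀ i, 0 ≤ ∫ x in cell {a, b, c}, (G x i - σ x i) ^ 2 :=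
    fun i => integral_sq_nonneg fun x => G x i - σ x i
  have c0' := c0.trans (mul_le_mul_of_nonneg_left b1 n0)
  have c1' := c1.trans (mul_le_mul_of_nonneg_left (b2 0) (n1 1))
  have c2' := c2.trans (mul_le_mul_of_nonneg_left (b2 1) (n1 0))
  have key : ∀ x y z : ℝ, (x - y + z) ^ 2 ≤ 3 * (x ^ 2 + y ^ 2 + z ^ 2) := by
    intro x y z
    nlinarith [sq_nonneg (x + y), sq_nonneg (y + z), sq_nonneg (x - z)]
  refine (key _ _ _).trans ?_
  linarith

/-- The local residuals and errors that control the jumps over the edges of a triangle. -/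
def edgeControl (σ G : Plane → Plane) (T : Finset Plane) : ℝ :=
  size T ^ 2 * (∫ x in cell T, weakCurl (cell T) σ x ^ 2)
    + (∫ x in cell T, (G x 0 - σ x 0) ^ 2) + ∫ x in cell T, (G x 1 - σ x 1) ^ 2

theorem edgeControl_nonneg (σ G : Plane → Plane) (T : Finset Plane) : 0 ≤ edgeControl σ G T := by
  have n0 : 0 ≤ ∫ x in cell T, weakCurl (cell T) σ x ^ 2 := integral_sq_nonneg _
  have n1 : ∀ i, 0 ≤ ∫ x in cell T, (G x i - σ x i) ^ 2 :=
    fun i => integral_sq_nonneg fun x => G x i - σ x i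
  have := n1 0
  have := n1 1
  unfold edgeControl
  positivity

theorem tangent_eq {E : Finset Plane} (hE : E.card = 2) :
    ∃ a b : Plane, a ≠ b ∧ E = {a, b} ∧ tangent E = ‖b - a‖⁻¹ • (b - a) := by
  obtain ⟨x, y, hxy, rfl⟩ := Finset.card_eq_two.mp hE
  have h : ∃ z : Plane × Plane, z.1 ≠ z.2 ∧
      ((({x, y} : Finset Plane) : Set Plane)) = {z.1, z.2} := ⟨(x, y), hxy, by simp⟩
  refine ⟨h.choose.1, h.choose.2, h.choose_spec.1, ?_, ?_⟩
  · apply Finset.coe_injective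
    exact h.choose_spec.2.trans Finset.coe_pair.symm
  · rw [tangent, dif_pos h]

open Classical in
-- The bounds from the triangles at the edge are added with their orientation signs. Each triangle
-- carries its own extension of the edge bubble; the extensions agree on the edge, and nothing else
-- has to match.
theorem exists_jump_bound (m : ℕ) {c₁ : ℝ} (hc₁ : 0 < c₁) : ∃ C : ℝ, 0 < C ∧
    ∀ {Ω : Set Plane}, IsPolygonalDomain Ω → ∀ (𝒯 : Triangulation Ω), 𝒯.ShapeRegular c₁ →
      ∀ u, MemH10 Ω u → ∀ σ, 𝒯.PiecewiseH1 σ → ∀ γ, 𝒯.IsTraceFamily σ γ →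
      ∀ E ∈ 𝒯.edges, ∀ r, IsPoly m r →
        size E * ∫ x, 𝒯.tangentialJump γ E x ^ 2 ∂(arc (hull E))
          ≤ C * ((∑ T ∈ 𝒯.tri.filter (fun T => E ⊆ T), edgeControl σ (weakGrad Ω u) T)
            + size E * ∫ x, (𝒯.tangentialJump γ E x - r x) ^ 2 ∂(arc (hull E))) := by
  obtain ⟨K, hK, H⟩ := exists_edge_bubble m c₁
  obtain ⟨R, hR, HR⟩ := exists_edge_residual_bound m c₁
  refine ⟨K + K * (2 * R), by positivity, ?_⟩
  intro Ω hΩ 𝒯 hreg u hu σ hσ γ hγ E hE r hr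
  simp only [Triangulation.edges, Finset.mem_biUnion, edgesOf, Finset.mem_powersetCard] at hE
  obtain ⟨T₀, hT₀, hET₀, hE2⟩ := hE
  obtain ⟨a, b, hab, rfl, htan⟩ := tangent_eq hE2
  have hL : 0 < ‖b - a‖ := norm_pos_iff.mpr (sub_ne_zero.mpr hab.symm)
  obtain ⟨P, hP, hrP⟩ := hr.exists_polynomial_line a (b - a)
  set S := ∑ T ∈ 𝒯.tri.filter (fun T => {a, b} ⊆ T), edgeControl σ (weakGrad Ω u) T with hS
  set w : ℝ → ℝ := fun s => (s * (1 - s)) ^ 2 * P.eval s with hw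
  have mw : MemLp w 2 (volume.restrict (Set.Ioc (0 : ℝ) 1)) :=
    memLp_Ioc (by have := P.continuous; fun_prop)
  have hPn : 0 ≤ ∫ s in Set.Ioc (0 : ℝ) 1, P.eval s ^ 2 := integral_sq_nonneg _
  -- the tangential trace from one triangle
  let t : Finset Plane → ℝ → ℝ := fun T s =>
    γ T {a, b} (a + s • (b - a)) 0 * (b - a) 0 + γ T {a, b} (a + s • (b - a)) 1 * (b - a) 1
  have hedge : ∀ T ∈ 𝒯.tri, {a, b} ⊆ T → {a, b} ∈ edgesOf T := fun T _ h =>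
    Finset.mem_powersetCard.mpr ⟨h, hE2⟩
  have mt : ∀ T ∈ 𝒯.tri, {a, b} ⊆ T → MemLp (t T) 2 (volume.restrict (Set.Ioc (0 : ℝ) 1)) := by
    intro T hT hTE
    have h := fun i => memLp_arc hab (hγ T hT _ (hedge T hT hTE) i).1
    exact ((h 0).mul_const _).add ((h 1).mul_const _)
  have hin : ∀ (y z : Plane), inner ℝ y z = y 0 * z 0 + y 1 * z 1 := by
    intro y z
    simp [PiLp.inner_apply, Fin.sum_univ_two, mul_comm]
  have bound : ∀ c, {a, b, c} ∈ 𝒯.tri → det2 (b - a) (c - a) ≠ 0 →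
      (|det2 (b - a) (c - a)| / det2 (b - a) (c - a) * (∫ s in Set.Ioc (0 : ℝ) 1,
        t {a, b, c} s * w s) - edgePairing a b c P (weakGrad Ω u)) ^ 2
      ≤ R * edgeControl σ (weakGrad Ω u) {a, b, c} * ∫ s in Set.Ioc (0 : ℝ) 1, P.eval s ^ 2 := by
    intro c hT hd
    have hsub : ({a, b} : Finset Plane) ⊆ {a, b, c} := by
      intro x; simp only [Finset.mem_insert, Finset.mem_singleton]; tauto
    exact HR a b c _ hab (hreg.isShape hc₁ hT hab hd) P hP σ (γ {a, b, c} {a, b}) (weakGrad Ω u)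
      (hσ _ hT) (hγ _ hT _ (hedge _ hT hsub)) (hu.1.weakGrad_spec.1.mono_set (𝒯.cell_subset hΩ hT))
  have hsq : ∀ d : ℝ, d ≠ 0 → (|d| / d) ^ 2 = 1 := fun d hd => by
    rw [div_pow, sq_abs, div_self (pow_ne_zero 2 hd)]
  -- the jump tested with the bubble function
  have main : ∃ J : ℝ → ℝ, MemLp J 2 (volume.restrict (Set.Ioc (0 : ℝ) 1)) ∧
      (∀ s, 𝒯.tangentialJump γ {a, b} (a + s • (b - a)) = ‖b - a‖⁻¹ * J s) ∧
      (∫ s in Set.Ioc (0 : ℝ) 1, J s * w s) ^ 2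
        ≤ 2 * R * S * ∫ s in Set.Ioc (0 : ℝ) 1, P.eval s ^ 2 := by
    by_cases h2 : ∃ z : Finset Plane × Finset Plane,
        z.1 ∈ 𝒯.tri ∧ z.2 ∈ 𝒯.tri ∧ z.1 ≠ z.2 ∧ {a, b} ⊆ z.1 ∧ {a, b} ⊆ z.2
    · have hj : ∀ x, 𝒯.jump γ {a, b} x = γ h2.choose.1 {a, b} x - γ h2.choose.2 {a, b} x := by
        intro x; rw [Triangulation.jump, dif_pos h2]
      have hz := h2.choose_spec
      set T := h2.choose.1
      set T' := h2.choose.2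
      obtain ⟨hT, hT', hne, hET, hET'⟩ := hz
      refine ⟨fun s => t T s - t T' s, (mt T hT hET).sub (mt T' hT' hET'), ?_, ?_⟩
      · intro s
        rw [Triangulation.tangentialJump, hj, htan, hin]
        simp only [t, PiLp.sub_apply, PiLp.smul_apply, smul_eq_mul]
        ring
      · have hsum : edgeControl σ (weakGrad Ω u) T + edgeControl σ (weakGrad Ω u) T' ≤ S := by
          rw [← Finset.sum_pair hne]
          apply Finset.sum_le_sum_of_subset_of_nonneg
          · intro x hx
            simp only [Finset.mem_insert, Finset.mem_singleton] at hx
            rcases hx with rfl | rfl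
            · exact Finset.mem_filter.mpr ⟨hT, hET⟩
            · exact Finset.mem_filter.mpr ⟨hT', hET'⟩
          · intro x _ _
            exact edgeControl_nonneg _ _ _
        have eI := integral_sub (integrable_mul_of_memLp (mt T hT hET) mw)
          (integrable_mul_of_memLp (mt T' hT' hET') mw)
        obtain ⟨c, -, -, hTc, hd⟩ := (𝒯.isTriangle T hT).exists_third hab
          (hET (by simp)) (hET (by simp))
        obtain ⟨c', -, -, hTc', hd'⟩ := (𝒯.isTriangle T' hT').exists_third hab
          (hET' (by simp)) (hET' (by simp))
        rw [hTc] at hT hne hsum eI ⊢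
        rw [hTc'] at hT' hne hsum eI ⊢
        have hneg := 𝒯.det2_mul_neg hT hT' hne hd hd'
        have hpair := edgePairing_interior hu (𝒯.cell_subset hΩ hT) (𝒯.cell_subset hΩ hT') hneg P
        have hk := abs_div_self_add_of_mul_neg hneg
        have b1 := bound c hT hd
        have b2 := bound c' hT' hd'
        have hk2 := hsq _ hd
        simp only [sub_mul]
        rw [eI]
        set k := |det2 (b - a) (c - a)| / det2 (b - a) (c - a)
        set k' := |det2 (b - a) (c' - a)| / det2 (b - a) (c' - a)
        set X := ∫ s in Set.Ioc (0 : ℝ) 1, t {a, b, c} s * w s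
        set X' := ∫ s in Set.Ioc (0 : ℝ) 1, t {a, b, c'} s * w s
        set Q := edgePairing a b c P (weakGrad Ω u)
        set Q' := edgePairing a b c' P (weakGrad Ω u)
        -- Opposite orientations turn the sum of the two residuals into `k` times the difference of
        -- the traces, with `k² = 1`, while the pairings cancel.
        have hkk : k' = -k := by linarith
        have hQQ : Q' = -Q := by linarith
        rw [hkk, hQQ] at b2
        calc (X - X') ^ 2 = ((k * X - Q) + (-k * X' - -Q)) ^ 2 := by
              have : ((k * X - Q) + (-k * X' - -Q)) ^ 2 = k ^ 2 * (X - X') ^ 2 := by ring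
              rw [this, hk2, one_mul]
          _ ≤ 2 * ((k * X - Q) ^ 2 + (-k * X' - -Q) ^ 2) := by
              nlinarith [sq_nonneg ((k * X - Q) - (-k * X' - -Q))]
          _ ≤ 2 * (R * edgeControl σ (weakGrad Ω u) {a, b, c}
                * (∫ s in Set.Ioc (0 : ℝ) 1, P.eval s ^ 2)
              + R * edgeControl σ (weakGrad Ω u) {a, b, c'}
                * ∫ s in Set.Ioc (0 : ℝ) 1, P.eval s ^ 2) := by gcongr
          _ = 2 * R * (edgeControl σ (weakGrad Ω u) {a, b, c}
              + edgeControl σ (weakGrad Ω u) {a, b, c'})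
                * ∫ s in Set.Ioc (0 : ℝ) 1, P.eval s ^ 2 := by ring
          _ ≤ _ := by gcongr
    · have h1 : ∃ T, T ∈ 𝒯.tri ∧ {a, b} ⊆ T := ⟨T₀, hT₀, hET₀⟩
      have hj : ∀ x, 𝒯.jump γ {a, b} x = γ h1.choose {a, b} x := by
        intro x; rw [Triangulation.jump, dif_neg h2, dif_pos h1]
      have hz := h1.choose_spec
      set T := h1.choose
      obtain ⟨hT, hET⟩ := hz
      refine ⟨t T, mt T hT hET, ?_, ?_⟩
      · intro s
        rw [Triangulation.tangentialJump, hj, htan, hin]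
        simp only [t, PiLp.smul_apply, smul_eq_mul]
        ring
      · have hsum : edgeControl σ (weakGrad Ω u) T ≤ S :=
          Finset.single_le_sum (f := fun T => edgeControl σ (weakGrad Ω u) T)
            (fun x _ => edgeControl_nonneg _ _ _) (Finset.mem_filter.mpr ⟨hT, hET⟩)
        have huniq : ∀ S ∈ 𝒯.tri, a ∈ S → b ∈ S → S = T := by
          intro S hS ha hb
          by_contra hST
          refine h2 ⟨(S, T), hS, hT, hST, ?_, hET⟩
          intro x hx
          simp only [Finset.mem_insert, Finset.mem_singleton] at hx
          rcases hx with rfl | rfl <;> assumption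
        obtain ⟨c, -, -, hTc, hd⟩ := (𝒯.isTriangle T hT).exists_third hab
          (hET (by simp)) (hET (by simp))
        rw [hTc] at hT hsum huniq ⊢
        have hpair := edgePairing_boundary hu (𝒯.cell_subset hΩ hT) hd
          (fun s hs => 𝒯.notMem_of_boundary hΩ.1 hT hd huniq hs) P
        have b1 := bound c hT hd
        rw [hpair, sub_zero, mul_pow, hsq _ hd, one_mul] at b1
        refine b1.trans (mul_le_mul_of_nonneg_right ?_ hPn)
        -- One triangle would give the bound without the factor `2`; it is enlarged to fit the
        -- interior case.
        have hS0 : 0 ≤ S := (edgeControl_nonneg _ _ _).trans hsum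
        nlinarith [mul_le_mul_of_nonneg_left hsum hR.le, mul_nonneg hR.le hS0]
  obtain ⟨J, hJ, hJt, hJw⟩ := main
  have hS0 : 0 ≤ S := Finset.sum_nonneg fun T _ => edgeControl_nonneg _ _ _
  have mJ : MemLp (fun s => ‖b - a‖⁻¹ * J s) 2 (volume.restrict (Set.Ioc (0 : ℝ) 1)) :=
    hJ.const_mul _
  -- `J` is the jump against `b - a` instead of the unit tangent. The resulting `‖b - a‖⁻²` is
  -- compensated below by the weight of the edge and by the arc length element.
  have key := (H P hP).1 (fun s => ‖b - a‖⁻¹ * J s) mJ ((‖b - a‖⁻¹) ^ 2 * (2 * R * S))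
    (by positivity) (by
      simp only [mul_assoc]
      rw [integral_const_mul, mul_pow]
      gcongr
      simpa only [mul_assoc] using hJw)
  rw [size_pair, integral_arc hab, integral_arc hab, intervalIntegral.integral_of_le zero_le_one,
    intervalIntegral.integral_of_le zero_le_one]
  simp only [hJt, hrP]
  have hO : 0 ≤ ∫ s in Set.Ioc (0 : ℝ) 1, (‖b - a‖⁻¹ * J s - P.eval s) ^ 2 :=
    integral_sq_nonneg fun s => ‖b - a‖⁻¹ * J s - P.eval s
  calc ‖b - a‖ * (‖b - a‖ * ∫ s in Set.Ioc (0 : ℝ) 1, (‖b - a‖⁻¹ * J s) ^ 2)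
      ≤ ‖b - a‖ * (‖b - a‖ * (K * ((∫ s in Set.Ioc (0 : ℝ) 1, (‖b - a‖⁻¹ * J s - P.eval s) ^ 2)
          + (‖b - a‖⁻¹) ^ 2 * (2 * R * S)))) := by gcongr
    _ = K * (‖b - a‖ * (‖b - a‖ * ∫ s in Set.Ioc (0 : ℝ) 1, (‖b - a‖⁻¹ * J s - P.eval s) ^ 2))
          + K * (2 * R) * S := by field_simp
    _ ≤ (K + K * (2 * R)) * (‖b - a‖ * (‖b - a‖ *
          ∫ s in Set.Ioc (0 : ℝ) 1, (‖b - a‖⁻¹ * J s - P.eval s) ^ 2))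
          + (K + K * (2 * R)) * S := by
        have : 0 ≤ K * (2 * R) := by positivity
        gcongr <;> linarith
    _ = _ := by ring

/-! ### The coefficient and the energy norm -/

theorem norm_sq_plane (v : Plane) : ‖v‖ ^ 2 = v 0 ^ 2 + v 1 ^ 2 := by
  rw [EuclideanSpace.real_norm_sq_eq, Fin.sum_univ_two]

/-- Coercivity excludes a kernel, so the matrix inverse is a true inverse. -/
theorem inv_app_app {B : Matrix (Fin 2) (Fin 2) ℝ} {α : ℝ} (hα : 0 < α)
    (h : ∀ ξ : Plane, α * ‖ξ‖ ^ 2 ≤ inner ℝ ξ (app B ξ)) (v : Plane) :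
    app B⁻¹ (app B v) = v ∧ app B (app B⁻¹ v) = v := by
  have hdet : IsUnit B.det := by
    rw [isUnit_iff_ne_zero]
    intro h0
    obtain ⟨w, hw, hBw⟩ := Matrix.exists_mulVec_eq_zero_iff.mpr h0
    have h1 := h (WithLp.toLp 2 w)
    have h2 : app B (WithLp.toLp 2 w) = 0 := by simp [app, hBw]
    rw [h2, inner_zero_right] at h1
    have h3 : ‖(WithLp.toLp 2 w : Plane)‖ ^ 2 = 0 :=
      le_antisymm (nonpos_of_mul_nonpos_right h1 hα) (sq_nonneg _)
    have h4 : (WithLp.toLp 2 w : Plane) = 0 := norm_eq_zero.mp (pow_eq_zero_iff two_ne_zero |>.mp h3)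
    exact hw (by simpa using congrArg WithLp.ofLp h4)
  constructor
  · rw [app, app, Matrix.mulVec_mulVec, Matrix.nonsing_inv_mul _ hdet, Matrix.one_mulVec]
  · rw [app, app, Matrix.mulVec_mulVec, Matrix.mul_nonsing_inv _ hdet, Matrix.one_mulVec]

theorem norm_inv_app_le {B : Matrix (Fin 2) (Fin 2) ℝ} {α : ℝ} (hα : 0 < α)
    (h : ∀ ξ : Plane, α * ‖ξ‖ ^ 2 ≤ inner ℝ ξ (app B ξ)) (v : Plane) :
    ‖app B⁻¹ v‖ ≤ α⁻¹ * ‖v‖ := by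
  have h1 := h (app B⁻¹ v)
  rw [(inv_app_app hα h v).2] at h1
  have h2 := h1.trans (real_inner_le_norm _ _)
  rw [inv_mul_eq_div, le_div_iff₀ hα]
  rcases (norm_nonneg (app B⁻¹ v)).eq_or_lt with h0 | h0
  · rw [← h0, zero_mul]; exact norm_nonneg v
  · nlinarith

theorem app_sub (B : Matrix (Fin 2) (Fin 2) ℝ) (v w : Plane) :
    app B (v - w) = app B v - app B w := by
  simp only [app, WithLp.ofLp_sub, Matrix.mulVec_sub, WithLp.toLp_sub]

variable {α β : ℝ} {A : Plane → Matrix (Fin 2) (Fin 2) ℝ}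

/-- Measurability comes from the explicit formula for the inverse of a `2 × 2` matrix, integrability
from the pointwise bound by `α⁻¹`. -/
theorem IsCoefficient.memL2_invApp (hα : 0 < α) (hA : IsCoefficient Ω α β A) {q : Plane → Plane}
    (hq : MemL2 Ω q) : MemL2 Ω (invApp A q) := by
  have hm : ∀ i, AEMeasurable (fun x => q x i) (volume.restrict Ω) :=
    fun i => (hq.apply i).aestronglyMeasurable.aemeasurable
  have hdet : AEMeasurable (fun x => (A x 0 0 * A x 1 1 - A x 0 1 * A x 1 0)⁻¹)
      (volume.restrict Ω) :=
    (((hA.1 0 0).mul (hA.1 1 1)).sub ((hA.1 0 1).mul (hA.1 1 0))).inv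
  have e : ∀ x, invApp A q x = WithLp.toLp 2
      ![(A x 0 0 * A x 1 1 - A x 0 1 * A x 1 0)⁻¹ * (A x 1 1 * q x 0 - A x 0 1 * q x 1),
        (A x 0 0 * A x 1 1 - A x 0 1 * A x 1 0)⁻¹ * (A x 0 0 * q x 1 - A x 1 0 * q x 0)] := by
    intro x
    rw [invApp, app, Matrix.inv_def, Matrix.adjugate_fin_two, Ring.inverse_eq_inv',
      Matrix.det_fin_two]
    congr 1
    ext i
    fin_cases i <;> simp [Matrix.mulVec, dotProduct, Fin.sum_univ_two] <;> ring
  have hmeas : AEStronglyMeasurable (invApp A q) (volume.restrict Ω) := by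
    apply AEMeasurable.aestronglyMeasurable
    rw [funext e]
    apply (PiLp.continuous_toLp 2 (fun _ : Fin 2 => ℝ)).measurable.comp_aemeasurable
    rw [aemeasurable_pi_iff]
    intro i
    fin_cases i
    · exact hdet.mul (((hA.1 1 1).mul (hm 0)).sub ((hA.1 0 1).mul (hm 1)))
    · exact hdet.mul (((hA.1 0 0).mul (hm 1)).sub ((hA.1 1 0).mul (hm 0)))
  apply MemLp.of_le_mul (c := α⁻¹) hq hmeas
  filter_upwards [hA.2] with x hx
  exact norm_inv_app_le hα (fun ξ => (hx.2 ξ).1) (q x)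

/-- Coercivity at the vector `ξ = A⁻¹ q`, for which `A ξ = q`. -/
theorem IsCoefficient.le_energySq (hα : 0 < α) (hA : IsCoefficient Ω α β A) {q : Plane → Plane}
    (hq : MemL2 Ω q) : ∫ x in Ω, ‖invApp A q x‖ ^ 2 ≤ α⁻¹ * energySq Ω A q := by
  have hi := hA.memL2_invApp hα hq
  rw [energySq, ← integral_const_mul]
  apply integral_mono_ae
  · exact hi.integrable_norm_pow (by norm_num)
  · have h1 : Integrable (fun x => inner ℝ (invApp A q x) (q x)) (volume.restrict Ω) := by
      have h2 : ∀ x, inner ℝ (invApp A q x) (q x)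
          = invApp A q x 0 * q x 0 + invApp A q x 1 * q x 1 := by
        intro x
        simp [PiLp.inner_apply, Fin.sum_univ_two, mul_comm]
      simp only [h2]
      exact (integrable_mul_of_memLp (hi.apply 0) (hq.apply 0)).add
        (integrable_mul_of_memLp (hi.apply 1) (hq.apply 1))
    exact h1.const_mul _
  · filter_upwards [hA.2] with x hx
    have h1 := (hx.2 (invApp A q x)).1
    rw [invApp, (inv_app_app hα (fun ξ => (hx.2 ξ).1) (q x)).2] at h1
    rw [inv_mul_eq_div, le_div_iff₀ hα, mul_comm]
    exact h1

/-! ### Sums over the triangulation -/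

theorem Triangulation.sum_setIntegral_le (𝒯 : Triangulation Ω) (hΩ : IsPolygonalDomain Ω)
    {g : Plane → ℝ} (hg : IntegrableOn g Ω) (h0 : ∀ x, 0 ≤ g x) :
    ∑ T ∈ 𝒯.tri, ∫ x in cell T, g x ≤ ∫ x in Ω, g x := by
  have hsub : (⋃ T ∈ 𝒯.tri, cell T) ⊆ Ω := Set.iUnion₂_subset fun T hT => 𝒯.cell_subset hΩ hT
  rw [← integral_biUnion_finset 𝒯.tri (fun T _ => (isOpen_cell T).measurableSet)
    (fun S hS T hT hST => 𝒯.disjoint_cell hS hT hST)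
    (fun T hT => hg.mono_set (𝒯.cell_subset hΩ hT))]
  exact setIntegral_mono_set hg (Eventually.of_forall h0) hsub.eventuallyLE

theorem Triangulation.card_edgesOf (𝒯 : Triangulation Ω) {T : Finset Plane} (hT : T ∈ 𝒯.tri) :
    (edgesOf T).card = 3 := by
  rw [edgesOf, Finset.card_powersetCard, (𝒯.isTriangle T hT).1]
  rfl

open Classical in
-- The estimator visits an edge once for each triangle that has it, at most twice.
theorem Triangulation.sum_edgesOf_le (𝒯 : Triangulation Ω) {F : Finset Plane → ℝ}
    (hF : ∀ E ∈ 𝒯.edges, 0 ≤ F E) :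
    ∑ T ∈ 𝒯.tri, ∑ E ∈ edgesOf T, F E ≤ 2 * ∑ E ∈ 𝒯.edges, F E := by
  have h1 : ∑ T ∈ 𝒯.tri, ∑ E ∈ edgesOf T, F E
      = ∑ E ∈ 𝒯.edges, ∑ T ∈ 𝒯.tri.filter (fun T => E ∈ edgesOf T), F E := by
    apply Finset.sum_comm'
    intro T E
    simp only [Triangulation.edges, Finset.mem_biUnion, Finset.mem_filter]
    constructor
    · rintro ⟨hT, hE⟩
      exact ⟨⟨hT, hE⟩, T, hT, hE⟩
    · rintro ⟨⟨hT, hE⟩, -⟩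
      exact ⟨hT, hE⟩
  rw [h1, Finset.mul_sum]
  apply Finset.sum_le_sum
  intro E hE
  rw [Finset.sum_const, nsmul_eq_mul]
  apply mul_le_mul_of_nonneg_right _ (hF E hE)
  have hE' := hE
  simp only [Triangulation.edges, Finset.mem_biUnion, edgesOf, Finset.mem_powersetCard] at hE'
  obtain ⟨T₀, -, -, hE2⟩ := hE'
  obtain ⟨a, b, hab, rfl⟩ := Finset.card_eq_two.mp hE2
  have h2 := 𝒯.card_filter_le_two hab
  have h3 : (𝒯.tri.filter fun T => {a, b} ∈ edgesOf T).card
      ≤ (𝒯.tri.filter fun T => a ∈ T ∧ b ∈ T).card := by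
    apply Finset.card_le_card
    intro T hT
    simp only [Finset.mem_filter, edgesOf, Finset.mem_powersetCard] at hT ⊢
    exact ⟨hT.1, hT.2.1 (by simp), hT.2.1 (by simp)⟩
  exact_mod_cast h3.trans h2

open Classical in
theorem Triangulation.sum_edges_le (𝒯 : Triangulation Ω) {Y : Finset Plane → ℝ}
    (hY : ∀ T, 0 ≤ Y T) :
    ∑ E ∈ 𝒯.edges, ∑ T ∈ 𝒯.tri.filter (fun T => E ⊆ T), Y T ≤ 3 * ∑ T ∈ 𝒯.tri, Y T := by
  have h1 : ∑ E ∈ 𝒯.edges, ∑ T ∈ 𝒯.tri.filter (fun T => E ⊆ T), Y T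
      = ∑ T ∈ 𝒯.tri, ∑ E ∈ 𝒯.edges.filter (fun E => E ⊆ T), Y T := by
    apply Finset.sum_comm'
    intro E T
    simp only [Finset.mem_filter]
    tauto
  rw [h1, Finset.mul_sum]
  apply Finset.sum_le_sum
  intro T hT
  rw [Finset.sum_const, nsmul_eq_mul]
  apply mul_le_mul_of_nonneg_right _ (hY T)
  have h2 : (𝒯.edges.filter fun E => E ⊆ T).card ≤ (edgesOf T).card := by
    apply Finset.card_le_card
    intro E hE
    simp only [Finset.mem_filter, Triangulation.edges, Finset.mem_biUnion, edgesOf,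
      Finset.mem_powersetCard] at hE ⊢
    obtain ⟨⟨S, -, -, h⟩, hET⟩ := hE
    exact ⟨hET, h⟩
  rw [𝒯.card_edgesOf hT] at h2
  exact_mod_cast h2

/-- The bubble argument accepts any polynomial of the right degree, so this is all it needs to know
about the projection; the default value `0` is covered. -/
theorem isPoly_bestApprox (μ : Measure Plane) (m : ℕ) (g : Plane → ℝ) :
    IsPoly m (bestApprox μ m g) := by
  unfold bestApprox
  split_ifs with h
  · exact h.choose_spec.1
  · exact isPoly_zero m

theorem IsTriangle.exists_vertices {T : Finset Plane} (hT : IsTriangle T) :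
    ∃ a b c, a ≠ b ∧ T = {a, b, c} ∧ det2 (b - a) (c - a) ≠ 0 := by
  obtain ⟨x, hx⟩ := Finset.card_pos.mp (by rw [hT.1]; norm_num : 0 < T.card)
  obtain ⟨a, b, hab, -, -, h, hd⟩ := hT.exists_eq hx
  exact ⟨a, b, x, hab, h, hd⟩

/-! ### The terms of the estimator -/

theorem normSq_real (U : Set Plane) (g : Plane → ℝ) : normSq U g = ∫ x in U, g x ^ 2 := by
  simp [normSq]

/-- Both sides are weak divergences of `p - p_h` in `L²`, and these are unique. -/
theorem weakDiv_error_ae_eq (hΩ : IsOpen Ω) {f : Plane → ℝ} {p ph : Plane → Plane}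
    (hf : MemL2 Ω f) (hp : MemL2 Ω p) (hpf : HasWeakDiv Ω p fun x => -f x) (hph : MemHDiv Ω ph) :
    ∀ᵐ x ∂(volume.restrict Ω), weakDiv Ω (p - ph) x = -(f x + weakDiv Ω ph x) := by
  obtain ⟨hd1, hd2⟩ := hph.weakDiv_spec
  have hs := hpf.sub hd2 hp hph.1 hf.neg hd1
  have hL : MemL2 Ω ((fun x => -f x) - weakDiv Ω ph) := MemLp.sub hf.neg hd1
  have hH : MemHDiv Ω (p - ph) := ⟨hp.sub hph.1, _, hL, hs⟩
  obtain ⟨he1, he2⟩ := hH.weakDiv_spec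
  filter_upwards [he2.unique hΩ hs he1 hL] with x hx
  rw [hx, Pi.sub_apply]
  ring

/-- `∫_T |G - σ|²`. -/
def cellError (σ G : Plane → Plane) (T : Finset Plane) : ℝ :=
  (∫ x in cell T, (G x 0 - σ x 0) ^ 2) + ∫ x in cell T, (G x 1 - σ x 1) ^ 2

theorem cellError_nonneg (σ G : Plane → Plane) (T : Finset Plane) : 0 ≤ cellError σ G T :=
  add_nonneg (integral_sq_nonneg fun x => G x 0 - σ x 0) (integral_sq_nonneg fun x => G x 1 - σ x 1)

theorem exists_curl_estimate (m : ℕ) {c₁ : ℝ} (hc₁ : 0 < c₁) : ∃ C : ℝ, 0 < C ∧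
    ∀ {Ω : Set Plane}, IsPolygonalDomain Ω → ∀ (𝒯 : Triangulation Ω), 𝒯.ShapeRegular c₁ →
      ∀ u, MemH1 Ω u → ∀ σ, 𝒯.PiecewiseH1 σ → ∀ T ∈ 𝒯.tri,
        size T ^ 2 * ∫ x in cell T, weakCurl (cell T) σ x ^ 2
          ≤ C * (cellError σ (weakGrad Ω u) T + size T ^ 2 *
            oscSq (volume.restrict (cell T)) m (weakCurl (cell T) σ)) := by
  obtain ⟨C, hC, H⟩ := exists_curl_bound m c₁
  refine ⟨C, hC, ?_⟩
  intro Ω hΩ 𝒯 hreg u hu σ hσ T hT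
  obtain ⟨a, b, c, hab, rfl, hd⟩ := (𝒯.isTriangle T hT).exists_vertices
  have hsub := 𝒯.cell_subset hΩ hT
  obtain ⟨⟨hc1, hc2⟩, -⟩ := weakCurl_spec (hσ _ hT)
  obtain ⟨hG1, hG2⟩ := hu.weakGrad_spec
  have hGT := hG1.mono_set hsub
  have hGw := hG2.mono hΩ.1.measurableSet hsub
  refine H a b c _ (hreg.isShape hc₁ hT hab hd) (fun x => weakGrad Ω u x - σ x) _
    (fun i => (hGT.apply i).sub (hσ _ hT i).1) hc1 ?_ _ (isPoly_bestApprox _ m _)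
  intro φ hφ
  have h1 := hc2 φ hφ
  have h2 := hGw.integral_curl_eq_zero hGT hφ
  have m1 : ∀ F : Plane → Plane, (∀ i, MemL2 (cell {a, b, c}) fun x => F x i) →
      Integrable (fun x => F x 1 * pderiv 0 φ x - F x 0 * pderiv 1 φ x)
        (volume.restrict (cell {a, b, c})) := fun F hF =>
    (integrable_mul_of_memLp (hF 1) (hφ.pderiv 0).memLp).sub
      (integrable_mul_of_memLp (hF 0) (hφ.pderiv 1).memLp)
  have h3 := integral_sub (m1 _ hGT.apply) (m1 σ fun i => (hσ _ hT i).1)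
  have h4 : ∫ x in cell {a, b, c}, ((weakGrad Ω u x - σ x) 1 * pderiv 0 φ x
      - (weakGrad Ω u x - σ x) 0 * pderiv 1 φ x)
      = ∫ x in cell {a, b, c}, ((weakGrad Ω u x 1 * pderiv 0 φ x - weakGrad Ω u x 0 * pderiv 1 φ x)
        - (σ x 1 * pderiv 0 φ x - σ x 0 * pderiv 1 φ x)) := by
    congr 1; ext x; simp only [PiLp.sub_apply]; ring
  rw [h4, h3, h2]
  linarith

/-- The scalar bound is applied to both components, each of which brings its own copy of the
displacement error; hence the factor `2`. -/
theorem exists_gradResidual_estimate (m : ℕ) {c₁ : ℝ} (hc₁ : 0 < c₁) : ∃ C : ℝ, 0 < C ∧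
    ∀ {Ω : Set Plane}, IsPolygonalDomain Ω → ∀ (𝒯 : Triangulation Ω), 𝒯.ShapeRegular c₁ →
      ∀ u, MemH1 Ω u → ∀ A ph, 𝒯.PiecewiseH1 (invApp A ph) → ∀ l uh, 𝒯.MemL l uh → ∀ T ∈ 𝒯.tri,
        size T ^ 2 * normSq (cell T) (gradResidual A ph uh T)
          ≤ C * (2 * (∫ x in cell T, (u x - uh x) ^ 2)
            + size T ^ 2 * cellError (invApp A ph) (weakGrad Ω u) T
            + size T ^ 2 * ∑ i, oscSq (volume.restrict (cell T)) m
                (fun x => gradResidual A ph uh T x i)) := by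
  obtain ⟨C, hC, H⟩ := exists_gradResidual_bound m c₁
  refine ⟨C, hC, ?_⟩
  intro Ω hΩ 𝒯 hreg u hu A ph hσ l uh huh T hT
  set σ := invApp A ph with hσdef
  obtain ⟨q, hq, hqu⟩ := huh.2 T hT
  obtain ⟨a, b, c, hab, rfl, hd⟩ := (𝒯.isTriangle T hT).exists_vertices
  have hsub := 𝒯.cell_subset hΩ hT
  obtain ⟨hG1, hG2⟩ := hu.weakGrad_spec
  have hGT := hG1.mono_set hsub
  have hGw := hG2.mono hΩ.1.measurableSet hsub
  obtain ⟨hg1, hg2⟩ := (memH1_cell_of_ae_eq_isPoly hq hqu).weakGrad_spec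
  have huT : MemL2 (cell {a, b, c}) u := hu.1.mono_set hsub
  have huhT : MemL2 (cell {a, b, c}) uh := huh.1.mono_set hsub
  have mρ : ∀ i, MemL2 (cell {a, b, c}) fun x => gradResidual A ph uh {a, b, c} x i := fun i =>
    (hσ _ hT i).1.sub (hg1.apply i)
  have mε : ∀ i, MemL2 (cell {a, b, c}) fun x => weakGrad Ω u x i - σ x i := fun i =>
    (hGT.apply i).sub (hσ _ hT i).1
  have key : ∀ i, size {a, b, c} ^ 2 * ∫ x in cell {a, b, c}, gradResidual A ph uh {a, b, c} x i ^ 2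
      ≤ C * ((∫ x in cell {a, b, c}, (u x - uh x) ^ 2)
        + size {a, b, c} ^ 2 * (∫ x in cell {a, b, c}, (weakGrad Ω u x i - σ x i) ^ 2)
        + size {a, b, c} ^ 2 * oscSq (volume.restrict (cell {a, b, c})) m
            (fun x => gradResidual A ph uh {a, b, c} x i)) := by
    intro i
    refine H a b c _ (hreg.isShape hc₁ hT hab hd) i (fun x => weakGrad Ω u x i - σ x i)
      (fun x => u x - uh x) _ (mε i) (huT.sub huhT) (mρ i) ?_ _ (isPoly_bestApprox _ m _)
    intro φ hφ
    have h1 := hGw φ hφ i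
    have h2 := hg2 φ hφ i
    have e1 := integral_sub (integrable_mul_of_memLp huT ((hφ.pderiv i).memLp))
      (integrable_mul_of_memLp huhT ((hφ.pderiv i).memLp))
    have mφ := hφ.memLp (V := cell {a, b, c})
    have e2 := integral_sub (integrable_mul_of_memLp (hGT.apply i) mφ)
      (integrable_mul_of_memLp (hσ _ hT i).1 mφ)
    have e3 := integral_sub (integrable_mul_of_memLp (hσ _ hT i).1 mφ)
      (integrable_mul_of_memLp (hg1.apply i) mφ)
    simp only [gradResidual, PiLp.sub_apply, sub_mul]
    rw [e1, e2, e3]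
    linarith
  have e : normSq (cell {a, b, c}) (gradResidual A ph uh {a, b, c})
      = (∫ x in cell {a, b, c}, gradResidual A ph uh {a, b, c} x 0 ^ 2)
        + ∫ x in cell {a, b, c}, gradResidual A ph uh {a, b, c} x 1 ^ 2 := by
    rw [normSq, ← integral_add (mρ 0).integrable_sq (mρ 1).integrable_sq]
    simp only [norm_sq_plane]
  rw [e, Fin.sum_univ_two, cellError]
  linarith [key 0, key 1]

end MixedFEM

end

/-! ### The efficiency estimate -/

theorem theorem3p4 (Ω : Set Plane) (hΩ : IsPolygonalDomain Ω)
    (α β : ℝ) (hα : 0 < α) (hαβ : α ≤ β) (c₁ : ℝ) (hc₁ : 0 < c₁)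
    (fam : Family) (l n : ℕ) (hn : l + 1 ≤ n) :
    ∃ C : ℝ, 0 < C ∧
      ∀ (A : Plane → Matrix (Fin 2) (Fin 2) ℝ) (f : Plane → ℝ) (p : Plane → Plane) (u : Plane → ℝ)
        (κ : ℝ) (𝒯 : Triangulation Ω) (ph : Plane → Plane) (uh : Plane → ℝ)
        (γ : Finset Plane → Finset Plane → Plane → Plane),
        IsCoefficient Ω α β A → MemL2 Ω f → IsSolution Ω A f p u → 0 ≤ κ → κ ≤ 1 →
        𝒯.ShapeRegular c₁ → 𝒯.IsDiscreteSolution fam l A f ph uh →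
        𝒯.PiecewiseH1 (invApp A ph) → 𝒯.IsTraceFamily (invApp A ph) γ →
        𝒯.etaSq κ A f ph uh γ ≤
          C * (energySq Ω A (p - ph) + 𝒯.weightedNormSq κ (weakDiv Ω (p - ph))
            + normSq Ω (u - uh) + 𝒯.dataOscSq n A ph uh γ) := by
  classical
  obtain ⟨C₂, hC₂, H₂⟩ := exists_curl_estimate n hc₁
  obtain ⟨C₃, hC₃, H₃⟩ := exists_jump_bound (n + 1) hc₁
  obtain ⟨C₄, hC₄, H₄⟩ := exists_gradResidual_estimate n hc₁
  set D := Metric.diam (closure Ω) with hD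
  -- The coefficient of the total error `Z` at the end: `1` for the equilibrium residual, `C₂ (1 +
  -- α⁻¹)` for the curl, the `C₃` terms for the jumps, in which `6` is two triangles per edge times
  -- three edges per triangle, and the `C₄` terms for the gradient residual.
  refine ⟨1 + (1 + 6 * C₃) * C₂ * (1 + α⁻¹) + 6 * C₃ * α⁻¹ + 2 * C₃ + 2 * C₄ + C₄ * D ^ 2 * α⁻¹,
    by positivity, ?_⟩
  intro A f p u κ 𝒯 ph uh γ hA hf hsol hκ0 hκ1 hreg hdisc hσ hγ
  obtain ⟨hu, hp, hpu, hpf⟩ := hsol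
  obtain ⟨hph, huh, -, -⟩ := hdisc
  set σ := invApp A ph with hσdef
  set G := weakGrad Ω u with hGdef
  obtain ⟨hG1, -⟩ := hu.1.weakGrad_spec
  have hσ2 : MemL2 Ω σ := hA.memL2_invApp hα hph.1.1
  have hL2 : MemL2 Ω (p - ph) := hp.1.sub hph.1.1
  -- the error of the flux
  have hEE : ∑ T ∈ 𝒯.tri, cellError σ G T ≤ α⁻¹ * energySq Ω A (p - ph) := by
    have m0 : ∀ i, MemL2 Ω fun x => G x i - σ x i := fun i => (hG1.apply i).sub (hσ2.apply i)
    have h1 : ∑ T ∈ 𝒯.tri, cellError σ G T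
        ≤ (∫ x in Ω, (G x 0 - σ x 0) ^ 2) + ∫ x in Ω, (G x 1 - σ x 1) ^ 2 := by
      simp only [cellError]
      rw [Finset.sum_add_distrib]
      exact add_le_add
        (𝒯.sum_setIntegral_le hΩ (m0 0).integrable_sq fun x => sq_nonneg _)
        (𝒯.sum_setIntegral_le hΩ (m0 1).integrable_sq fun x => sq_nonneg _)
    refine h1.trans ((le_of_eq ?_).trans (hA.le_energySq hα hL2))
    rw [← integral_add (m0 0).integrable_sq (m0 1).integrable_sq]
    apply integral_congr_ae
    filter_upwards [hA.2, hpu] with x hx hxp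
    -- `A⁻¹ p = ∇u`, so the energy error of the flux controls `∇u - σ`.
    have e : invApp A (p - ph) x = G x - σ x := by
      simp only [hσdef, invApp, Pi.sub_apply]
      rw [app_sub, hxp, (inv_app_app hα (fun ξ => (hx.2 ξ).1) (G x)).1]
    rw [e, norm_sq_plane]
    rfl
  -- the error of the displacement
  have hW : ∑ T ∈ 𝒯.tri, ∫ x in cell T, (u x - uh x) ^ 2 ≤ normSq Ω (u - uh) := by
    rw [normSq_real]
    exact 𝒯.sum_setIntegral_le hΩ (hu.1.1.sub huh.1).integrable_sq fun x => sq_nonneg _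
  -- the residual of the equilibrium equation
  have hT1 : ∑ T ∈ 𝒯.tri, normSq (cell T) (fun x => size T ^ κ * (f x + weakDiv Ω ph x))
      = 𝒯.weightedNormSq κ (weakDiv Ω (p - ph)) := by
    apply Finset.sum_congr rfl
    intro T hT
    rw [normSq_real, normSq_real]
    apply integral_congr_ae
    filter_upwards [ae_restrict_of_ae_restrict_of_subset (𝒯.cell_subset hΩ hT)
      (weakDiv_error_ae_eq hΩ.1 hf hp.1 hpf hph.1)] with x hx
    rw [hx]
    ring
  -- the curl residual
  have hT2 : ∑ T ∈ 𝒯.tri, size T ^ 2 * (∫ x in cell T, weakCurl (cell T) σ x ^ 2)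
      ≤ C₂ * ((∑ T ∈ 𝒯.tri, cellError σ G T) + ∑ T ∈ 𝒯.tri, size T ^ 2 *
        oscSq (volume.restrict (cell T)) n (weakCurl (cell T) σ)) := by
    rw [← Finset.sum_add_distrib, Finset.mul_sum]
    exact Finset.sum_le_sum fun T hT => H₂ hΩ 𝒯 hreg u hu.1 σ hσ T hT
  -- the jumps
  have hsize : ∀ T : Finset Plane, 0 ≤ size T := fun T => Metric.diam_nonneg
  have hosc : ∀ (μ : Measure Plane) (m : ℕ) (g : Plane → ℝ), 0 ≤ oscSq μ m g :=
    fun μ m g => integral_sq_nonneg fun x => g x - bestApprox μ m g x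
  have hT3 : ∑ T ∈ 𝒯.tri, ∑ E ∈ edgesOf T, size E * ∫ x, 𝒯.tangentialJump γ E x ^ 2 ∂(arc (hull E))
      ≤ 2 * (C₃ * (3 * ((∑ T ∈ 𝒯.tri, size T ^ 2 * (∫ x in cell T, weakCurl (cell T) σ x ^ 2))
          + ∑ T ∈ 𝒯.tri, cellError σ G T)
        + ∑ E ∈ 𝒯.edges, size E * oscSq (arc (hull E)) (n + 1) (𝒯.tangentialJump γ E))) := by
    refine (𝒯.sum_edgesOf_le fun E _ => mul_nonneg (hsize E) (integral_sq_nonneg _)).trans ?_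
    have h1 := Finset.sum_le_sum fun E (hE : E ∈ 𝒯.edges) => H₃ hΩ 𝒯 hreg u hu σ hσ γ hγ E hE _
      (isPoly_bestApprox (arc (hull E)) (n + 1) (𝒯.tangentialJump γ E))
    rw [← Finset.mul_sum, Finset.sum_add_distrib] at h1
    have h2 := 𝒯.sum_edges_le (Y := edgeControl σ G) (edgeControl_nonneg σ G)
    have h3 : ∑ T ∈ 𝒯.tri, edgeControl σ G T
        = (∑ T ∈ 𝒯.tri, size T ^ 2 * (∫ x in cell T, weakCurl (cell T) σ x ^ 2))
          + ∑ T ∈ 𝒯.tri, cellError σ G T := by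
      rw [← Finset.sum_add_distrib]
      exact Finset.sum_congr rfl fun T _ => by rw [edgeControl, cellError, add_assoc]
    rw [h3] at h2
    refine mul_le_mul_of_nonneg_left (h1.trans ?_) zero_le_two
    refine mul_le_mul_of_nonneg_left (add_le_add h2 le_rfl) hC₃.le
  -- the gradient residual
  have hT4 : ∑ T ∈ 𝒯.tri, size T ^ 2 * normSq (cell T) (gradResidual A ph uh T)
      ≤ C₄ * (2 * (∑ T ∈ 𝒯.tri, ∫ x in cell T, (u x - uh x) ^ 2)
        + D ^ 2 * (∑ T ∈ 𝒯.tri, cellError σ G T)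
        + ∑ T ∈ 𝒯.tri, size T ^ 2 * ∑ i, oscSq (volume.restrict (cell T)) n
            (fun x => gradResidual A ph uh T x i)) := by
    rw [Finset.mul_sum, Finset.mul_sum, ← Finset.sum_add_distrib, ← Finset.sum_add_distrib,
      Finset.mul_sum]
    apply Finset.sum_le_sum
    intro T hT
    refine (H₄ hΩ 𝒯 hreg u hu.1 A ph hσ l uh huh T hT).trans ?_
    -- Here the dependence of the constant on the diameter of `Ω` enters.
    have hDT : size T ^ 2 ≤ D ^ 2 := pow_le_pow_left₀ (hsize T) (𝒯.size_le hΩ hT) 2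
    have := cellError_nonneg σ G T
    gcongr
  have heta : 𝒯.etaSq κ A f ph uh γ
      = (∑ T ∈ 𝒯.tri, normSq (cell T) (fun x => size T ^ κ * (f x + weakDiv Ω ph x)))
        + (∑ T ∈ 𝒯.tri, size T ^ 2 * (∫ x in cell T, weakCurl (cell T) σ x ^ 2))
        + (∑ T ∈ 𝒯.tri, ∑ E ∈ edgesOf T,
            size E * ∫ x, 𝒯.tangentialJump γ E x ^ 2 ∂(arc (hull E)))
        + ∑ T ∈ 𝒯.tri, size T ^ 2 * normSq (cell T) (gradResidual A ph uh T) := by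
    rw [← Finset.sum_add_distrib, ← Finset.sum_add_distrib, ← Finset.sum_add_distrib]
    apply Finset.sum_congr rfl
    intro T _
    rw [Triangulation.etaLocalSq, normSq_real (cell T) (weakCurl (cell T) (invApp A ph))]
  have hE0 : 0 ≤ ∑ T ∈ 𝒯.tri, cellError σ G T :=
    Finset.sum_nonneg fun T _ => cellError_nonneg σ G T
  have hW0 : 0 ≤ ∑ T ∈ 𝒯.tri, ∫ x in cell T, (u x - uh x) ^ 2 :=
    Finset.sum_nonneg fun T _ => integral_sq_nonneg fun x => u x - uh x
  have hO1 : 0 ≤ ∑ T ∈ 𝒯.tri, size T ^ 2 *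
      oscSq (volume.restrict (cell T)) n (weakCurl (cell T) σ) :=
    Finset.sum_nonneg fun T _ => mul_nonneg (sq_nonneg _) (hosc _ _ _)
  have hO2 : 0 ≤ ∑ E ∈ 𝒯.edges, size E * oscSq (arc (hull E)) (n + 1) (𝒯.tangentialJump γ E) :=
    Finset.sum_nonneg fun E _ => mul_nonneg (hsize E) (hosc _ _ _)
  have hO3 : 0 ≤ ∑ T ∈ 𝒯.tri, size T ^ 2 * ∑ i, oscSq (volume.restrict (cell T)) n
      (fun x => gradResidual A ph uh T x i) :=
    Finset.sum_nonneg fun T _ => mul_nonneg (sq_nonneg _) (Finset.sum_nonneg fun i _ => hosc _ _ _)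
  have hR0 : 0 ≤ 𝒯.weightedNormSq κ (weakDiv Ω (p - ph)) :=
    Finset.sum_nonneg fun T _ => integral_nonneg fun x => sq_nonneg _
  rw [heta, hT1, Triangulation.dataOscSq, ← hσdef]
  set EE := ∑ T ∈ 𝒯.tri, cellError σ G T
  set W := ∑ T ∈ 𝒯.tri, ∫ x in cell T, (u x - uh x) ^ 2
  set T₂ := ∑ T ∈ 𝒯.tri, size T ^ 2 * (∫ x in cell T, weakCurl (cell T) σ x ^ 2)
  set O₁ := ∑ T ∈ 𝒯.tri, size T ^ 2 *
      oscSq (volume.restrict (cell T)) n (weakCurl (cell T) σ)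
  set O₂ := ∑ E ∈ 𝒯.edges, size E * oscSq (arc (hull E)) (n + 1) (𝒯.tangentialJump γ E)
  set O₃ := ∑ T ∈ 𝒯.tri, size T ^ 2 * ∑ i, oscSq (volume.restrict (cell T)) n
      (fun x => gradResidual A ph uh T x i)
  set R := 𝒯.weightedNormSq κ (weakDiv Ω (p - ph))
  set e := energySq Ω A (p - ph)
  set N := normSq Ω (u - uh)
  have hα' : 0 < α⁻¹ := inv_pos.mpr hα
  -- Follows from the flux bound, since `α⁻¹ e` dominates a nonnegative sum.
  have he0 : 0 ≤ e := by
    by_contra h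
    have := mul_neg_of_pos_of_neg hα' (not_le.mp h)
    linarith
  have hN0 : 0 ≤ N := hW0.trans hW
  set Z := e + R + N + (O₁ + O₂ + O₃) with hZ
  have hEZ : EE ≤ α⁻¹ * Z := hEE.trans (mul_le_mul_of_nonneg_left (by linarith) hα'.le)
  have h2 : T₂ ≤ C₂ * (1 + α⁻¹) * Z := by
    calc T₂ ≤ C₂ * (EE + O₁) := hT2
      _ ≤ C₂ * (α⁻¹ * Z + Z) := by gcongr; linarith
      _ = _ := by ring
  have h3 : 2 * (C₃ * (3 * (T₂ + EE) + O₂)) ≤ 2 * (C₃ * (3 * (C₂ * (1 + α⁻¹) * Z + α⁻¹ * Z) + Z)) := by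
    gcongr; linarith
  -- `O₃` is a part of `Z - N`; the factor `2` makes `2 N + 2 (Z - N)` collapse to `2 Z`.
  have h4 : C₄ * (2 * W + D ^ 2 * EE + O₃) ≤ C₄ * (2 * N + D ^ 2 * (α⁻¹ * Z) + 2 * (Z - N)) := by
    gcongr; linarith
  calc _ ≤ Z + C₂ * (1 + α⁻¹) * Z + 2 * (C₃ * (3 * (C₂ * (1 + α⁻¹) * Z + α⁻¹ * Z) + Z))
        + C₄ * (2 * N + D ^ 2 * (α⁻¹ * Z) + 2 * (Z - N)) := by
        gcongr
        · linarith
        · exact hT3.trans h3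
        · exact hT4.trans h4
    _ = _ := by ring
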